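/- Let $d\in\{2,3\}$, $T>0$, let $D\subset\mathbb{R}^d$ be open and bounded, and let $\Omega_0$ be open with $C^2$ boundary and $\overline{\Omega_0}\subset D$. Let $\mathrm w\in C^1([0,T];C^k_c(D;\mathbb{R}^d))$, $k\ge 2$, have support in a fixed compact subset of $D$ and satisfy $\operatorname{div}\mathrm w=0$ in $[0,T]\times D$. Let $\Phi_t$ be its flow, $\frac{d}{dt}\Phi_t=\mathrm w(t,\Phi_t)$, $\Phi_0=\mathrm{Id}$, and $\Omega(t)=\Phi_t(\Omega_0)$. **Spaces.** Let $H(t)$ be the space of $u\in L^2(\Omega(t);\mathbb{R}^d)$ with $\int_{\Omega(t)}u\cdot\nabla q=0$ for all $q\in C^1_c(\Omega(t))$, with the $L^2$ inner product. Let $V(t)=\{u\in H^1_0(\Omega(t);\mathbb{R}^d):\operatorname{div}u=0\}$, with $(u,v)_{V(t)}=\int_{\Omega(t)}Du:Dv+u\cdot v$. Let $V^*(t)$ be the space of $f\in H^{-1}(\Omega(t);\mathbb{R}^d)$ with $\langle f,\nabla q\rangle=0$ for all $q\in C_c^1(\Omega(t))$ such that $\nabla q\in H^1_0$, with the $H^{-1}$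 norm. Write $V_0,H_0,V_0^*$ for the corresponding spaces on $\Omega_0$. Put $\phi_{-t}u=D\Phi_t^{-1}\,(u\circ\Phi_t)$, and for $f\in V^*(t)$ define $\phi_{-t}f$ by $\langle\phi_{-t}f,\eta\rangle=\langle f,(D\Phi_t^{-T}\eta)\circ\Phi_t^{-1}\rangle$, $\eta\in H^1_0(\Omega_0;\mathbb{R}^d)$. For $X\in\{V,H,V^*\}$, $L^2_X$ is the set of families $u(t)\in X(t)$ with $\phi_{-(\cdot)}u(\cdot)\in L^2(0,T;X_0)$. **Assumption on the advecting field.** $\mathrm V$ is a time-dependent vector field such that either $\mathrm V\circ\Phi_{(\cdot)}\in L^\infty(0,T;L^p(\Omega_0))$ with $p\ge d$ and, for a.e. $t$, $\operatorname{div}\mathrm V(t)=0$ weakly in $\Omega(t)$; or $\mathrm V\circ\Phi_{(\cdot)}\in L^\infty(0,T;L^\infty(\Omega_0))$ (set $p=\infty$ in this case). **Forms.** Define $$\lambda(t;u,v)=\int_{\Omega(t)}u\cdot\Big(D\Phi_t^{-T}\tfrac{d}{dt}(D\Phi_t^TD\Phi_t)D\Phi_t^{-1}\Big)\circ\Phi_t^{-1}v\quad(u,v\in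 H(t)),$$ $$l(t;f,v)=\langle f,v\rangle\quad (f\in V^*(t),\ v\in V(t)),$$ and, for $u,v\in V(t)$, $$a(t;u,v)=(u,v)_{V(t)}-(u,v)_{H(t)}+\big(((\mathrm V-\mathrm w)\cdot\nabla)u,v\big)_{H(t)}-\Big(\big(D\Phi_t\tfrac{d}{dt}(D\Phi_t^{-1})\big)\circ\Phi_t^{-1}u,v\Big)_{H(t)}-\lambda(t;u,v).$$ Here the convective term is the pairing of $H^{-1}(\Omega(t))$ with $H^1_0(\Omega(t))$ that extends the $L^2$ inner product, i.e. the value at $v$ of the continuous extension of $\varphi\mapsto\int_{\Omega(t)}((\mathrm V-\mathrm w)\cdot\nabla)u\cdot\varphi$ from $C_c^\infty(\Omega(t);\mathbb{R}^d)$ to $H_0^1(\Omega(t);\mathbb{R}^d)$. **Claim.** Under these assumptions the following hold. 0. (The forms are well defined.) For every $t\in(0,T)$ the integrals in $\lambda$ and in the fourth term of $a$ converge absolutely for all $u,v\in L^2(\Omega(t);\mathbb{R}^d)$. For a.e. $t\in(0,T)$ and all $u\in V(t)$, $((\mathrm V-\mathrm w)\cdot\nabla)u\in L^1(\Omega(t))\cap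 H^{-1}(\Omega(t))$; moreover, except possibly when $d=p=2$, for all $v\in V(t)$ the convective term is the absolutely convergent integral $\int_{\Omega(t)}((\mathrm V-\mathrm w)\cdot\nabla)u\cdot v$. 1. The maps $t\mapsto a(t;u(t),v(t))$ for $u,v\in L^2_V$, $t\mapsto\lambda(t;u(t),v(t))$ for $u,v\in L^2_H$, and $t\mapsto l(t;f(t),v(t))$ for $(f,v)\in L^2_{V^*}\times L^2_V$ are Lebesgue measurable on $(0,T)$. 2. The forms $a,\lambda,l$ are bilinear and bounded uniformly in $t$: there is $C$ independent of $t$ with $|\lambda(t;u,v)|\le C\|u\|_{H(t)}\|v\|_{H(t)}$ and $|l(t;f,v)|\le C\|f\|_{V^*(t)}\|v\|_{V(t)}$ for all $t\in(0,T)$, and $|a(t;u,v)|\le C\|u\|_{V(t)}\|v\|_{V(t)}$ for a.e. $t\in(0,T)$, for all elements of the respective spaces. 3. There are $C_1,C_2>0$ such that for a.e. $t\in(0,T)$ and all $u\in V(t)$, $$a(t;u,u)\ge C_1\|u\|_{V(t)}^2-C_2\|u\|_{H(t)}^2.$$ -/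

import Mathlib

open MeasureTheory Set Topology
open scoped ENNReal ContDiff RealInnerProductSpace

noncomputable section

namespace MovingStokes

/-- Euclidean space `ℝ^d`. -/
abbrev Vec (d : ℕ) : Type := EuclideanSpace ℝ (Fin d)

/-- `d × d` matrices with the Frobenius inner product `A : B = ∑ i j, A i j * B i j`. -/
abbrev Mat (d : ℕ) : Type := EuclideanSpace ℝ (Fin d × Fin d)

variable {d : ℕ}

/-! ### Classical differential operators and domains -/

/-- The Jacobian matrix of `f` at `x`; the entry `(i, j)` is `∂_j f_i`. -/
def jacobian (f : Vec d → Vec d) (x : Vec d) : Mat d :=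
  WithLp.toLp 2 fun ij => fderiv ℝ f x (EuclideanSpace.single ij.2 1) ij.1

/-- Classical divergence. -/
def divergence (f : Vec d → Vec d) (x : Vec d) : ℝ :=
  ∑ i, fderiv ℝ f x (EuclideanSpace.single i 1) i

/-- `Ω` lies locally on one side of its boundary, which is locally the zero set of a `C²` function
with nonvanishing gradient. -/
def HasC2Boundary (Ω : Set (Vec d)) : Prop :=
  ∀ x ∈ frontier Ω, ∃ U : Set (Vec d), IsOpen U ∧ x ∈ U ∧ ∃ ρ : Vec d → ℝ,
    ContDiffOn ℝ 2 ρ U ∧ fderiv ℝ ρ x ≠ 0 ∧ Ω ∩ U = {y | y ∈ U ∧ ρ y < 0}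

/-- `q ∈ C¹_c(Ω; ℝ)`. -/
def IsC1c (Ω : Set (Vec d)) (q : Vec d → ℝ) : Prop :=
  ContDiff ℝ 1 q ∧ HasCompactSupport q ∧ tsupport q ⊆ Ω

/-- `φ ∈ C^∞_c(Ω; ℝ^d)`. -/
def IsTest (Ω : Set (Vec d)) (φ : Vec d → Vec d) : Prop :=
  ContDiff ℝ ∞ φ ∧ HasCompactSupport φ ∧ tsupport φ ⊆ Ω

/-! ### Function spaces on a fixed domain -/

/-- `L²(Ω; ℝ^d)`. -/
abbrev L2 (Ω : Set (Vec d)) : Type := Lp (Vec d) 2 (volume.restrict Ω)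

/-- `L²(Ω; ℝ^d) × L²(Ω; ℝ^{d×d})` with the Hilbert product inner product. -/
abbrev L2Pair (Ω : Set (Vec d)) : Type :=
  WithLp 2 (Lp (Vec d) 2 (volume.restrict Ω) × Lp (Mat d) 2 (volume.restrict Ω))

/-- `H¹₀(Ω; ℝ^d)`, the closure of `C^∞_c(Ω; ℝ^d)` for the norm `(∫ |Du|² + |u|²)^{1/2}`.
A function `u` is stored as the pair `(u, Du)` of the function and its weak Jacobian, so that the
inner product is `∫ Du : Dv + u · v`. -/
def H10Sub (Ω : Set (Vec d)) : Submodule ℝ (L2Pair Ω) :=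
  (Submodule.span ℝ {p : L2Pair Ω | ∃ φ : Vec d → Vec d, IsTest Ω φ ∧
    p.fst =ᵐ[volume.restrict Ω] φ ∧ p.snd =ᵐ[volume.restrict Ω] jacobian φ}).topologicalClosure

/-- The type of elements of `H¹₀(Ω; ℝ^d)`, a Hilbert space. -/
def H10 (Ω : Set (Vec d)) : Type := H10Sub Ω

instance instNormedAddCommGroupH10 (Ω : Set (Vec d)) : NormedAddCommGroup (H10 Ω) :=
  inferInstanceAs (NormedAddCommGroup (H10Sub Ω))

instance instInnerProductSpaceH10 (Ω : Set (Vec d)) : InnerProductSpace ℝ (H10 Ω) :=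
  inferInstanceAs (InnerProductSpace ℝ (H10Sub Ω))

/-- The function underlying an element of `H¹₀`. -/
def fnH {Ω : Set (Vec d)} (u : H10 Ω) : L2 Ω := (Subtype.val u : L2Pair Ω).fst

/-- The weak Jacobian of an element of `H¹₀`. -/
def jacH {Ω : Set (Vec d)} (u : H10 Ω) : Lp (Mat d) 2 (volume.restrict Ω) :=
  (Subtype.val u : L2Pair Ω).snd

/-- The space `V(Ω)` of divergence free functions in `H¹₀(Ω; ℝ^d)`, with the inner product of
`H¹₀`. -/
def VSp (Ω : Set (Vec d)) : Submodule ℝ (H10 Ω) where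
  carrier := {u | ∀ᵐ x ∂(volume.restrict Ω), ∑ i, jacH u x (i, i) = 0}
  zero_mem' := by
    have h : (jacH (0 : H10 Ω)) = 0 := rfl
    simp only [mem_ofPred_eq, h]
    filter_upwards [Lp.coeFn_zero (Mat d) 2 (volume.restrict Ω)] with x hx
    rw [hx]
    simp only [Pi.zero_apply, PiLp.zero_apply, Finset.sum_const_zero]
  add_mem' := by
    intro u v hu hv
    have h : (jacH (u + v)) = jacH u + jacH v := rfl
    simp only [mem_ofPred_eq, h] at hu hv ⊢
    filter_upwards [hu, hv, Lp.coeFn_add (jacH u) (jacH v)] with x h1 h2 h3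
    rw [h3]
    simp only [Pi.add_apply, PiLp.add_apply, Finset.sum_add_distrib, h1, h2, add_zero]
  smul_mem' := by
    intro c u hu
    have h : (jacH (c • u)) = c • jacH u := rfl
    simp only [mem_ofPred_eq, h] at hu ⊢
    filter_upwards [hu, Lp.coeFn_smul c (jacH u)] with x h1 h2
    simp [h2, ← Finset.mul_sum, h1]

/-- The function underlying an element of `V(Ω)`. -/
def fnV {Ω : Set (Vec d)} (u : VSp Ω) : L2 Ω := fnH (u : H10 Ω)

/-- The weak Jacobian of an element of `V(Ω)`. -/
def jacV {Ω : Set (Vec d)} (u : VSp Ω) : Lp (Mat d) 2 (volume.restrict Ω) :=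
  jacH (u : H10 Ω)

/-- A vector field `b` is weakly divergence free in `Ω`: `∫_Ω b · ∇q = 0` for `q ∈ C¹_c(Ω)`. -/
def WeaklyDivFree (Ω : Set (Vec d)) (b : Vec d → Vec d) : Prop :=
  ∀ q : Vec d → ℝ, IsC1c Ω q → ∫ x in Ω, ⟪b x, gradient q x⟫ = 0

theorem integrable_inner_gradient {Ω : Set (Vec d)} (u : L2 Ω) {q : Vec d → ℝ} (hq : IsC1c Ω q) :
    Integrable (fun x => ⟪u x, gradient q x⟫) (volume.restrict Ω) := by
  have hc : Continuous (gradient q) :=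
    (InnerProductSpace.toDual ℝ (Vec d)).symm.continuous.comp (hq.1.continuous_fderiv (by simp))
  have hs : HasCompactSupport (gradient q) :=
    (hq.2.1.fderiv (𝕜 := ℝ)).comp_left (map_zero _)
  have hm : MemLp (gradient q) 2 (volume.restrict Ω) := hc.memLp_of_hasCompactSupport hs
  refine (L2.integrable_inner (𝕜 := ℝ) u (hm.toLp _)).congr ?_
  filter_upwards [hm.coeFn_toLp] with x hx
  rw [hx]

/-- The space `H(Ω)` of weakly divergence free functions in `L²(Ω; ℝ^d)`, with the inner product
of `L²`. -/
def HSp (Ω : Set (Vec d)) : Submodule ℝ (L2 Ω) where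
  carrier := {u | WeaklyDivFree Ω u}
  zero_mem' := by
    intro q _
    have : ∀ᵐ x ∂(volume.restrict Ω), ⟪(0 : L2 Ω) x, gradient q x⟫ = 0 := by
      filter_upwards [Lp.coeFn_zero (Vec d) 2 (volume.restrict Ω)] with x hx
      rw [hx]
      exact inner_zero_left _
    rw [integral_congr_ae this]
    simp
  add_mem' := by
    intro u v hu hv q hq
    have : ∀ᵐ x ∂(volume.restrict Ω), ⟪(u + v) x, gradient q x⟫
        = ⟪u x, gradient q x⟫ + ⟪v x, gradient q x⟫ := by
      filter_upwards [Lp.coeFn_add u v] with x hx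
      rw [hx]
      exact inner_add_left _ _ _
    rw [integral_congr_ae this, integral_add (integrable_inner_gradient u hq)
      (integrable_inner_gradient v hq), hu q hq, hv q hq, add_zero]
  smul_mem' := by
    intro c u hu q hq
    have : ∀ᵐ x ∂(volume.restrict Ω), ⟪(c • u) x, gradient q x⟫
        = c * ⟪u x, gradient q x⟫ := by
      filter_upwards [Lp.coeFn_smul c u] with x hx
      rw [hx]
      exact real_inner_smul_left _ _ _
    rw [integral_congr_ae this, integral_const_mul, hu q hq, mul_zero]

/-- The space `V*(Ω)` of weakly divergence free elements of `H^{-1}(Ω; ℝ^d)`: the continuous linear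
functionals on `H¹₀(Ω; ℝ^d)` that vanish at every gradient `∇q ∈ H¹₀`, `q ∈ C¹_c(Ω)`. The norm is
that of `H^{-1}`. -/
def VStar (Ω : Set (Vec d)) : Submodule ℝ (StrongDual ℝ (H10 Ω)) where
  carrier := {ℓ | ∀ q : Vec d → ℝ, IsC1c Ω q → ∀ g : H10 Ω,
    fnH g =ᵐ[volume.restrict Ω] gradient q → ℓ g = 0}
  zero_mem' := by intro q _ g _; simp
  add_mem' := by
    intro a b ha hb q hq g hg
    simp [ha q hq g hg, hb q hq g hg]
  smul_mem' := by
    intro c a ha q hq g hg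
    simp [ha q hq g hg]

/-- `ℓ ∈ H^{-1}(Ω)` is the distribution given by the function `f`: `⟨ℓ, φ⟩ = ∫_Ω f · φ` for all
`φ ∈ C^∞_c(Ω; ℝ^d)`. -/
def Represents (Ω : Set (Vec d)) (f : Vec d → Vec d) (ℓ : StrongDual ℝ (H10 Ω)) : Prop :=
  ∀ φ : Vec d → Vec d, IsTest Ω φ → ∀ g : H10 Ω, fnH g =ᵐ[volume.restrict Ω] φ →
    ℓ g = ∫ x in Ω, ⟪f x, φ x⟫

open Classical in
/-- The extension `(f, v)` of the `L²(Ω)` inner product to `f ∈ H^{-1}(Ω)`, `v ∈ H¹₀(Ω)`, for a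
distribution `f` that is a function: the value at `v` of the (unique) continuous extension of
`φ ↦ ∫_Ω f · φ` from `C^∞_c(Ω; ℝ^d)` to `H¹₀(Ω; ℝ^d)` (and `0` if there is none). -/
def pairing (Ω : Set (Vec d)) (f : Vec d → Vec d) (v : H10 Ω) : ℝ :=
  if h : ∃ ℓ : StrongDual ℝ (H10 Ω), Represents Ω f ℓ then h.choose v else 0

/-! ### The flow and the Piola transforms -/

/-- `γ` solves `γ' = w(t, γ)` on `[0, T]` with `γ(0) = x`. -/
def IsIntegralCurve (w : ℝ → Vec d → Vec d) (T : ℝ) (x : Vec d) (γ : ℝ → Vec d) : Prop :=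
  γ 0 = x ∧ ∀ t ∈ Icc 0 T, HasDerivWithinAt γ (w t (γ t)) (Icc 0 T) t

/-- The flow map `Φ_t(x)` of `w`, for `t ∈ [0, T]`. -/
def flow (w : ℝ → Vec d → Vec d) (T t : ℝ) (x : Vec d) : Vec d :=
  Classical.epsilon (IsIntegralCurve w T x) t

/-- `Φ_t⁻¹`. -/
def flowInv (Φ : ℝ → Vec d → Vec d) (t : ℝ) : Vec d → Vec d := Function.invFun (Φ t)

/-- `DΦ_t(x)`. -/
def DΦ (Φ : ℝ → Vec d → Vec d) (t : ℝ) (x : Vec d) : Vec d →L[ℝ] Vec d := fderiv ℝ (Φ t) x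

/-- `DΦ_t(x)⁻¹`. -/
def DΦinv (Φ : ℝ → Vec d → Vec d) (t : ℝ) (x : Vec d) : Vec d →L[ℝ] Vec d := (DΦ Φ t x).inverse

/-- The inverse (contravariant) Piola transform `φ_{-t} u = DΦ_t⁻¹ (u ∘ Φ_t)`. -/
def piolaInv (Φ : ℝ → Vec d → Vec d) (t : ℝ) (u : Vec d → Vec d) (x : Vec d) : Vec d :=
  DΦinv Φ t x (u (Φ t x))

/-- The covariant Piola transform `φ_{-t}^* η = (DΦ_t^{-T} η) ∘ Φ_t⁻¹`. -/
def covPiola (Φ : ℝ → Vec d → Vec d) (t : ℝ) (η : Vec d → Vec d) (y : Vec d) : Vec d :=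
  (ContinuousLinearMap.adjoint (DΦinv Φ t (flowInv Φ t y))) (η (flowInv Φ t y))

/-! ### Time-dependent Bochner spaces -/

/-- Lebesgue measure on `(0, T)`. -/
abbrev timeMeasure (T : ℝ) : Measure ℝ := volume.restrict (Ioo 0 T)

/-- `u ∈ L²_V`: `φ_{-(·)} u(·) ∈ L²(0, T; V₀)`. -/
def MemL2V (Φ : ℝ → Vec d → Vec d) (Ω₀ : Set (Vec d)) (T : ℝ)
    (u : ∀ t : ℝ, VSp (Φ t '' Ω₀)) : Prop :=
  ∃ u₀ : ℝ → VSp Ω₀, MemLp u₀ 2 (timeMeasure T) ∧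
    ∀ᵐ t ∂(timeMeasure T), fnV (u₀ t) =ᵐ[volume.restrict Ω₀] piolaInv Φ t (fnV (u t))

/-- `u ∈ L²_H`: `φ_{-(·)} u(·) ∈ L²(0, T; H₀)`. -/
def MemL2H (Φ : ℝ → Vec d → Vec d) (Ω₀ : Set (Vec d)) (T : ℝ)
    (u : ∀ t : ℝ, HSp (Φ t '' Ω₀)) : Prop :=
  ∃ u₀ : ℝ → HSp Ω₀, MemLp u₀ 2 (timeMeasure T) ∧
    ∀ᵐ t ∂(timeMeasure T), (u₀ t : L2 Ω₀) =ᵐ[volume.restrict Ω₀]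
      piolaInv Φ t (u t : L2 (Φ t '' Ω₀))

/-- `f ∈ L²_{V*}`: `φ_{-(·)} f(·) ∈ L²(0, T; V₀*)`, where `φ_{-t} f` is defined by duality,
`⟨φ_{-t} f, η⟩ = ⟨f, φ_{-t}^* η⟩` for `η ∈ H¹₀(Ω₀; ℝ^d)`. -/
def MemL2VStar (Φ : ℝ → Vec d → Vec d) (Ω₀ : Set (Vec d)) (T : ℝ)
    (f : ∀ t : ℝ, VStar (Φ t '' Ω₀)) : Prop :=
  ∃ f₀ : ℝ → VStar Ω₀, MemLp f₀ 2 (timeMeasure T) ∧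
    ∀ᵐ t ∂(timeMeasure T), ∀ (η : H10 Ω₀) (ζ : H10 (Φ t '' Ω₀)),
      fnH ζ =ᵐ[volume.restrict (Φ t '' Ω₀)] covPiola Φ t (fnH η) →
      (f₀ t : StrongDual ℝ (H10 Ω₀)) η = (f t : StrongDual ℝ (H10 (Φ t '' Ω₀))) ζ

/-- `g ∈ L^∞(0, T; L^p(Ω₀; ℝ^d))`: as a function of `t` with values in the functions on `Ω₀` modulo
null sets, `g` has a representative that is jointly measurable, and the `L^p` norms of the `g(t)`
are essentially bounded. -/
def MemLinfLp (Ω₀ : Set (Vec d)) (T : ℝ) (p : ℝ≥0∞) (g : ℝ → Vec d → Vec d) : Prop :=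
  (∃ G : ℝ → Vec d → Vec d, StronglyMeasurable (Function.uncurry G) ∧
    ∀ᵐ t ∂(timeMeasure T), g t =ᵐ[volume.restrict Ω₀] G t) ∧
  ∃ M : NNReal, ∀ᵐ t ∂(timeMeasure T), eLpNorm (g t) p (volume.restrict Ω₀) ≤ M

/-- The assumption on the advecting field `V`: either `V ∘ Φ ∈ L^∞(0, T; L^p(Ω₀))` with `p ≥ d` and
`V` is weakly divergence free in the moving domain, or `V ∘ Φ ∈ L^∞(0, T; L^∞(Ω₀))`. -/
def AdvectionAssumption (Φ : ℝ → Vec d → Vec d) (Ω₀ : Set (Vec d)) (T : ℝ) (p : ℝ≥0∞)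
    (V : ℝ → Vec d → Vec d) : Prop :=
  MemLinfLp Ω₀ T p (fun t x => V t (Φ t x)) ∧
  (((d : ℝ≥0∞) ≤ p ∧ ∀ᵐ t ∂(timeMeasure T), WeaklyDivFree (Φ t '' Ω₀) (V t)) ∨ p = ⊤)

/-! ### The bilinear forms -/

/-- The matrix field `(DΦ_t^{-T} (d/dt)(DΦ_t^T DΦ_t) DΦ_t⁻¹) ∘ Φ_t⁻¹`. -/
def lamMatrix (Φ : ℝ → Vec d → Vec d) (t : ℝ) (y : Vec d) : Vec d →L[ℝ] Vec d :=
  let x := flowInv Φ t y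
  (ContinuousLinearMap.adjoint (DΦinv Φ t x)) ∘L
    (deriv (fun s => (ContinuousLinearMap.adjoint (DΦ Φ s x)) ∘L DΦ Φ s x) t) ∘L DΦinv Φ t x

/-- The matrix field `(DΦ_t (d/dt)(DΦ_t⁻¹)) ∘ Φ_t⁻¹`. -/
def driftMatrix (Φ : ℝ → Vec d → Vec d) (t : ℝ) (y : Vec d) : Vec d →L[ℝ] Vec d :=
  let x := flowInv Φ t y
  DΦ Φ t x ∘L deriv (fun s => DΦinv Φ s x) t

/-- `λ(t; u, v) = ∫_{Ω(t)} u · (DΦ_t^{-T} (d/dt)(DΦ_t^T DΦ_t) DΦ_t⁻¹) ∘ Φ_t⁻¹ v`. -/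
def lamForm (Φ : ℝ → Vec d → Vec d) (Ω₀ : Set (Vec d)) (t : ℝ) (u v : L2 (Φ t '' Ω₀)) : ℝ :=
  ∫ x in Φ t '' Ω₀, ⟪u x, lamMatrix Φ t x (v x)⟫

/-- `l(t; f, v) = ⟨f, v⟩` for `f ∈ V*(t)`, `v ∈ V(t)`. -/
def lForm (Φ : ℝ → Vec d → Vec d) (Ω₀ : Set (Vec d)) (t : ℝ)
    (f : VStar (Φ t '' Ω₀)) (v : VSp (Φ t '' Ω₀)) : ℝ :=
  (f : StrongDual ℝ (H10 (Φ t '' Ω₀))) (v : H10 (Φ t '' Ω₀))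

/-- The field `((V(t) - w(t)) · ∇) u`, whose `i`-th component is `∑ j, (V - w)_j ∂_j u_i`. -/
def convection (w V : ℝ → Vec d → Vec d) (Φ : ℝ → Vec d → Vec d) (Ω₀ : Set (Vec d)) (t : ℝ)
    (u : VSp (Φ t '' Ω₀)) (x : Vec d) : Vec d :=
  WithLp.toLp 2 fun i => ∑ j, (V t x j - w t x j) * jacV u x (i, j)

/-- `a(t; u, v) = (u, v)_{V(t)} - (u, v)_{H(t)} + (((V - w) · ∇) u, v)_{H(t)}
- ((DΦ_t (d/dt)(DΦ_t⁻¹)) ∘ Φ_t⁻¹ u, v)_{H(t)} - λ(t; u, v)`,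
the convective term being the pairing of `H^{-1}` with `H¹₀` that extends the inner product. -/
def aForm (w V : ℝ → Vec d → Vec d) (Φ : ℝ → Vec d → Vec d) (Ω₀ : Set (Vec d)) (t : ℝ)
    (u v : VSp (Φ t '' Ω₀)) : ℝ :=
  ⟪u, v⟫ - ⟪fnV u, fnV v⟫
    + pairing (Φ t '' Ω₀) (convection w V Φ Ω₀ t u) (v : H10 (Φ t '' Ω₀))
    - (∫ x in Φ t '' Ω₀, ⟪driftMatrix Φ t x (fnV u x), fnV v x⟫)
    - lamForm Φ Ω₀ t (fnV u) (fnV v)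

/-- `b` is a bilinear form with `|b(x, y)| ≤ C ‖x‖ ‖y‖`. -/
def IsBilinearBoundedBy {X Y : Type*} [NormedAddCommGroup X] [NormedSpace ℝ X]
    [NormedAddCommGroup Y] [NormedSpace ℝ Y] (C : ℝ) (b : X → Y → ℝ) : Prop :=
  ∃ B : X →ₗ[ℝ] Y →ₗ[ℝ] ℝ, ∀ x y, B x y = b x y ∧ |b x y| ≤ C * ‖x‖ * ‖y‖

/-- `w ∈ C¹([0, T]; C^k_K(ℝ^d; ℝ^d))`, for the space of `C^k` fields supported in a compact `K`
with its topology of uniform convergence of the derivatives of order at most `k`. -/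
def IsC1InTime {k : ℕ∞} {K : TopologicalSpace.Compacts (Vec d)} (T : ℝ)
    (w : ℝ → ContDiffMapSupportedIn (Vec d) (Vec d) k K) : Prop :=
  ∃ w' : ℝ → ContDiffMapSupportedIn (Vec d) (Vec d) k K,
    ContinuousOn w' (Icc 0 T) ∧ ∀ t ∈ Icc 0 T, HasDerivWithinAt w (w' t) (Icc 0 T) t

end MovingStokes

end

open MovingStokes

open MeasureTheory Set Topology
open scoped ENNReal ContDiff RealInnerProductSpace
open MovingStokes

namespace MovingStokes

open scoped NNReal

/-! ### Grönwall estimates and global solvability of ordinary differential equations. -/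

section Gronwall

variable {E : Type*} [NormedAddCommGroup E] [NormedSpace ℝ E]

/-! The flow enters the forms only through bounded matrix fields. By the variational equation
`(DΦ_t)' = Dw(t, Φ_t) DΦ_t`, the matrix in `λ` is `Dwᵀ + Dw` and the drift matrix is `-Dw`
(`IsFlow.lamMatrix_eq`, `IsFlow.driftMatrix_eq`). Hence every term except the convective one is
controlled by the supremum of `Dw`, which is finite because `w` is continuous in time with values in
`C²` fields.

For the convective term put `b = V - w`. Everything follows from one estimate on test functions, `|∫
(b·∇)ψ · φ| ≤ κ ‖ψ‖ ‖φ‖` with `κ` independent of `t` (`IsAdvecting`). It extends by density to a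
bounded bilinear form on `H¹₀`, and this form is the pairing (`IsAdvecting.exists_bilin`). If `d =
3` or `p > 2`, the estimate is Hölder plus Sobolev on one ball containing all the domains
(`exists_isAdvecting_subcritical`).

In the critical case `d = p = 2` Hölder would require `H¹₀ ⊆ L^∞`, which fails, and the vanishing
divergence of `b` has to be exploited by an argument of Wente type (`exists_isAdvecting_critical`).
For scalar `u` put `f = b·∇u`. Its logarithmic potential is bounded (`abs_logPot_le`): an
integration by parts moves the derivative from `u` to the kernel, whose gradient is radial and of
size `1/r`. On discs inside the domain `b` is orthogonal to radial fields, so on each circle the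
value of `u` at one point may be subtracted. On a circle that leaves the domain `u` already vanishes
somewhere. Either way `u` is replaced by its oscillation on the circle, at most `r` times the
angular integral of `|∇u|`; the factor `r` cancels the singularity, and rotation invariance of
Lebesgue measure gives `2π ‖b‖₂ ‖∇u‖₂`. An integrable `f` with bounded potential `N` is in `H⁻¹`,
since testing `ΔN = f` with `N` bounds the energy of `N` (`abs_integral_mul_le_of_logPot`). The
geometry enters once: circles of radius below some `δ` that lie in `Ω(t)` must bound discs in
`Ω(t)`, with `δ` independent of `t`. This is where the `C²` boundary is needed
(`HasC2Boundary.exists_closedBall_subset`).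

Gårding's inequality: on the diagonal the convective term vanishes if `b` is divergence free; if `p
= ∞` it is at most `‖b‖_∞ ‖u‖_V ‖u‖_H`, which Young's inequality absorbs (`IsFlow.le_aForm`).

Measurability: the Piola transform and extension by zero carry all families to fixed spaces over
`ℝ^d`, by operators that depend measurably on time (`aestronglyMeasurable_of_operator`).
Measurability in `H¹₀` follows from measurability in `L²`, because `H¹₀ → L²` is a continuous
injection of Polish spaces (`aestronglyMeasurable_H10`). The pairing need not be an integral in the
critical case, but it is always a limit of integrals against truncated fields
(`Represents.tendsto_trunc`). -/

theorem gronwallBound_le_mul_exp {δ K ε x : ℝ} (hK : 0 ≤ K) (hε : 0 ≤ ε) :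
    gronwallBound δ K ε x ≤ (δ + ε * x) * Real.exp (K * x) := by
  rcases hK.eq_or_lt with rfl | hK'
  · simp [gronwallBound_K0]
  · rw [gronwallBound_of_K_ne_0 hK'.ne']
    have h1 : Real.exp (K * x) - 1 ≤ K * x * Real.exp (K * x) := by
      have h2 := Real.add_one_le_exp (-(K * x))
      have h3 : Real.exp (-(K * x)) * Real.exp (K * x) = 1 := by
        rw [← Real.exp_add]; simp
      nlinarith [Real.exp_pos (K * x)]
    have h4 : ε / K * (Real.exp (K * x) - 1) ≤ ε / K * (K * x * Real.exp (K * x)) :=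
      mul_le_mul_of_nonneg_left h1 (by positivity)
    have h5 : ε / K * (K * x * Real.exp (K * x)) = ε * x * Real.exp (K * x) := by
      field_simp
    linarith

/-- Grönwall's inequality on `[0, T]`, forwards and backwards in time. -/
theorem norm_le_of_norm_derivWithin_le {γ γ' : ℝ → E} {T K ε : ℝ} (hK : 0 ≤ K) (hε : 0 ≤ ε)
    (h : ∀ t ∈ Icc 0 T, HasDerivWithinAt γ (γ' t) (Icc 0 T) t)
    (hb : ∀ t ∈ Icc 0 T, ‖γ' t‖ ≤ K * ‖γ t‖ + ε) {s t : ℝ} (hs : s ∈ Icc 0 T) (ht : t ∈ Icc 0 T) :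
    ‖γ t‖ ≤ (‖γ s‖ + ε * T) * Real.exp (K * T) := by
  have key : ∀ {x : ℝ}, 0 ≤ x → x ≤ T →
      gronwallBound ‖γ s‖ K ε x ≤ (‖γ s‖ + ε * T) * Real.exp (K * T) := by
    intro x hx hxT
    have hT : 0 ≤ T := hx.trans hxT
    refine (gronwallBound_le_mul_exp hK hε).trans ?_
    have : 0 ≤ ‖γ s‖ + ε * T := by positivity
    gcongr
  rcases le_total s t with hst | hst
  · have := norm_le_gronwallBound_of_norm_deriv_right_le (f := γ) (f' := γ') (δ := ‖γ s‖) (K := K)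
      (ε := ε) (a := s) (b := t)
      (fun x hx => ((h x ⟨hs.1.trans hx.1, hx.2.trans ht.2⟩).continuousWithinAt.mono
        (Icc_subset_Icc hs.1 ht.2)))
      (fun x hx => (h x ⟨hs.1.trans hx.1, hx.2.le.trans ht.2⟩).mono_of_mem_nhdsWithin
        (Filter.mem_of_superset (Icc_mem_nhdsGE (hx.2.trans_le ht.2))
          (Icc_subset_Icc (hs.1.trans hx.1) le_rfl))) le_rfl
      (fun x hx => hb x ⟨hs.1.trans hx.1, hx.2.le.trans ht.2⟩) t ⟨hst, le_rfl⟩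
    exact this.trans (key (by linarith) (by linarith [hs.1, ht.2]))
  -- Backwards in time the forward inequality is applied to the reversed curve `τ ↦ γ (s - τ)`.
  · have hd : ∀ x ∈ Icc 0 (s - t), HasDerivWithinAt (fun τ => γ (s - τ)) (-(γ' (s - x)))
        (Icc 0 (s - t)) x := by
      intro x hx
      have h1 := h (s - x) ⟨by linarith [hx.2, ht.1], by linarith [hx.1, hs.2]⟩
      have h2 : HasDerivWithinAt (fun τ : ℝ => s - τ) (-1) (Icc 0 (s - t)) x :=
        ((hasDerivAt_id x).const_sub s).hasDerivWithinAt
      have := h1.scomp x h2 (fun y hy => ⟨by linarith [hy.2, ht.1], by linarith [hy.1, hs.2]⟩)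
      simpa [Function.comp_def] using this
    have := norm_le_gronwallBound_of_norm_deriv_right_le (f := fun τ => γ (s - τ))
      (f' := fun τ => -(γ' (s - τ))) (δ := ‖γ s‖) (K := K) (ε := ε) (a := 0) (b := s - t)
      (fun x hx => (hd x hx).continuousWithinAt)
      (fun x hx => (hd x ⟨hx.1, hx.2.le⟩).mono_of_mem_nhdsWithin
        (Filter.mem_of_superset (Icc_mem_nhdsGE hx.2) (Icc_subset_Icc hx.1 le_rfl))) (by simp)
      (fun x hx => by
        rw [norm_neg]
        exact hb (s - x) ⟨by linarith [hx.2, ht.1], by linarith [hx.1, hs.2]⟩)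
      (s - t) ⟨by linarith, le_rfl⟩
    simp only [sub_sub_cancel, sub_zero] at this
    exact this.trans (key (by linarith) (by linarith [hs.2, ht.1]))

/-- Global solvability on `[0, T]` for bounded Lipschitz fields, with data at an arbitrary time. -/
theorem exists_integralCurve_of_bounded [CompleteSpace E] {F : ℝ → E → E} {M K : ℝ≥0} {T : ℝ}
    (hF : ∀ x, Continuous fun t => F t x) (hM : ∀ t x, ‖F t x‖ ≤ M)
    (hK : ∀ t, LipschitzWith K (F t)) {t₀ : ℝ} (ht₀ : t₀ ∈ Icc 0 T) (y : E) :
    ∃ γ : ℝ → E, γ t₀ = y ∧ ∀ t ∈ Icc 0 T, HasDerivWithinAt γ (F t (γ t)) (Icc 0 T) t := by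
  have hT : 0 ≤ T := ht₀.1.trans ht₀.2
  -- The radius `M * T` is never exceeded: a curve of speed at most `M` travels no farther in time
  -- `T`. The field is Lipschitz on the whole space, so any radius is admissible.
  have : IsPicardLindelof F (tmin := 0) (tmax := T) ⟨t₀, ht₀⟩ y (M * T.toNNReal) 0 M K :=
    { lipschitzOnWith := fun t _ => (hK t).lipschitzOnWith
      continuousOn := fun x _ => (hF x).continuousOn
      norm_le := fun t _ x _ => hM t x
      mul_max_le := by
        have : max (T - t₀) (t₀ - 0) ≤ T := max_le (by linarith [ht₀.1]) (by linarith [ht₀.2])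
        simp only [NNReal.coe_mul, NNReal.coe_zero, sub_zero, Real.coe_toNNReal T hT] at this ⊢
        gcongr }
  exact this.exists_eq_forall_mem_Icc_hasDerivWithinAt₀

/-- Solvability of the linear operator equation `A' = B(t) ∘ A` on `[0, T]`. -/
theorem exists_linear_integralCurve [FiniteDimensional ℝ E] {B : ℝ → E →L[ℝ] E} {K : ℝ≥0} {T : ℝ}
    (hT : 0 ≤ T) (hB : Continuous B) (hK : ∀ t, ‖B t‖ ≤ K) :
    ∃ A : ℝ → E →L[ℝ] E, A 0 = ContinuousLinearMap.id ℝ E ∧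
      ∀ t ∈ Icc 0 T, HasDerivWithinAt A (B t ∘L A t) (Icc 0 T) t := by
  have : FiniteDimensional ℝ (E →L[ℝ] E) := inferInstance
  have : CompleteSpace (E →L[ℝ] E) := FiniteDimensional.complete ℝ _
  -- The field `A ↦ B t ∘L A` is unbounded, so it is cut off outside a ball. Grönwall bounds the
  -- solution of the truncated equation by `R`, inside the region where the cutoff equals `1`, so it
  -- solves the original equation.
  set R : ℝ := Real.exp (K * T) with hR
  have hR0 : 0 < R := Real.exp_pos _
  let χ : ContDiffBump (0 : E →L[ℝ] E) := ⟨R + 1, R + 2, by linarith, by linarith⟩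
  let g : (E →L[ℝ] E) → (E →L[ℝ] E) := fun A => χ A • A
  have hg : ContDiff ℝ 1 g := (χ.contDiff).smul contDiff_id
  have hgs : HasCompactSupport g := χ.hasCompactSupport.smul_right
  obtain ⟨C, hC⟩ := hg.lipschitzWith_of_hasCompactSupport hgs (by simp)
  obtain ⟨D, hD⟩ := hgs.exists_bound_of_continuous hg.continuous
  have hD0 : 0 ≤ D := (norm_nonneg _).trans (hD 0)
  obtain ⟨A, hA0, hA⟩ := exists_integralCurve_of_bounded (F := fun t A => B t ∘L g A)
    (M := K * D.toNNReal) (K := K * C) (T := T) (fun A => by fun_prop)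
    (fun t A => by
      rw [NNReal.coe_mul, Real.coe_toNNReal D hD0]
      exact (ContinuousLinearMap.opNorm_comp_le _ _).trans
        (mul_le_mul (hK t) (hD A) (norm_nonneg _) K.2))
    (fun t => LipschitzWith.of_dist_le_mul fun A A' => by
      rw [dist_eq_norm, ← ContinuousLinearMap.comp_sub, NNReal.coe_mul, mul_assoc]
      refine (ContinuousLinearMap.opNorm_comp_le _ _).trans
        (mul_le_mul (hK t) ?_ (norm_nonneg _) K.2)
      rw [← dist_eq_norm]
      exact hC.dist_le_mul _ _) (left_mem_Icc.2 hT) (ContinuousLinearMap.id ℝ E)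
  have hgn : ∀ A, ‖g A‖ ≤ ‖A‖ := fun A => by
    rw [norm_smul, Real.norm_of_nonneg χ.nonneg]
    exact mul_le_of_le_one_left (norm_nonneg _) χ.le_one
  have hAn : ∀ t ∈ Icc 0 T, ‖A t‖ ≤ R := by
    intro t ht
    have := norm_le_of_norm_derivWithin_le (K := K) (ε := 0) K.2 le_rfl hA
      (fun t _ => by
        rw [add_zero]
        exact (ContinuousLinearMap.opNorm_comp_le _ _).trans
          (mul_le_mul (hK t) (hgn _) (norm_nonneg _) K.2)) (left_mem_Icc.2 hT) ht
    rw [hA0, zero_mul, add_zero] at this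
    exact this.trans (mul_le_of_le_one_left (Real.exp_pos _).le ContinuousLinearMap.norm_id_le)
  refine ⟨A, hA0, fun t ht => ?_⟩
  have h1 := hA t ht
  have h2 : g (A t) = A t := by
    have : χ (A t) = 1 := χ.one_of_mem_closedBall (by
      rw [mem_closedBall_zero_iff]
      have := hAn t ht
      change ‖A t‖ ≤ R + 1
      linarith)
    simp only [g, this, one_smul]
  rwa [h2] at h1

end Gronwall

end MovingStokes

namespace MovingStokes

open scoped NNReal

/-- A bounded time-dependent field, `C^{1,1}` in space with uniform bounds. -/
structure IsRegularField {E : Type*} [NormedAddCommGroup E] [NormedSpace ℝ E] (W : ℝ → E → E)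
    (M L N : ℝ≥0) : Prop where
  cont : Continuous (Function.uncurry W)
  diff : ∀ t, Differentiable ℝ (W t)
  bound : ∀ t x, ‖W t x‖ ≤ M
  dbound : ∀ t x, ‖fderiv ℝ (W t) x‖ ≤ L
  dlip : ∀ t, LipschitzWith N (fderiv ℝ (W t))
  dcont : Continuous fun z : ℝ × E => fderiv ℝ (W z.1) z.2

/-- `Φ` is the flow on `[0, T]` of `W`. -/
def IsFlow {E : Type*} [NormedAddCommGroup E] [NormedSpace ℝ E] (W : ℝ → E → E) (T : ℝ)
    (Φ : ℝ → E → E) : Prop :=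
  ∀ x, Φ 0 x = x ∧ ∀ t ∈ Icc 0 T, HasDerivWithinAt (fun s => Φ s x) (W t (Φ t x)) (Icc 0 T) t

/-! ### The flow of a `C^{1,1}` field: Lipschitz bounds, bijectivity, the variational equation. -/

section Flow

variable {E : Type*} [NormedAddCommGroup E] [NormedSpace ℝ E]
  {W : ℝ → E → E} {M L N : ℝ≥0} {T : ℝ} {Φ : ℝ → E → E}

theorem IsRegularField.lipschitz (hW : IsRegularField W M L N) (t : ℝ) : LipschitzWith L (W t) :=
  lipschitzWith_of_nnnorm_fderiv_le (hW.diff t) fun x => hW.dbound t x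

/-- Mean value inequality on the segment, with the linearization at `x` subtracted. This quadratic
remainder is the source term in the Grönwall argument for differentiability of the flow. -/
theorem IsRegularField.norm_sub_fderiv_le (hW : IsRegularField W M L N) (t : ℝ) (x y : E) :
    ‖W t y - W t x - fderiv ℝ (W t) x (y - x)‖ ≤ N * ‖y - x‖ ^ 2 := by
  have h := (convex_segment x y).norm_image_sub_le_of_norm_hasFDerivWithin_le' (f := W t)
    (f' := fderiv ℝ (W t)) (φ := fderiv ℝ (W t) x) (C := N * ‖y - x‖)
    (fun z _ => ((hW.diff t) z).hasFDerivAt.hasFDerivWithinAt)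
    (fun z hz => by
      rw [← dist_eq_norm]
      refine ((hW.dlip t).dist_le_mul z x).trans ?_
      gcongr
      rw [dist_eq_norm]
      obtain ⟨a, b, ha, hb, hab, rfl⟩ := hz
      have : a • x + b • y - x = b • (y - x) := by
        rw [← eq_sub_iff_add_eq] at hab; rw [hab]; module
      rw [this, norm_smul, Real.norm_of_nonneg hb]
      exact mul_le_of_le_one_left (norm_nonneg _) (by linarith))
    (left_mem_segment ℝ x y) (right_mem_segment ℝ x y)
  calc _ ≤ _ := h
    _ = _ := by ring

/-- Grönwall for the difference of two trajectories. The two times may come in either order, so the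
same constant serves `Φ_t` and its inverse. -/
theorem IsFlow.dist_le (hW : IsRegularField W M L N) (hΦ : IsFlow W T Φ) {s t : ℝ}
    (hs : s ∈ Icc 0 T) (ht : t ∈ Icc 0 T) (x y : E) :
    ‖Φ t x - Φ t y‖ ≤ Real.exp (L * T) * ‖Φ s x - Φ s y‖ := by
  have := norm_le_of_norm_derivWithin_le (γ := fun t => Φ t x - Φ t y) (K := L) (ε := 0) L.2 le_rfl
    (fun t ht => ((hΦ x).2 t ht).sub ((hΦ y).2 t ht))
    (fun t _ => by
      rw [add_zero, ← dist_eq_norm, ← dist_eq_norm]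
      exact (hW.lipschitz t).dist_le_mul _ _) hs ht
  rw [zero_mul, add_zero, mul_comm] at this
  exact this

/-- A Lipschitz constant of the flow maps and of their inverses. -/
noncomputable def flowLip (L : ℝ≥0) (T : ℝ) : ℝ≥0 := (Real.exp (L * T)).toNNReal

theorem coe_flowLip (L : ℝ≥0) (T : ℝ) : (flowLip L T : ℝ) = Real.exp (L * T) :=
  Real.coe_toNNReal _ (Real.exp_pos _).le

theorem IsFlow.lipschitz (hW : IsRegularField W M L N) (hΦ : IsFlow W T Φ) {t : ℝ}
    (ht : t ∈ Icc 0 T) : LipschitzWith (flowLip L T) (Φ t) :=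
  LipschitzWith.of_dist_le_mul fun x y => by
    have := hΦ.dist_le hW (left_mem_Icc.2 (ht.1.trans ht.2)) ht x y
    rwa [(hΦ x).1, (hΦ y).1, ← coe_flowLip, ← dist_eq_norm, ← dist_eq_norm] at this

theorem IsFlow.antilipschitz (hW : IsRegularField W M L N) (hΦ : IsFlow W T Φ) {t : ℝ}
    (ht : t ∈ Icc 0 T) : AntilipschitzWith (flowLip L T) (Φ t) :=
  AntilipschitzWith.of_le_mul_dist fun x y => by
    have := hΦ.dist_le hW ht (left_mem_Icc.2 (ht.1.trans ht.2)) x y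
    rwa [(hΦ x).1, (hΦ y).1, ← coe_flowLip, ← dist_eq_norm, ← dist_eq_norm] at this

theorem IsFlow.dist_time_le (hW : IsRegularField W M L N) (hΦ : IsFlow W T Φ) {s t : ℝ}
    (hs : s ∈ Icc 0 T) (ht : t ∈ Icc 0 T) (x : E) : ‖Φ t x - Φ s x‖ ≤ M * |t - s| := by
  have := (convex_Icc (0 : ℝ) T).norm_image_sub_le_of_norm_hasDerivWithin_le
    (f := fun t => Φ t x) (C := M) (fun t ht => (hΦ x).2 t ht) (fun t _ => hW.bound t _) hs ht
  simpa using this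

variable [FiniteDimensional ℝ E]

theorem exists_isFlow (hW : IsRegularField W M L N) (hT : 0 ≤ T) (x : E) :
    ∃ γ : ℝ → E, γ 0 = x ∧ ∀ t ∈ Icc 0 T, HasDerivWithinAt γ (W t (γ t)) (Icc 0 T) t := by
  have : CompleteSpace E := FiniteDimensional.complete ℝ _
  exact exists_integralCurve_of_bounded
    (fun x => hW.cont.comp (by fun_prop : Continuous fun t : ℝ => (t, x))) hW.bound hW.lipschitz
    (left_mem_Icc.2 hT) x

/-- For surjectivity the equation is solved with data `y` at time `t`; the value at time `0` of this
solution is the preimage, by uniqueness of trajectories. -/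
theorem IsFlow.bijective (hW : IsRegularField W M L N) (hΦ : IsFlow W T Φ) {t : ℝ}
    (ht : t ∈ Icc 0 T) : Function.Bijective (Φ t) := by
  have : CompleteSpace E := FiniteDimensional.complete ℝ _
  refine ⟨(hΦ.antilipschitz hW ht).injective, fun y => ?_⟩
  obtain ⟨γ, hγ, hγ'⟩ := exists_integralCurve_of_bounded
    (fun x => hW.cont.comp (by fun_prop : Continuous fun t : ℝ => (t, x))) hW.bound hW.lipschitz
    ht y
  refine ⟨γ 0, ?_⟩
  have := norm_le_of_norm_derivWithin_le (γ := fun t => Φ t (γ 0) - γ t) (K := L) (ε := 0) L.2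
    le_rfl (fun t ht => ((hΦ (γ 0)).2 t ht).sub (hγ' t ht))
    (fun t _ => by
      rw [add_zero, ← dist_eq_norm, ← dist_eq_norm]
      exact (hW.lipschitz t).dist_le_mul _ _) (left_mem_Icc.2 (ht.1.trans ht.2)) ht
  rw [(hΦ _).1, sub_self, norm_zero, zero_mul, add_zero, zero_mul] at this
  rw [← hγ]
  exact sub_eq_zero.1 (norm_le_zero_iff.1 this)

/-- The flow map is differentiable in space, and its derivative solves the variational equation. -/
theorem IsFlow.exists_variational (hW : IsRegularField W M L N) (hΦ : IsFlow W T Φ) (hT : 0 ≤ T)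
    (x : E) :
    (∀ t ∈ Icc 0 T, HasFDerivAt (Φ t) (fderiv ℝ (Φ t) x) x) ∧
      fderiv ℝ (Φ 0) x = ContinuousLinearMap.id ℝ E ∧
      ∀ t ∈ Icc 0 T, HasDerivWithinAt (fun s => fderiv ℝ (Φ s) x)
        (fderiv ℝ (W t) (Φ t x) ∘L fderiv ℝ (Φ t) x) (Icc 0 T) t := by
  -- The trajectory is known only on `[0, T]`. Clamping the time makes the coefficient of the linear
  -- equation continuous on all of `ℝ`.
  have hcl : Continuous fun t : ℝ => ((projIcc 0 T hT t : Icc 0 T) : ℝ) := by fun_prop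
  have hcx : ContinuousOn (fun t => Φ t x) (Icc 0 T) :=
    fun t ht => ((hΦ x).2 t ht).continuousWithinAt
  have hcx' : Continuous fun t : ℝ => Φ (projIcc 0 T hT t) x :=
    hcx.comp_continuous hcl fun t => (projIcc 0 T hT t).2
  obtain ⟨A, hA0, hA⟩ := exists_linear_integralCurve (K := L)
    (B := fun t => fderiv ℝ (W (projIcc 0 T hT t)) (Φ (projIcc 0 T hT t) x)) hT
    (hW.dcont.comp (hcl.prodMk hcx')) (fun t => hW.dbound _ _)
  have hA' : ∀ t ∈ Icc 0 T, HasDerivWithinAt A (fderiv ℝ (W t) (Φ t x) ∘L A t) (Icc 0 T) t := by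
    intro t ht
    have := hA t ht
    rwa [projIcc_of_mem hT ht] at this
  -- The error `Φ t y - Φ t x - A t (y - x)` starts at zero, and its derivative is `DW` applied to
  -- the error itself plus a quadratic Taylor remainder. Grönwall makes it quadratic in `y - x`,
  -- which identifies `A t` as the derivative of the flow.
  have key : ∀ t ∈ Icc 0 T, ∀ y, ‖Φ t y - Φ t x - A t (y - x)‖ ≤
      N * Real.exp (L * T) ^ 2 * T * Real.exp (L * T) * ‖y - x‖ ^ 2 := by
    intro t ht y
    have := norm_le_of_norm_derivWithin_le (γ := fun t => Φ t y - Φ t x - A t (y - x)) (K := L)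
      (ε := N * (Real.exp (L * T) * ‖y - x‖) ^ 2) L.2 (by positivity)
      (γ' := fun t => W t (Φ t y) - W t (Φ t x) - (fderiv ℝ (W t) (Φ t x) ∘L A t) (y - x))
      (fun t ht => (((hΦ y).2 t ht).sub ((hΦ x).2 t ht)).sub
        ((hA' t ht).clm_apply (hasDerivWithinAt_const t _ (y - x)) |>.congr_deriv (by simp)))
      (fun t ht => by
        have h1 := hW.norm_sub_fderiv_le t (Φ t x) (Φ t y)
        have h2 : ‖Φ t y - Φ t x‖ ≤ Real.exp (L * T) * ‖y - x‖ := by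
          have := hΦ.dist_le hW (left_mem_Icc.2 hT) ht y x
          rwa [(hΦ x).1, (hΦ y).1] at this
        have h3 : W t (Φ t y) - W t (Φ t x) - (fderiv ℝ (W t) (Φ t x) ∘L A t) (y - x) =
          fderiv ℝ (W t) (Φ t x) (Φ t y - Φ t x - A t (y - x)) +
            (W t (Φ t y) - W t (Φ t x) - fderiv ℝ (W t) (Φ t x) (Φ t y - Φ t x)) := by
          rw [ContinuousLinearMap.comp_apply, map_sub (fderiv ℝ (W t) (Φ t x)) (Φ t y - Φ t x)]
          abel
        rw [h3]
        refine (norm_add_le _ _).trans (add_le_add ?_ (h1.trans ?_))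
        · exact (ContinuousLinearMap.le_opNorm _ _).trans (by gcongr; exact hW.dbound _ _)
        · gcongr) (left_mem_Icc.2 hT) ht
    simp only [(hΦ _).1, hA0, ContinuousLinearMap.id_apply, sub_self, norm_zero, zero_add] at this
    refine this.trans (le_of_eq ?_)
    ring
  have hfd : ∀ t ∈ Icc 0 T, HasFDerivAt (Φ t) (A t) x := by
    intro t ht
    rw [hasFDerivAt_iff_isLittleO]
    refine Asymptotics.IsBigO.trans_isLittleO (g := fun y => ‖y - x‖ ^ 2) ?_ ?_
    · exact Asymptotics.IsBigO.of_bound _ (Filter.Eventually.of_forall fun y => by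
        rw [norm_pow, norm_norm]; exact key t ht y)
    · have h1 : (fun y : E => ‖y - x‖) =o[𝓝 x] fun _ => (1 : ℝ) := by
        rw [Asymptotics.isLittleO_one_iff]
        have : Continuous fun y : E => ‖y - x‖ := by fun_prop
        simpa using this.tendsto x
      have h2 := h1.mul_isBigO (Asymptotics.isBigO_refl (fun y : E => ‖y - x‖) (𝓝 x))
      simp only [one_mul] at h2
      refine Asymptotics.IsLittleO.of_norm_right ?_
      simpa [sq] using h2
  have hAeq : ∀ t ∈ Icc 0 T, fderiv ℝ (Φ t) x = A t := fun t ht => (hfd t ht).fderiv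
  refine ⟨fun t ht => by rw [hAeq t ht]; exact hfd t ht, by
    rw [hAeq 0 (left_mem_Icc.2 hT), hA0], fun t ht => ?_⟩
  rw [hAeq t ht]
  exact (hA' t ht).congr_of_mem hAeq ht

end Flow

end MovingStokes

namespace MovingStokes

open scoped NNReal

theorem continuous_of_lipschitz_right {E F : Type*} [PseudoMetricSpace E] [PseudoMetricSpace F]
    {f : ℝ → E → F} {C : ℝ≥0} (hc : ∀ x, Continuous fun t => f t x)
    (hl : ∀ t, LipschitzWith C (f t)) : Continuous fun z : ℝ × E => f z.1 z.2 :=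
  (continuous_prod_of_continuous_lipschitzWith (fun z : E × ℝ => f z.2 z.1) C hc hl).comp
    continuous_swap

/-! ### Invertibility and regularity of the derivative of the flow, and of the inverse flow. -/

section FlowDerivative

variable {E : Type*} [NormedAddCommGroup E] [NormedSpace ℝ E] [FiniteDimensional ℝ E]
  {W : ℝ → E → E} {M L N : ℝ≥0} {T : ℝ} {Φ : ℝ → E → E}

omit [FiniteDimensional ℝ E] in
theorem IsFlow.norm_fderiv_le (hW : IsRegularField W M L N) (hΦ : IsFlow W T Φ) {t : ℝ}
    (ht : t ∈ Icc 0 T) (x : E) : ‖fderiv ℝ (Φ t) x‖ ≤ flowLip L T :=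
  norm_fderiv_le_of_lipschitz ℝ (hΦ.lipschitz hW ht)

/-- Grönwall for the variational equation, run from time `t` back to time `0`, where the derivative
is the identity. It yields injectivity, hence invertibility, of `DΦ_t` without determinants. -/
theorem IsFlow.le_norm_fderiv_apply (hW : IsRegularField W M L N) (hΦ : IsFlow W T Φ) {t : ℝ}
    (ht : t ∈ Icc 0 T) (x h : E) : ‖h‖ ≤ flowLip L T * ‖fderiv ℝ (Φ t) x h‖ := by
  have hT : 0 ≤ T := ht.1.trans ht.2
  obtain ⟨-, h0, h1⟩ := hΦ.exists_variational hW hT x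
  have hd : ∀ t ∈ Icc 0 T, HasDerivWithinAt (fun t => fderiv ℝ (Φ t) x h)
      (fderiv ℝ (W t) (Φ t x) (fderiv ℝ (Φ t) x h)) (Icc 0 T) t := fun t ht =>
    (ContinuousLinearMap.apply ℝ E h).hasFDerivAt.comp_hasDerivWithinAt t (h1 t ht)
  have hb : ∀ t ∈ Icc 0 T, ‖fderiv ℝ (W t) (Φ t x) (fderiv ℝ (Φ t) x h)‖ ≤
      L * ‖fderiv ℝ (Φ t) x h‖ + 0 := fun t _ => by
    rw [add_zero]
    exact (ContinuousLinearMap.le_opNorm _ _).trans (by gcongr; exact hW.dbound _ _)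
  have := norm_le_of_norm_derivWithin_le (NNReal.coe_nonneg L) le_rfl hd hb ht (left_mem_Icc.2 hT)
  rw [zero_mul, add_zero, h0, ← coe_flowLip, mul_comm, ContinuousLinearMap.id_apply] at this
  exact this

theorem IsFlow.isInvertible_fderiv (hW : IsRegularField W M L N) (hΦ : IsFlow W T Φ) {t : ℝ}
    (ht : t ∈ Icc 0 T) (x : E) : (fderiv ℝ (Φ t) x).IsInvertible := by
  have hinj : Function.Injective (fderiv ℝ (Φ t) x) := by
    rw [injective_iff_map_eq_zero]
    intro h hh
    have := hΦ.le_norm_fderiv_apply hW ht x h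
    rw [hh, norm_zero, mul_zero] at this
    exact norm_le_zero_iff.1 this
  exact ⟨(LinearEquiv.ofInjectiveEndo _ hinj).toContinuousLinearEquiv, by ext; rfl⟩

/-- A spatial Lipschitz constant of the derivative of the flow. -/
noncomputable def flowDerivLip (L N : ℝ≥0) (T : ℝ) : ℝ≥0 :=
  N * flowLip L T * flowLip L T * T.toNNReal * flowLip L T

/-- The difference of two solutions of the variational equation starts at zero and is driven by the
Lipschitz variation of `DW`. The bound is needed because multiplication by `DΦᵀ DΦ` must preserve
`H¹₀`. -/
theorem IsFlow.lipschitz_fderiv (hW : IsRegularField W M L N) (hΦ : IsFlow W T Φ) {t : ℝ}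
    (ht : t ∈ Icc 0 T) : LipschitzWith (flowDerivLip L N T) (fderiv ℝ (Φ t)) := by
  have hT : 0 ≤ T := ht.1.trans ht.2
  refine LipschitzWith.of_dist_le_mul fun x y => ?_
  obtain ⟨-, hx0, hx1⟩ := hΦ.exists_variational hW hT x
  obtain ⟨-, hy0, hy1⟩ := hΦ.exists_variational hW hT y
  have := norm_le_of_norm_derivWithin_le (γ := fun t => fderiv ℝ (Φ t) x - fderiv ℝ (Φ t) y)
    (K := L) (ε := N * (flowLip L T * ‖x - y‖) * flowLip L T) L.2 (by positivity)
    (fun t ht => (hx1 t ht).sub (hy1 t ht))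
    (fun t ht => by
      have h3 : fderiv ℝ (W t) (Φ t x) ∘L fderiv ℝ (Φ t) x -
            fderiv ℝ (W t) (Φ t y) ∘L fderiv ℝ (Φ t) y =
          fderiv ℝ (W t) (Φ t x) ∘L (fderiv ℝ (Φ t) x - fderiv ℝ (Φ t) y) +
            (fderiv ℝ (W t) (Φ t x) - fderiv ℝ (W t) (Φ t y)) ∘L fderiv ℝ (Φ t) y := by
        ext; simp
      rw [h3]
      refine (norm_add_le _ _).trans (add_le_add ?_ ?_)
      · exact (ContinuousLinearMap.opNorm_comp_le _ _).trans (by gcongr; exact hW.dbound _ _)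
      · refine (ContinuousLinearMap.opNorm_comp_le _ _).trans ?_
        gcongr
        · rw [← dist_eq_norm, ← dist_eq_norm x y]
          refine ((hW.dlip t).dist_le_mul _ _).trans ?_
          gcongr
          exact (hΦ.lipschitz hW ht).dist_le_mul _ _
        · exact hΦ.norm_fderiv_le hW ht y) (left_mem_Icc.2 hT) ht
  simp only [hx0, hy0, sub_self, norm_zero, zero_add] at this
  rw [dist_eq_norm, dist_eq_norm]
  refine this.trans_eq ?_
  simp only [flowDerivLip, NNReal.coe_mul, Real.coe_toNNReal T hT, coe_flowLip]
  ring

/-- Continuity in time together with a Lipschitz constant in space uniform in time gives joint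
continuity. Time is clamped since `Φ` is unspecified outside `[0, T]`. -/
theorem IsFlow.continuous_fderiv_clamp (hW : IsRegularField W M L N) (hΦ : IsFlow W T Φ)
    (hT : 0 ≤ T) : Continuous fun z : ℝ × E => fderiv ℝ (Φ (projIcc 0 T hT z.1)) z.2 := by
  have hcl : Continuous fun t : ℝ => ((projIcc 0 T hT t : Icc 0 T) : ℝ) := by fun_prop
  have hc : ∀ x, ContinuousOn (fun t => fderiv ℝ (Φ t) x) (Icc 0 T) := fun x t ht =>
    HasDerivWithinAt.continuousWithinAt ((hΦ.exists_variational hW hT x).2.2 t ht)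
  have hc' : ∀ x, Continuous fun t : ℝ => fderiv ℝ (Φ (projIcc 0 T hT t)) x := fun x =>
    (hc x).comp_continuous hcl fun t => (projIcc 0 T hT t).2
  have hl : ∀ t : ℝ, LipschitzWith (flowDerivLip L N T) (fderiv ℝ (Φ (projIcc 0 T hT t))) :=
    fun t => hΦ.lipschitz_fderiv hW (projIcc 0 T hT t).2
  exact continuous_of_lipschitz_right (f := fun t x => fderiv ℝ (Φ (projIcc 0 T hT t)) x) hc' hl

theorem IsFlow.invFun_apply (hW : IsRegularField W M L N) (hΦ : IsFlow W T Φ) {t : ℝ}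
    (ht : t ∈ Icc 0 T) (x : E) : Function.invFun (Φ t) (Φ t x) = x :=
  Function.leftInverse_invFun (hΦ.bijective hW ht).1 x

theorem IsFlow.apply_invFun (hW : IsRegularField W M L N) (hΦ : IsFlow W T Φ) {t : ℝ}
    (ht : t ∈ Icc 0 T) (y : E) : Φ t (Function.invFun (Φ t) y) = y :=
  Function.rightInverse_invFun (hΦ.bijective hW ht).2 y

theorem IsFlow.lipschitz_invFun (hW : IsRegularField W M L N) (hΦ : IsFlow W T Φ) {t : ℝ}
    (ht : t ∈ Icc 0 T) : LipschitzWith (flowLip L T) (Function.invFun (Φ t)) :=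
  (hΦ.antilipschitz hW ht).to_rightInverse (hΦ.apply_invFun hW ht)

theorem IsFlow.continuous_invFun_clamp (hW : IsRegularField W M L N) (hΦ : IsFlow W T Φ)
    (hT : 0 ≤ T) : Continuous fun z : ℝ × E => Function.invFun (Φ (projIcc 0 T hT z.1)) z.2 := by
  have h := continuous_prod_of_continuous_lipschitzWith
    (fun z : E × ℝ => Function.invFun (Φ (projIcc 0 T hT z.2)) z.1) (flowLip L T)
    (fun x => by
      refine (LipschitzWith.of_dist_le_mul (K := flowLip L T * M) fun s t => ?_).continuous
      set s' := projIcc 0 T hT s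
      set t' := projIcc 0 T hT t
      refine ((hΦ.antilipschitz hW s'.2).le_mul_dist _ _).trans ?_
      rw [hΦ.apply_invFun hW s'.2, NNReal.coe_mul, mul_assoc]
      gcongr
      -- Writing `x` as the image at time `t'` of its own preimage turns the time variation of the
      -- inverse into that of the flow along one trajectory.
      nth_rewrite 1 [← hΦ.apply_invFun hW t'.2 x]
      rw [dist_eq_norm]
      refine (hΦ.dist_time_le hW s'.2 t'.2 _).trans ?_
      gcongr
      rw [← Real.dist_eq, dist_comm]
      exact (LipschitzWith.projIcc hT).dist_le_mul s t |>.trans_eq (by simp))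
    (fun t => hΦ.lipschitz_invFun hW (projIcc 0 T hT t).2)
  exact h.comp continuous_swap

end FlowDerivative

/-! ### The coefficient matrices of the forms in terms of the velocity gradient. -/

section Forms

variable {d : ℕ} {W : ℝ → Vec d → Vec d} {M L N : ℝ≥0} {T : ℝ} {Φ : ℝ → Vec d → Vec d}

/-- Transposition as a continuous linear map. -/
noncomputable def adjointCLM (d : ℕ) : (Vec d →L[ℝ] Vec d) →L[ℝ] (Vec d →L[ℝ] Vec d) :=
  LinearMap.toContinuousLinearMap
    { toFun := fun A => ContinuousLinearMap.adjoint A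
      map_add' := fun A B => map_add _ A B
      map_smul' := fun c A => by simp }

theorem IsFlow.hasDerivAt_fderiv (hW : IsRegularField W M L N) (hΦ : IsFlow W T Φ) {t : ℝ}
    (ht : t ∈ Ioo 0 T) (x : Vec d) :
    HasDerivAt (fun s => DΦ Φ s x) (fderiv ℝ (W t) (Φ t x) ∘L DΦ Φ t x) t :=
  ((hΦ.exists_variational hW (ht.1.trans ht.2).le x).2.2 t (Ioo_subset_Icc_self ht)).hasDerivAt
    (Icc_mem_nhds ht.1 ht.2)

/-- By the variational equation the time derivative of `DΦᵀ DΦ` is `DΦᵀ (DWᵀ + DW) DΦ`, and the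
outer factors of `lamMatrix` cancel `DΦ`. What remains is twice the symmetric gradient of the
velocity. -/
theorem IsFlow.lamMatrix_eq (hW : IsRegularField W M L N) (hΦ : IsFlow W T Φ) {t : ℝ}
    (ht : t ∈ Ioo 0 T) (y : Vec d) :
    lamMatrix Φ t y = ContinuousLinearMap.adjoint (fderiv ℝ (W t) y) + fderiv ℝ (W t) y := by
  have ht' := Ioo_subset_Icc_self ht
  have hy : Φ t (flowInv Φ t y) = y := hΦ.apply_invFun hW ht' y
  set x := flowInv Φ t y with hx
  have h1 := hΦ.hasDerivAt_fderiv hW ht x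
  have h2 : HasDerivAt (fun s => ContinuousLinearMap.adjoint (DΦ Φ s x))
      (ContinuousLinearMap.adjoint (fderiv ℝ (W t) (Φ t x) ∘L DΦ Φ t x)) t :=
    (adjointCLM d).hasFDerivAt.comp_hasDerivAt t h1
  have h3 := h2.clm_comp h1
  have hinv := hΦ.isInvertible_fderiv hW ht' x
  have e1 : DΦ Φ t x ∘L DΦinv Φ t x = ContinuousLinearMap.id ℝ _ := hinv.self_comp_inverse
  have e2 : ContinuousLinearMap.adjoint (DΦinv Φ t x) ∘L ContinuousLinearMap.adjoint (DΦ Φ t x) =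
      ContinuousLinearMap.id ℝ _ := by
    rw [← ContinuousLinearMap.adjoint_comp, e1]
    exact ContinuousLinearMap.adjoint_id
  simp only [lamMatrix, ← hx]
  rw [h3.deriv, hy, ContinuousLinearMap.adjoint_comp]
  ext1 v
  have e1' : ∀ v, DΦ Φ t x (DΦinv Φ t x v) = v := fun v => congr($e1 v)
  have e2' : ∀ v, ContinuousLinearMap.adjoint (DΦinv Φ t x)
    (ContinuousLinearMap.adjoint (DΦ Φ t x) v) = v := fun v => congr($e2 v)
  simp [e1', e2']

/-- The derivative of the inverse is `-DΦ⁻¹ (DΦ)' DΦ⁻¹`, which the variational equation reduces to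
`-DΦ⁻¹ DW`. -/
theorem IsFlow.driftMatrix_eq (hW : IsRegularField W M L N) (hΦ : IsFlow W T Φ) {t : ℝ}
    (ht : t ∈ Ioo 0 T) (y : Vec d) : driftMatrix Φ t y = -fderiv ℝ (W t) y := by
  have ht' := Ioo_subset_Icc_self ht
  have hy : Φ t (flowInv Φ t y) = y := hΦ.apply_invFun hW ht' y
  set x := flowInv Φ t y with hx
  have h1 := hΦ.hasDerivAt_fderiv hW ht x
  have hinv := hΦ.isInvertible_fderiv hW ht' x
  have e1 : DΦ Φ t x ∘L DΦinv Φ t x = ContinuousLinearMap.id ℝ _ := hinv.self_comp_inverse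
  have e2 : DΦinv Φ t x ∘L DΦ Φ t x = ContinuousLinearMap.id ℝ _ := hinv.inverse_comp_self
  -- `DΦ_t x` is packaged as a unit of the operator algebra, where inversion is differentiable.
  let u : (Vec d →L[ℝ] Vec d)ˣ := ⟨DΦ Φ t x, DΦinv Φ t x, e1, e2⟩
  have h2 : HasDerivAt (fun s => DΦinv Φ s x)
      (-(DΦinv Φ t x * (fderiv ℝ (W t) (Φ t x) ∘L DΦ Φ t x) * DΦinv Φ t x)) t := by
    have := (hasFDerivAt_ringInverse (𝕜 := ℝ) u).comp_hasDerivAt t h1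
    simp only [Function.comp_def, ContinuousLinearMap.ringInverse_eq_inverse] at this
    exact this
  simp only [driftMatrix, ← hx]
  rw [h2.deriv, hy]
  ext1 v
  have e1' : ∀ v, DΦ Φ t x (DΦinv Φ t x v) = v := fun v => congr($e1 v)
  simp [e1']

end Forms

/-! ### From time-dependent compactly supported fields to regular fields and their flow. -/

section FieldOfTestFunctions

variable {d : ℕ}

set_option synthInstance.maxHeartbeats 200000 in
-- Taking the value, the first and the second derivative are continuous linear maps into bounded
-- continuous functions, the last one because `k ≥ 2`; on the compact interval `[0, T]` their norms
-- are therefore bounded. Only continuity in time is used. Clamping the time extends the field to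
-- `ℝ` with the same bounds.
theorem IsC1InTime.exists_isRegularField {k : ℕ} (hk : 2 ≤ k)
    {K : TopologicalSpace.Compacts (Vec d)} {T : ℝ} (hT : 0 ≤ T)
    {w : ℝ → ContDiffMapSupportedIn (Vec d) (Vec d) (k : ℕ∞) K} (hw : IsC1InTime T w) :
    ∃ M L N : ℝ≥0, IsRegularField (fun t x => w (projIcc 0 T hT t) x) M L N := by
  obtain ⟨w', -, hw'⟩ := hw
  have hc : ContinuousOn w (Icc 0 T) := fun t ht =>
    (hasDerivWithinAt_iff_hasFDerivWithinAt.1 (hw' t ht)).continuousWithinAt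
  have hcc : Continuous fun t : Icc 0 T => w t := hc.domRestrict
  let D₀ := ContDiffMapSupportedIn.toBoundedContinuousFunctionCLM (E := Vec d) (F := Vec d)
    (n := (k : ℕ∞)) (K := K) ℝ
  let D₁ := (ContDiffMapSupportedIn.toBoundedContinuousFunctionCLM (E := Vec d)
    (F := Vec d →L[ℝ] Vec d) (n := ((k - 1 : ℕ) : ℕ∞)) (K := K) ℝ).comp
      (ContDiffMapSupportedIn.fderivCLM ℝ (k : ℕ∞) ((k - 1 : ℕ) : ℕ∞))
  let D₂ := (ContDiffMapSupportedIn.toBoundedContinuousFunctionCLM (E := Vec d)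
    (F := Vec d →L[ℝ] Vec d →L[ℝ] Vec d) (n := ((k - 2 : ℕ) : ℕ∞)) (K := K) ℝ).comp
      ((ContDiffMapSupportedIn.fderivCLM ℝ ((k - 1 : ℕ) : ℕ∞) ((k - 2 : ℕ) : ℕ∞)).comp
        (ContDiffMapSupportedIn.fderivCLM ℝ (k : ℕ∞) ((k - 1 : ℕ) : ℕ∞)))
  have hk1 : ((k - 1 : ℕ) : ℕ∞) + 1 ≤ (k : ℕ∞) := by norm_cast; omega
  have hk2 : ((k - 2 : ℕ) : ℕ∞) + 1 ≤ ((k - 1 : ℕ) : ℕ∞) := by norm_cast; omega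
  have e0 : ∀ f x, D₀ f x = f x := fun f x => rfl
  have e1 : ∀ (f : ContDiffMapSupportedIn (Vec d) (Vec d) (k : ℕ∞) K) x,
      D₁ f x = fderiv ℝ f x := fun f x => by
    change ContDiffMapSupportedIn.fderivLM ℝ (k : ℕ∞) ((k - 1 : ℕ) : ℕ∞) f x = _
    rw [ContDiffMapSupportedIn.fderivLM_apply_of_le ℝ f hk1]
  have e2 : ∀ (f : ContDiffMapSupportedIn (Vec d) (Vec d) (k : ℕ∞) K) x,
      D₂ f x = fderiv ℝ (fderiv ℝ f) x := fun f x => by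
    change ContDiffMapSupportedIn.fderivLM ℝ ((k - 1 : ℕ) : ℕ∞) ((k - 2 : ℕ) : ℕ∞)
      (ContDiffMapSupportedIn.fderivLM ℝ (k : ℕ∞) ((k - 1 : ℕ) : ℕ∞) f) x = _
    rw [ContDiffMapSupportedIn.fderivLM_apply_of_le ℝ _ hk2,
      ContDiffMapSupportedIn.fderivLM_apply_of_le ℝ f hk1]
  have hbd : ∀ {G : Type} [NormedAddCommGroup G] (f : Icc 0 T → G), Continuous f →
      ∃ C : ℝ≥0, ∀ t, ‖f t‖ ≤ C := by
    intro G _ f hf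
    obtain ⟨C, hC⟩ := isCompact_univ.exists_bound_of_continuousOn hf.continuousOn
    exact ⟨C.toNNReal, fun t => (hC t trivial).trans (Real.le_coe_toNNReal C)⟩
  obtain ⟨M, hM⟩ := hbd _ (D₀.continuous.comp hcc)
  obtain ⟨L, hL⟩ := hbd _ (D₁.continuous.comp hcc)
  obtain ⟨N, hN⟩ := hbd _ (D₂.continuous.comp hcc)
  have hcp : Continuous fun t : ℝ => projIcc 0 T hT t := by fun_prop
  have hev : ∀ {G : Type} [NormedAddCommGroup G],
      Continuous fun z : BoundedContinuousFunction (Vec d) G × Vec d => z.1 z.2 :=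
    fun {G} _ => continuous_eval
  have hsm : ∀ t, ContDiff ℝ 2 (w t) := fun t => (w t).contDiff.of_le (by exact WithTop.coe_le_coe.2 (by exact_mod_cast hk))
  refine ⟨M, L, N, ?_, fun t => (hsm _).differentiable (by simp), fun t x => ?_, fun t x => ?_,
    fun t => ?_, ?_⟩
  · exact hev.comp (((D₀.continuous.comp (hcc.comp hcp)).comp continuous_fst).prodMk continuous_snd)
  · exact ((D₀ (w (projIcc 0 T hT t))).norm_coe_le_norm x).trans (hM _)
  · rw [← e1]
    exact ((D₁ (w (projIcc 0 T hT t))).norm_coe_le_norm x).trans (hL _)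
  · refine lipschitzWith_of_nnnorm_fderiv_le
      (((hsm _).fderiv_right (m := 1) le_rfl).differentiable (by simp)) fun x => ?_
    change ‖fderiv ℝ (fderiv ℝ (w (projIcc 0 T hT t))) x‖ ≤ N
    rw [← e2]
    exact ((D₂ (w (projIcc 0 T hT t))).norm_coe_le_norm x).trans (hN _)
  · simp only [← e1]
    exact hev.comp (((D₁.continuous.comp (hcc.comp hcp)).comp continuous_fst).prodMk continuous_snd)

/-- `flow` selects a trajectory by `Classical.epsilon`, so existence of a solution is all that its
specification needs. -/
theorem isFlow_flow {W : ℝ → Vec d → Vec d} {M L N : ℝ≥0} {T : ℝ} (hT : 0 ≤ T)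
    (hW : IsRegularField W M L N) {w : ℝ → Vec d → Vec d} (hw : ∀ t ∈ Icc 0 T, w t = W t) :
    IsFlow W T (flow w T) := by
  intro x
  obtain ⟨γ, h0, h1⟩ := exists_isFlow hW hT x
  have : ∃ γ, IsIntegralCurve w T x γ := ⟨γ, h0, fun t ht => by rw [hw t ht]; exact h1 t ht⟩
  obtain ⟨h2, h3⟩ := Classical.epsilon_spec this
  exact ⟨h2, fun t ht => by
    have := h3 t ht
    rw [hw t ht] at this
    exact this⟩

end FieldOfTestFunctions

end MovingStokes

/-! ### The Hilbert space `H¹₀`: norms, density of test functions, weak derivatives. -/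

namespace MovingStokes

open scoped NNReal

variable {d : ℕ}

/-- Completeness and second countability make `H10 Ω` a Polish space, as is needed for deducing
measurability in `H¹₀` from measurability in `L²`. -/
instance instCompleteSpaceH10 (Ω : Set (Vec d)) : CompleteSpace (H10 Ω) := by
  have : IsClosed (H10Sub Ω : Set (L2Pair Ω)) := Submodule.isClosed_topologicalClosure _
  exact this.completeSpace_coe

instance instSecondCountableH10 (Ω : Set (Vec d)) : SecondCountableTopology (H10 Ω) := by
  have : Fact ((2 : ℝ≥0∞) ≠ ⊤) := ⟨by simp⟩
  have h1 : SecondCountableTopology (L2Pair Ω) := by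
    have : SecondCountableTopology (L2 Ω) := inferInstance
    have : SecondCountableTopology (Lp (Mat d) 2 (volume.restrict Ω)) := inferInstance
    exact (WithLp.homeomorphProd 2 (L2 Ω)
      (Lp (Mat d) 2 (volume.restrict Ω))).isInducing.secondCountableTopology
  exact (inferInstance : SecondCountableTopology (H10Sub Ω))

/-- The function part of an element of `H¹₀`, as a continuous linear map. -/
noncomputable def fnHL (Ω : Set (Vec d)) : H10 Ω →L[ℝ] L2 Ω :=
  (WithLp.fstL 2 ℝ _ _).comp (H10Sub Ω).subtypeL

/-- The Jacobian part of an element of `H¹₀`, as a continuous linear map. -/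
noncomputable def jacHL (Ω : Set (Vec d)) : H10 Ω →L[ℝ] Lp (Mat d) 2 (volume.restrict Ω) :=
  (WithLp.sndL 2 ℝ _ _).comp (H10Sub Ω).subtypeL

@[simp] theorem fnHL_apply {Ω : Set (Vec d)} (u : H10 Ω) : fnHL Ω u = fnH u := rfl
@[simp] theorem jacHL_apply {Ω : Set (Vec d)} (u : H10 Ω) : jacHL Ω u = jacH u := rfl

theorem inner_H10 {Ω : Set (Vec d)} (u v : H10 Ω) :
    ⟪u, v⟫ = ⟪fnH u, fnH v⟫ + ⟪jacH u, jacH v⟫ := rfl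

theorem norm_sq_H10 {Ω : Set (Vec d)} (u : H10 Ω) :
    ‖u‖ ^ 2 = ‖fnH u‖ ^ 2 + ‖jacH u‖ ^ 2 := by
  rw [← real_inner_self_eq_norm_sq, inner_H10, real_inner_self_eq_norm_sq,
    real_inner_self_eq_norm_sq]

theorem norm_fnH_le {Ω : Set (Vec d)} (u : H10 Ω) : ‖fnH u‖ ≤ ‖u‖ := by
  refine le_of_sq_le_sq ?_ (norm_nonneg _)
  rw [norm_sq_H10]; nlinarith [sq_nonneg ‖jacH u‖]

theorem norm_jacH_le {Ω : Set (Vec d)} (u : H10 Ω) : ‖jacH u‖ ≤ ‖u‖ := by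
  refine le_of_sq_le_sq ?_ (norm_nonneg _)
  rw [norm_sq_H10]; nlinarith [sq_nonneg ‖fnH u‖]

theorem norm_H10_le {Ω : Set (Vec d)} (u : H10 Ω) : ‖u‖ ≤ ‖fnH u‖ + ‖jacH u‖ := by
  refine le_of_sq_le_sq ?_ (by positivity)
  rw [norm_sq_H10]; nlinarith [norm_nonneg (fnH u), norm_nonneg (jacH u)]

/-! ### Test functions -/

section Test

variable {Ω : Set (Vec d)} {φ ψ : Vec d → Vec d}

theorem IsTest.mono {Ω' : Set (Vec d)} (hφ : IsTest Ω φ) (h : Ω ⊆ Ω') : IsTest Ω' φ :=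
  ⟨hφ.1, hφ.2.1, hφ.2.2.trans h⟩

theorem IsTest.differentiable (hφ : IsTest Ω φ) : Differentiable ℝ φ :=
  hφ.1.differentiable (by simp)

theorem IsTest.eq_zero (hφ : IsTest Ω φ) {x : Vec d} (hx : x ∉ Ω) : φ x = 0 :=
  image_eq_zero_of_notMem_tsupport fun h => hx (hφ.2.2 h)

theorem IsTest.fderiv_eq_zero (hφ : IsTest Ω φ) {x : Vec d} (hx : x ∉ Ω) : fderiv ℝ φ x = 0 :=
  image_eq_zero_of_notMem_tsupport fun h => hx (hφ.2.2 (tsupport_fderiv_subset ℝ h))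

theorem IsTest.add (hφ : IsTest Ω φ) (hψ : IsTest Ω ψ) : IsTest Ω (φ + ψ) :=
  ⟨hφ.1.add hψ.1, hφ.2.1.add hψ.2.1,
    (tsupport_add φ ψ).trans (union_subset hφ.2.2 hψ.2.2)⟩

theorem IsTest.smul (c : ℝ) (hφ : IsTest Ω φ) : IsTest Ω (c • φ) :=
  ⟨hφ.1.const_smul c, hφ.2.1.smul_left (f := fun _ => c),
    (tsupport_smul_subset_right (fun _ => c) φ).trans hφ.2.2⟩

theorem IsTest.zero : IsTest Ω (0 : Vec d → Vec d) :=
  ⟨contDiff_const, HasCompactSupport.zero, by simp⟩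

/-- The Jacobian matrix as a linear function of the derivative. -/
noncomputable def matOfCLM (d : ℕ) : (Vec d →L[ℝ] Vec d) →L[ℝ] Mat d :=
  LinearMap.toContinuousLinearMap
    { toFun := fun A => WithLp.toLp 2 fun ij => A (EuclideanSpace.single ij.2 1) ij.1
      map_add' := fun A B => by ext; simp
      map_smul' := fun c A => by ext; simp }

theorem jacobian_eq (f : Vec d → Vec d) (x : Vec d) : jacobian f x = matOfCLM d (fderiv ℝ f x) :=
  rfl

theorem continuous_jacobian (hφ : ContDiff ℝ 1 φ) : Continuous (jacobian φ) :=
  (matOfCLM d).continuous.comp (hφ.continuous_fderiv (by simp))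

theorem hasCompactSupport_jacobian (hφ : HasCompactSupport φ) :
    HasCompactSupport (jacobian φ) :=
  (hφ.fderiv ℝ).comp_left (map_zero (matOfCLM d))

theorem jacobian_add (hφ : Differentiable ℝ φ) (hψ : Differentiable ℝ ψ) :
    jacobian (φ + ψ) = jacobian φ + jacobian ψ := by
  ext1 x
  simp only [jacobian_eq, Pi.add_apply, fderiv_add (hφ x) (hψ x), map_add]

theorem jacobian_smul (c : ℝ) (hφ : Differentiable ℝ φ) :
    jacobian (c • φ) = c • jacobian φ := by
  ext1 x
  simp only [jacobian_eq, Pi.smul_apply, fderiv_const_smul (hφ x), map_smul]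

theorem IsTest.memLp (hφ : IsTest Ω φ) (p : ℝ≥0∞) (μ : Measure (Vec d))
    [IsFiniteMeasureOnCompacts μ] : MemLp φ p μ :=
  hφ.1.continuous.memLp_of_hasCompactSupport hφ.2.1

theorem IsTest.memLp_jacobian (hφ : IsTest Ω φ) (p : ℝ≥0∞) (μ : Measure (Vec d))
    [IsFiniteMeasureOnCompacts μ] : MemLp (jacobian φ) p μ :=
  (continuous_jacobian (hφ.1.of_le (by simp))).memLp_of_hasCompactSupport
    (hasCompactSupport_jacobian hφ.2.1)

/-- A test function as an element of `H¹₀`. -/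
noncomputable def IsTest.toH10 (hφ : IsTest Ω φ) : H10 Ω :=
  ⟨WithLp.toLp 2 ((hφ.memLp 2 (volume.restrict Ω)).toLp φ,
      (hφ.memLp_jacobian 2 (volume.restrict Ω)).toLp (jacobian φ)),
    Submodule.le_topologicalClosure _ (Submodule.subset_span
      ⟨φ, hφ, (hφ.memLp 2 (volume.restrict Ω)).coeFn_toLp,
        (hφ.memLp_jacobian 2 (volume.restrict Ω)).coeFn_toLp⟩)⟩

theorem IsTest.coeFn_fnH (hφ : IsTest Ω φ) : fnH hφ.toH10 =ᵐ[volume.restrict Ω] φ :=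
  MemLp.coeFn_toLp (hφ.memLp 2 (volume.restrict Ω))

theorem IsTest.coeFn_jacH (hφ : IsTest Ω φ) :
    jacH hφ.toH10 =ᵐ[volume.restrict Ω] jacobian φ :=
  MemLp.coeFn_toLp (hφ.memLp_jacobian 2 (volume.restrict Ω))

theorem fnH_add (u v : H10 Ω) : fnH (u + v) = fnH u + fnH v := rfl
theorem jacH_add (u v : H10 Ω) : jacH (u + v) = jacH u + jacH v := rfl
theorem fnH_smul (c : ℝ) (u : H10 Ω) : fnH (c • u) = c • fnH u := rfl
theorem jacH_smul (c : ℝ) (u : H10 Ω) : jacH (c • u) = c • jacH u := rfl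
theorem fnH_zero : fnH (0 : H10 Ω) = 0 := rfl
theorem jacH_zero : jacH (0 : H10 Ω) = 0 := rfl

theorem H10.ext_of {u v : H10 Ω} (h1 : fnH u = fnH v) (h2 : jacH u = jacH v) : u = v :=
  Subtype.ext (WithLp.ofLp_injective 2 (Prod.ext h1 h2))

theorem H10.ext_ae {u v : H10 Ω} {f : Vec d → Vec d} {g : Vec d → Mat d}
    (h1 : fnH u =ᵐ[volume.restrict Ω] f) (h2 : fnH v =ᵐ[volume.restrict Ω] f)
    (h3 : jacH u =ᵐ[volume.restrict Ω] g) (h4 : jacH v =ᵐ[volume.restrict Ω] g) : u = v :=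
  H10.ext_of (Lp.ext (h1.trans h2.symm)) (Lp.ext (h3.trans h4.symm))

theorem IsTest.toH10_add (hφ : IsTest Ω φ) (hψ : IsTest Ω ψ) :
    (hφ.add hψ).toH10 = hφ.toH10 + hψ.toH10 := by
  refine H10.ext_ae (hφ.add hψ).coeFn_fnH ?_ (hφ.add hψ).coeFn_jacH ?_
  · rw [fnH_add]
    filter_upwards [Lp.coeFn_add (fnH hφ.toH10) (fnH hψ.toH10), hφ.coeFn_fnH, hψ.coeFn_fnH]
      with x h1 h2 h3
    rw [h1, Pi.add_apply, Pi.add_apply, h2, h3]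
  · rw [jacH_add, jacobian_add hφ.differentiable hψ.differentiable]
    filter_upwards [Lp.coeFn_add (jacH hφ.toH10) (jacH hψ.toH10), hφ.coeFn_jacH, hψ.coeFn_jacH]
      with x h1 h2 h3
    rw [h1, Pi.add_apply, Pi.add_apply, h2, h3]

theorem IsTest.toH10_smul (c : ℝ) (hφ : IsTest Ω φ) :
    (hφ.smul c).toH10 = c • hφ.toH10 := by
  refine H10.ext_ae (hφ.smul c).coeFn_fnH ?_ (hφ.smul c).coeFn_jacH ?_
  · rw [fnH_smul]
    filter_upwards [Lp.coeFn_smul c (fnH hφ.toH10), hφ.coeFn_fnH] with x h1 h2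
    rw [h1, Pi.smul_apply, Pi.smul_apply, h2]
  · rw [jacH_smul, jacobian_smul c hφ.differentiable]
    filter_upwards [Lp.coeFn_smul c (jacH hφ.toH10), hφ.coeFn_jacH] with x h1 h2
    rw [h1, Pi.smul_apply, Pi.smul_apply, h2]

theorem IsTest.toH10_zero : (IsTest.zero (Ω := Ω)).toH10 = 0 := by
  have h0 : jacobian (0 : Vec d → Vec d) = 0 := by
    ext1 x
    simp [jacobian_eq]
  refine H10.ext_ae IsTest.zero.coeFn_fnH ?_ IsTest.zero.coeFn_jacH ?_
  · rw [fnH_zero]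
    exact Lp.coeFn_zero _ _ _
  · rw [jacH_zero, h0]
    exact Lp.coeFn_zero _ _ _

/-- The subspace of `H¹₀` of test functions. -/
noncomputable def testSub (Ω : Set (Vec d)) : Submodule ℝ (H10 Ω) where
  carrier := {v | ∃ φ, ∃ hφ : IsTest Ω φ, v = hφ.toH10}
  zero_mem' := ⟨0, IsTest.zero, IsTest.toH10_zero.symm⟩
  add_mem' := by
    rintro _ _ ⟨φ, hφ, rfl⟩ ⟨ψ, hψ, rfl⟩
    exact ⟨φ + ψ, hφ.add hψ, (hφ.toH10_add hψ).symm⟩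
  smul_mem' := by
    rintro c _ ⟨φ, hφ, rfl⟩
    exact ⟨c • φ, hφ.smul c, (hφ.toH10_smul c).symm⟩

/-- Every element of `H¹₀` is a limit of test functions. -/
theorem H10.mem_closure_testSub (u : H10 Ω) : u ∈ closure (testSub Ω : Set (H10 Ω)) := by
  have hspan : (Submodule.span ℝ {p : L2Pair Ω | ∃ φ : Vec d → Vec d, IsTest Ω φ ∧
      p.fst =ᵐ[volume.restrict Ω] φ ∧ p.snd =ᵐ[volume.restrict Ω] jacobian φ}) ≤
      (testSub Ω).map (H10Sub Ω).subtype := by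
    rw [Submodule.span_le]
    rintro p ⟨φ, hφ, h1, h2⟩
    refine ⟨hφ.toH10, ⟨φ, hφ, rfl⟩, WithLp.ofLp_injective 2 (Prod.ext ?_ ?_)⟩
    · exact Lp.ext (hφ.coeFn_fnH.trans h1.symm)
    · exact Lp.ext (hφ.coeFn_jacH.trans h2.symm)
  have h1 : (Subtype.val u : L2Pair Ω) ∈ closure ((Submodule.span ℝ {p : L2Pair Ω |
    ∃ φ : Vec d → Vec d, IsTest Ω φ ∧ p.fst =ᵐ[volume.restrict Ω] φ ∧
      p.snd =ᵐ[volume.restrict Ω] jacobian φ} :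
    Submodule ℝ (L2Pair Ω)) : Set (L2Pair Ω)) := u.2
  have h2 := closure_mono (SetLike.coe_subset_coe.2 hspan) h1
  have h3 : Topology.IsInducing (fun v : H10 Ω => (Subtype.val v : L2Pair Ω)) :=
    Topology.IsInducing.subtypeVal
  rw [h3.closure_eq_preimage_closure_image]
  exact h2

theorem H10.induction_closed {P : H10 Ω → Prop} (hP : IsClosed {u | P u})
    (h : ∀ φ (hφ : IsTest Ω φ), P hφ.toH10) (u : H10 Ω) : P u := by
  refine closure_minimal ?_ hP u.mem_closure_testSub
  rintro _ ⟨φ, hφ, rfl⟩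
  exact h φ hφ

theorem H10.exists_seq_tendsto (u : H10 Ω) : ∃ (φ : ℕ → Vec d → Vec d)
    (hφ : ∀ n, IsTest Ω (φ n)), Filter.Tendsto (fun n => (hφ n).toH10) Filter.atTop (𝓝 u) := by
  obtain ⟨v, hv, hlim⟩ := mem_closure_iff_seq_limit.1 u.mem_closure_testSub
  choose φ hφ h using hv
  exact ⟨φ, hφ, hlim.congr h⟩

end Test

/-! ### Weak derivatives -/

theorem continuous_integral_inner {α F : Type*} [MeasurableSpace α] {μ : Measure α}
    [NormedAddCommGroup F] [InnerProductSpace ℝ F] {g : α → F} (hg : MemLp g 2 μ) :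
    Continuous fun u : Lp F 2 μ => ∫ x, ⟪u x, g x⟫ ∂μ := by
  have : (fun u : Lp F 2 μ => ∫ x, ⟪u x, g x⟫ ∂μ) = fun u => ⟪u, hg.toLp g⟫ := by
    ext u
    rw [L2.inner_def]
    refine integral_congr_ae ?_
    filter_upwards [hg.coeFn_toLp] with x hx
    rw [hx]
  rw [this]
  fun_prop

theorem memLp_single {ι : Type*} [Fintype ι] [DecidableEq ι] {f : Vec d → ℝ} (hf : Continuous f)
    (hfc : HasCompactSupport f) (p : ℝ≥0∞) (μ : Measure (Vec d)) [IsFiniteMeasureOnCompacts μ]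
    (i : ι) : MemLp (fun x => EuclideanSpace.single i (f x)) p μ := by
  have : (fun x => EuclideanSpace.single i (f x)) =
      fun x => f x • EuclideanSpace.single i (1 : ℝ) := by
    ext x k; simp
  rw [this]
  exact (hf.smul continuous_const).memLp_of_hasCompactSupport hfc.smul_right

/-- Integration by parts against a `C¹` function with compact support. -/
theorem integral_jacH_mul {Ω : Set (Vec d)} (u : H10 Ω) {ψ : Vec d → ℝ} (hψ : ContDiff ℝ 1 ψ)
    (hψc : HasCompactSupport ψ) (i j : Fin d) :
    ∫ x in Ω, jacH u x (i, j) * ψ x =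
      -∫ x in Ω, fnH u x i * fderiv ℝ ψ x (EuclideanSpace.single j 1) := by
  have hc1 : Continuous fun x => fderiv ℝ ψ x (EuclideanSpace.single j (1 : ℝ)) :=
    (hψ.continuous_fderiv (by simp)).clm_apply continuous_const
  have hg1 := memLp_single hψ.continuous hψc 2 (volume.restrict Ω) (i, j)
  have hg2 := memLp_single hc1 (hψc.fderiv_apply ℝ _) 2 (volume.restrict Ω) i
  refine H10.induction_closed (P := fun u => ∫ x in Ω, jacH u x (i, j) * ψ x =
      -∫ x in Ω, fnH u x i * fderiv ℝ ψ x (EuclideanSpace.single j 1)) ?_ ?_ u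
  · have h1 : Continuous fun u : H10 Ω => ∫ x in Ω, jacH u x (i, j) * ψ x :=
      ((continuous_integral_inner hg1).comp (jacHL Ω).continuous).congr fun u =>
        integral_congr_ae (Filter.Eventually.of_forall fun x => by
          simp [EuclideanSpace.inner_single_right, mul_comm])
    have h2 : Continuous fun u : H10 Ω =>
        ∫ x in Ω, fnH u x i * fderiv ℝ ψ x (EuclideanSpace.single j 1) :=
      ((continuous_integral_inner hg2).comp (fnHL Ω).continuous).congr fun u =>
        integral_congr_ae (Filter.Eventually.of_forall fun x => by
          simp [EuclideanSpace.inner_single_right, mul_comm])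
    exact isClosed_eq h1 h2.neg
  -- The test function `φ` vanishes outside `Ω`, so both integrals are integrals over the whole
  -- space, where no boundary term arises even if `ψ` is not supported in `Ω`.
  · intro φ hφ
    have e1 : ∫ x in Ω, jacH hφ.toH10 x (i, j) * ψ x = ∫ x, jacobian φ x (i, j) * ψ x := by
      rw [← setIntegral_eq_integral_of_forall_compl_eq_zero (s := Ω)
        (f := fun x => jacobian φ x (i, j) * ψ x)
        (fun x hx => by simp [jacobian_eq, hφ.fderiv_eq_zero hx])]
      refine integral_congr_ae ?_
      filter_upwards [hφ.coeFn_jacH] with x hx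
      rw [hx]
    have e2 : ∫ x in Ω, fnH hφ.toH10 x i * fderiv ℝ ψ x (EuclideanSpace.single j 1) =
        ∫ x, φ x i * fderiv ℝ ψ x (EuclideanSpace.single j 1) := by
      rw [← setIntegral_eq_integral_of_forall_compl_eq_zero (s := Ω)
        (f := fun x => φ x i * fderiv ℝ ψ x (EuclideanSpace.single j 1))
        (fun x hx => by simp [hφ.eq_zero hx])]
      refine integral_congr_ae ?_
      filter_upwards [hφ.coeFn_fnH] with x hx
      rw [hx]
    rw [e1, e2]
    have hφi : ContDiff ℝ 1 fun x => φ x i :=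
      (EuclideanSpace.proj (𝕜 := ℝ) i).contDiff.comp (hφ.1.of_le (by simp))
    have hφic : HasCompactSupport fun x => φ x i := hφ.2.1.comp_left (g := fun v : Vec d => v i) rfl
    have hfd : ∀ x, fderiv ℝ (fun x => φ x i) x (EuclideanSpace.single j 1) =
        jacobian φ x (i, j) := by
      intro x
      have := ((EuclideanSpace.proj (𝕜 := ℝ) i).hasFDerivAt.comp x
        (hφ.differentiable x).hasFDerivAt).fderiv
      simp only [Function.comp_def] at this
      change fderiv ℝ (fun x => (EuclideanSpace.proj (𝕜 := ℝ) i) (φ x)) x _ = _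
      rw [this]; rfl
    have hc3 : Continuous fun x => fderiv ℝ (fun x => φ x i) x (EuclideanSpace.single j 1) :=
      (hφi.continuous_fderiv (by simp)).clm_apply continuous_const
    have := integral_mul_fderiv_eq_neg_fderiv_mul_of_integrable (μ := volume)
      (f := fun x => φ x i) (g := ψ) (v := EuclideanSpace.single j 1)
      ((hc3.mul hψ.continuous).integrable_of_hasCompactSupport hψc.mul_left)
      ((hφi.continuous.mul hc1).integrable_of_hasCompactSupport hφic.mul_right)
      ((hφi.continuous.mul hψ.continuous).integrable_of_hasCompactSupport hφic.mul_right)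
      (fun x _ => hφi.differentiable (by simp) x) (fun x _ => hψ.differentiable (by simp) x)
    rw [this, neg_neg]
    simp only [hfd]

/-- The function determines its weak Jacobian: if `u = 0`, integration by parts makes the Jacobian
orthogonal to every smooth compactly supported function on `ℝ^d`. Since these need not be supported
in `Ω`, nothing is required of `Ω`. -/
theorem fnH_injective (Ω : Set (Vec d)) : Function.Injective (fnH : H10 Ω → L2 Ω) := by
  suffices ∀ u : H10 Ω, fnH u = 0 → jacH u = 0 by
    intro u v huv
    have h1 : fnH (u - v) = 0 := by
      rw [← fnHL_apply, map_sub, fnHL_apply, fnHL_apply, huv, sub_self]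
    have h2 := this _ h1
    exact sub_eq_zero.1 (H10.ext_of (v := 0) h1 h2)
  intro u hu
  refine Lp.ext ?_
  have key : ∀ ij : Fin d × Fin d, ∀ᵐ x ∂(volume.restrict Ω), jacH u x ij = 0 := by
    rintro ⟨i, j⟩
    have hmem : MemLp (fun x => jacH u x (i, j)) 2 (volume.restrict Ω) :=
      (EuclideanSpace.proj (𝕜 := ℝ) (i, j)).comp_memLp' (Lp.memLp (jacH u))
    refine ae_eq_zero_of_integral_contDiff_smul_eq_zero
      (hmem.locallyIntegrable (by norm_num)) fun g hg hgc => ?_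
    have := integral_jacH_mul u (hg.of_le (by simp)) hgc i j
    simp only [smul_eq_mul, mul_comm (g _)]
    rw [this, neg_eq_zero]
    refine integral_eq_zero_of_ae ?_
    rw [hu]
    filter_upwards [Lp.coeFn_zero (Vec d) 2 (volume.restrict Ω)] with x hx
    rw [hx]
    simp
  filter_upwards [ae_all_iff.2 key, Lp.coeFn_zero (Mat d) 2 (volume.restrict Ω)] with x hx h0
  rw [h0]
  ext ij
  exact hx ij

end MovingStokes

namespace MovingStokes

open scoped NNReal
open Filter (Tendsto atTop)

variable {d : ℕ}

/-! ### Bounded sequences -/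

/-- If `S` is injective, `u n` is bounded and `S (u n)` converges, then `u n` converges weakly. -/
theorem exists_weak_limit {H G : Type*} [NormedAddCommGroup H] [InnerProductSpace ℝ H]
    [CompleteSpace H] [NormedAddCommGroup G] [InnerProductSpace ℝ G] [CompleteSpace G]
    (S : H →L[ℝ] G) (hS : Function.Injective S) {u : ℕ → H} {c : ℕ → ℝ} {C : ℝ}
    (hu : ∀ n, ‖u n‖ ≤ c n) (hc : Tendsto c atTop (𝓝 C)) {g : G}
    (hg : Tendsto (fun n => S (u n)) atTop (𝓝 g)) :
    ∃ v, S v = g ∧ ‖v‖ ≤ C ∧ ∀ h, Tendsto (fun n => ⟪u n, h⟫) atTop (𝓝 ⟪v, h⟫) := by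
  obtain ⟨B, hB⟩ := hc.bddAbove_range
  have hB' : ∀ n, ‖u n‖ ≤ B := fun n => (hu n).trans (hB ⟨n, rfl⟩)
  have hB0 : 0 ≤ B := (norm_nonneg _).trans (hB' 0)
  -- Injectivity of `S` says that its adjoint has dense range. Against the range, `⟪u n, ·⟫`
  -- converges because `S (u n)` does; boundedness of `u n` extends this to all of `H`.
  have hdense : Dense (Set.range (ContinuousLinearMap.adjoint S)) := by
    have h1 : (ContinuousLinearMap.adjoint S).rangeᗮ = ⊥ := by
      rw [ContinuousLinearMap.orthogonal_range, ContinuousLinearMap.adjoint_adjoint]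
      exact LinearMap.ker_eq_bot.2 hS
    have h2 := Submodule.topologicalClosure_eq_top_iff.2 h1
    rw [← Submodule.dense_iff_topologicalClosure_eq_top] at h2
    exact h2
  have hcauchy : ∀ h, CauchySeq fun n => ⟪u n, h⟫ := by
    intro h
    rw [Metric.cauchySeq_iff']
    intro ε hε
    obtain ⟨_, ⟨k, rfl⟩, hk⟩ := hdense.exists_dist_lt h (ε := ε / (4 * (B + 1))) (by positivity)
    have hk' : ‖h - ContinuousLinearMap.adjoint S k‖ ≤ ε / (4 * (B + 1)) := by
      rw [dist_eq_norm] at hk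
      exact hk.le
    have h1 : CauchySeq fun n => ⟪S (u n), k⟫ := (hg.inner tendsto_const_nhds).cauchySeq
    obtain ⟨N, hN⟩ := Metric.cauchySeq_iff'.1 h1 (ε / 2) (by positivity)
    refine ⟨N, fun n hn => ?_⟩
    have h2 := hN n hn
    rw [Real.dist_eq] at h2 ⊢
    have e : ∀ n, ⟪u n, h⟫ = ⟪S (u n), k⟫ + ⟪u n, h - ContinuousLinearMap.adjoint S k⟫ := by
      intro n
      rw [inner_sub_right, ContinuousLinearMap.adjoint_inner_right]; ring
    have h3 : ∀ n, |⟪u n, h - ContinuousLinearMap.adjoint S k⟫| ≤ ε / 4 := by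
      intro n
      refine (abs_real_inner_le_norm _ _).trans ?_
      calc ‖u n‖ * ‖h - ContinuousLinearMap.adjoint S k‖ ≤ (B + 1) * (ε / (4 * (B + 1))) := by
            gcongr
            linarith [hB' n]
        _ = ε / 4 := by field_simp
    rw [e n, e N]
    have h4 := abs_le.1 (h3 n)
    have h5 := abs_le.1 (h3 N)
    rw [abs_lt] at h2 ⊢
    constructor <;> linarith
  -- The pointwise limits form a linear functional of norm at most `C`; its Riesz representative is
  -- the weak limit.
  choose L hL using fun h => cauchySeq_tendsto_of_complete (hcauchy h)
  have hLn : ∀ h, ‖L h‖ ≤ C * ‖h‖ := fun h =>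
    le_of_tendsto_of_tendsto (hL h).norm (hc.mul_const ‖h‖) (Filter.Eventually.of_forall fun n =>
      (norm_inner_le_norm _ _).trans (mul_le_mul_of_nonneg_right (hu n) (norm_nonneg _)))
  let Llin : H →ₗ[ℝ] ℝ :=
    { toFun := L
      map_add' := fun x y => tendsto_nhds_unique (hL (x + y))
        (((hL x).add (hL y)).congr fun n => (inner_add_right _ _ _).symm)
      map_smul' := fun a x => tendsto_nhds_unique (hL (a • x))
        (((hL x).const_mul a).congr fun n => (real_inner_smul_right _ _ _).symm) }
  let Lc : StrongDual ℝ H := Llin.mkContinuous C hLn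
  let v := (InnerProductSpace.toDual ℝ H).symm Lc
  have hv : ∀ h, ⟪v, h⟫ = L h := fun h => InnerProductSpace.toDual_symm_apply
  have hw : ∀ h, Tendsto (fun n => ⟪u n, h⟫) atTop (𝓝 ⟪v, h⟫) := fun h => by
    rw [hv]; exact hL h
  refine ⟨v, ext_inner_right ℝ fun k => ?_, ?_, hw⟩
  · rw [← ContinuousLinearMap.adjoint_inner_right]
    refine tendsto_nhds_unique (hw _) ?_
    refine (hg.inner (tendsto_const_nhds (x := k))).congr fun n => ?_
    rw [ContinuousLinearMap.adjoint_inner_right]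
  · have hC : 0 ≤ C := ge_of_tendsto' hc fun n => (norm_nonneg _).trans (hu n)
    rw [show v = (InnerProductSpace.toDual ℝ H).symm Lc from rfl, LinearIsometryEquiv.norm_map]
    exact Llin.mkContinuous_norm_le hC hLn

/-- This is how operations defined on test functions pass to `H¹₀`: `L²` convergence and bounded
Jacobians suffice, and the Jacobians need not converge strongly. -/
theorem H10.exists_weak_limit {Ω : Set (Vec d)} {u : ℕ → H10 Ω} {c : ℕ → ℝ} {C : ℝ}
    (hu : ∀ n, ‖u n‖ ≤ c n) (hc : Tendsto c atTop (𝓝 C)) {g : L2 Ω}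
    (hg : Tendsto (fun n => fnH (u n)) atTop (𝓝 g)) :
    ∃ v : H10 Ω, fnH v = g ∧ ‖v‖ ≤ C ∧
      ∀ ℓ : StrongDual ℝ (H10 Ω), Tendsto (fun n => ℓ (u n)) atTop (𝓝 (ℓ v)) := by
  obtain ⟨v, h1, h2, h3⟩ := MovingStokes.exists_weak_limit (fnHL Ω) (fnH_injective Ω) hu hc hg
  refine ⟨v, h1, h2, fun ℓ => ?_⟩
  have := h3 ((InnerProductSpace.toDual ℝ _).symm ℓ)
  have e : ∀ x, ⟪x, (InnerProductSpace.toDual ℝ (H10 Ω)).symm ℓ⟫ = ℓ x := fun x => by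
    rw [real_inner_comm, InnerProductSpace.toDual_symm_apply]
  simpa only [e] using this

/-! ### Operations on `H¹₀` -/

theorem Lp_norm_le_add {α F G K : Type*} [MeasurableSpace α] {μ : Measure α}
    [NormedAddCommGroup F] [NormedAddCommGroup G] [NormedAddCommGroup K] {p : ℝ≥0∞}
    [Fact (1 ≤ p)] (f : Lp F p μ) (g : Lp G p μ) (k : Lp K p μ) {a b : ℝ} (ha : 0 ≤ a)
    (hb : 0 ≤ b) (h : ∀ᵐ x ∂μ, ‖f x‖ ≤ a * ‖g x‖ + b * ‖k x‖) : ‖f‖ ≤ a * ‖g‖ + b * ‖k‖ := by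
  have hg : MemLp (fun x => a * ‖g x‖) p μ := (Lp.memLp g).norm.const_mul a
  have hk : MemLp (fun x => b * ‖k x‖) p μ := (Lp.memLp k).norm.const_mul b
  have e1 : ‖hg.toLp _‖ = a * ‖g‖ := by
    rw [Lp.norm_toLp]
    change (eLpNorm (a • fun x => ‖g x‖) p μ).toReal = _
    rw [eLpNorm_const_smul, ENNReal.toReal_mul, eLpNorm_norm, Lp.norm_def]
    simp [abs_of_nonneg ha]
  have e2 : ‖hk.toLp _‖ = b * ‖k‖ := by
    rw [Lp.norm_toLp]
    change (eLpNorm (b • fun x => ‖k x‖) p μ).toReal = _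
    rw [eLpNorm_const_smul, ENNReal.toReal_mul, eLpNorm_norm, Lp.norm_def]
    simp [abs_of_nonneg hb]
  rw [← e1, ← e2]
  refine le_trans ?_ (norm_add_le _ _)
  refine Lp.norm_le_norm_of_ae_le ?_
  filter_upwards [h, Lp.coeFn_add (hg.toLp _) (hk.toLp _), hg.coeFn_toLp, hk.coeFn_toLp]
    with x h1 h2 h3 h4
  rw [h2, Pi.add_apply, h3, h4]
  exact h1.trans (le_abs_self _)

theorem norm_matOfCLM_sq (A : Vec d →L[ℝ] Vec d) :
    ‖matOfCLM d A‖ ^ 2 = ∑ j, ‖A (EuclideanSpace.single j 1)‖ ^ 2 := by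
  rw [EuclideanSpace.norm_sq_eq, Fintype.sum_prod_type, Finset.sum_comm]
  refine Finset.sum_congr rfl fun j _ => ?_
  rw [EuclideanSpace.norm_sq_eq]
  rfl

theorem norm_matOfCLM_comp_le (A B : Vec d →L[ℝ] Vec d) :
    ‖matOfCLM d (A ∘L B)‖ ≤ ‖A‖ * ‖matOfCLM d B‖ := by
  refine le_of_sq_le_sq ?_ (by positivity)
  rw [mul_pow, norm_matOfCLM_sq, norm_matOfCLM_sq, Finset.mul_sum]
  refine Finset.sum_le_sum fun j _ => ?_
  rw [← mul_pow]
  gcongr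
  exact A.le_opNorm _

theorem IsTest.of_support {Ω : Set (Vec d)} {φ ψ : Vec d → Vec d} (hφ : IsTest Ω φ)
    (hψ : ContDiff ℝ ∞ ψ) (h : ∀ x, φ x = 0 → ψ x = 0) : IsTest Ω ψ := by
  have hs : tsupport ψ ⊆ tsupport φ :=
    closure_mono fun x hx hφx => hx (h x hφx)
  exact ⟨hψ, hφ.2.1.mono' ((subset_tsupport ψ).trans hs), hs.trans hφ.2.2⟩

/-- Composition of an `H¹₀` field with a smooth Lipschitz map that fixes the origin. -/
theorem H10.exists_comp {Ω : Set (Vec d)} {τ : Vec d → Vec d} (hτ : ContDiff ℝ ∞ τ) (h0 : τ 0 = 0)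
    (hl : LipschitzWith 1 τ) (u : H10 Ω) {φ : ℕ → Vec d → Vec d} (hφ : ∀ n, IsTest Ω (φ n))
    (hlim : Tendsto (fun n => (hφ n).toH10) atTop (𝓝 u)) :
    ∃ (hψ : ∀ n, IsTest Ω (τ ∘ φ n)) (v : H10 Ω), fnH v = hl.compLp h0 (fnH u) ∧ ‖v‖ ≤ 2 * ‖u‖ ∧
      ∀ ℓ : StrongDual ℝ (H10 Ω), Tendsto (fun n => ℓ (hψ n).toH10) atTop (𝓝 (ℓ v)) := by
  have hψ : ∀ n, IsTest Ω (τ ∘ φ n) := fun n =>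
    (hφ n).of_support (hτ.comp (hφ n).1) fun x hx => by simp [hx, h0]
  have hfn : ∀ n, fnH (hψ n).toH10 = hl.compLp h0 (fnH (hφ n).toH10) := fun n => by
    refine Lp.ext ?_
    filter_upwards [(hψ n).coeFn_fnH, (hφ n).coeFn_fnH,
      hl.coeFn_compLp h0 (fnH (hφ n).toH10)] with x h1 h2 h3
    rw [h1, h3, Function.comp_apply, Function.comp_apply, h2]
  -- By the chain rule and `‖Dτ‖ ≤ 1` the Jacobians stay bounded, which is all the weak limit needs.
  -- The factor `2` in the statement comes from splitting the `H¹₀` norm into its two parts.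
  have hjac : ∀ n, ‖jacH (hψ n).toH10‖ ≤ ‖jacH (hφ n).toH10‖ := fun n => by
    refine Lp.norm_le_norm_of_ae_le ?_
    filter_upwards [(hψ n).coeFn_jacH, (hφ n).coeFn_jacH] with x h1 h2
    rw [h1, h2, jacobian_eq, jacobian_eq, fderiv_comp x (hτ.differentiable (by simp) _)
      ((hφ n).differentiable x)]
    refine (norm_matOfCLM_comp_le _ _).trans (mul_le_of_le_one_left (norm_nonneg _) ?_)
    simpa using norm_fderiv_le_of_lipschitz ℝ hl (x₀ := φ n x)
  have hn : ∀ n, ‖(hψ n).toH10‖ ≤ 2 * ‖(hφ n).toH10‖ := fun n => by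
    have h1 : ‖fnH (hψ n).toH10‖ ≤ ‖fnH (hφ n).toH10‖ := by
      rw [hfn]; simpa using hl.norm_compLp_le h0 (fnH (hφ n).toH10)
    linarith [norm_H10_le (hψ n).toH10, norm_fnH_le (hφ n).toH10, norm_jacH_le (hφ n).toH10,
      hjac n]
  have hg : Tendsto (fun n => fnH (hψ n).toH10) atTop (𝓝 (hl.compLp h0 (fnH u))) := by
    simp only [hfn]
    exact ((hl.continuous_compLp h0).tendsto _).comp (((fnHL Ω).continuous.tendsto u).comp hlim)
  exact ⟨hψ, H10.exists_weak_limit hn (hlim.norm.const_mul 2) hg⟩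

/-- Uniform approximation of bounded Lipschitz maps by smooth ones with the same bounds. -/
theorem exists_smooth_approx {F : Type*} [NormedAddCommGroup F] [NormedSpace ℝ F]
    [CompleteSpace F] {A : Vec d → F} {B : ℝ} {K : ℝ≥0} (hB : ∀ x, ‖A x‖ ≤ B)
    (hA : LipschitzWith K A) {ε : ℝ} (hε : 0 < ε) :
    ∃ A' : Vec d → F, ContDiff ℝ ∞ A' ∧ LipschitzWith K A' ∧ (∀ x, ‖A' x‖ ≤ B) ∧
      ∀ x, ‖A' x - A x‖ ≤ ε := by
  have hδ : 0 < ε / (K + 1) := by positivity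
  let φ : ContDiffBump (0 : Vec d) := ⟨ε / (K + 1) / 2, ε / (K + 1), by positivity, by linarith⟩
  let A' : Vec d → F := convolution (φ.normed volume) A (ContinuousLinearMap.lsmul ℝ ℝ) volume
  have hAc : Continuous A := hA.continuous
  have hint : ∀ x, Integrable fun t => φ.normed volume t • A (x - t) := fun x =>
    (φ.continuous_normed.smul (hAc.comp (by fun_prop))).integrable_of_hasCompactSupport
      φ.hasCompactSupport_normed.smul_right
  refine ⟨A', φ.hasCompactSupport_normed.contDiff_convolution_left _ φ.contDiff_normed
    hAc.locallyIntegrable, LipschitzWith.of_dist_le_mul fun x y => ?_, fun x => ?_, fun x => ?_⟩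
  · rw [dist_eq_norm]
    have e : A' x - A' y = ∫ t, φ.normed volume t • (A (x - t) - A (y - t)) := by
      simp only [A', convolution_def, ContinuousLinearMap.lsmul_apply]
      rw [← integral_sub (hint x) (hint y)]
      simp only [smul_sub]
    rw [e]
    refine (norm_integral_le_of_norm_le (g := fun t => φ.normed volume t * (K * dist x y))
      (φ.integrable_normed.mul_const _) (Filter.Eventually.of_forall fun t => ?_)).trans_eq ?_
    · rw [norm_smul, Real.norm_of_nonneg (φ.nonneg_normed t), ← dist_eq_norm]
      gcongr
      · exact φ.nonneg_normed t
      · simpa using hA.dist_le_mul (x - t) (y - t)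
    · rw [integral_mul_const, φ.integral_normed, one_mul]
  · simp only [A', convolution_def, ContinuousLinearMap.lsmul_apply]
    refine (norm_integral_le_of_norm_le (g := fun t => φ.normed volume t * B)
      (φ.integrable_normed.mul_const _) (Filter.Eventually.of_forall fun t => ?_)).trans_eq ?_
    · rw [norm_smul, Real.norm_of_nonneg (φ.nonneg_normed t)]
      exact mul_le_mul_of_nonneg_left (hB _) (φ.nonneg_normed t)
    · rw [integral_mul_const, φ.integral_normed, one_mul]
  · rw [← dist_eq_norm]
    refine φ.dist_normed_convolution_le hAc.aestronglyMeasurable fun y hy => ?_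
    refine (hA.dist_le_mul y x).trans ?_
    have : dist y x ≤ ε / (K + 1) := (Metric.mem_ball.1 hy).le
    calc (K : ℝ) * dist y x ≤ (K + 1) * (ε / (K + 1)) := by gcongr; linarith
      _ = ε := by field_simp

/-- Multiplication of a test function by a smooth matrix field. -/
theorem IsTest.norm_mul_le {Ω : Set (Vec d)} {φ : Vec d → Vec d} (hφ : IsTest Ω φ)
    {A : Vec d → Vec d →L[ℝ] Vec d} (hA : ContDiff ℝ ∞ A) {B : ℝ} {K : ℝ≥0}
    (hB : ∀ x, ‖A x‖ ≤ B) (hK : LipschitzWith K A) :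
    ∃ hψ : IsTest Ω (fun x => A x (φ x)),
      ‖hψ.toH10‖ ≤ (2 * B + ‖matOfCLM d‖ * K) * ‖hφ.toH10‖ := by
  have hB0 : 0 ≤ B := (norm_nonneg _).trans (hB 0)
  have hψ : IsTest Ω (fun x => A x (φ x)) :=
    hφ.of_support (hA.clm_apply hφ.1) fun x hx => by simp [hx]
  refine ⟨hψ, ?_⟩
  have h1 : ‖fnH hψ.toH10‖ ≤ B * ‖fnH hφ.toH10‖ + 0 * ‖fnH hφ.toH10‖ := by
    refine Lp_norm_le_add _ _ _ hB0 le_rfl ?_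
    filter_upwards [hφ.coeFn_fnH, hψ.coeFn_fnH] with x h1 h2
    rw [h1, h2, zero_mul, add_zero]
    exact ((A x).le_opNorm _).trans (by gcongr; exact hB x)
  have h2 : ‖jacH hψ.toH10‖ ≤ B * ‖jacH hφ.toH10‖ + (‖matOfCLM d‖ * K) * ‖fnH hφ.toH10‖ := by
    refine Lp_norm_le_add _ _ _ hB0 (by positivity) ?_
    filter_upwards [hφ.coeFn_fnH, hφ.coeFn_jacH, hψ.coeFn_jacH] with x h1 h2 h3
    rw [h1, h2, h3, jacobian_eq, jacobian_eq,
      ((hA.differentiable (by simp) x).hasFDerivAt.clm_apply (hφ.differentiable x).hasFDerivAt).fderiv,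
      map_add]
    refine (norm_add_le _ _).trans (add_le_add ?_ ?_)
    · exact (norm_matOfCLM_comp_le _ _).trans (by gcongr; exact hB x)
    · refine ((matOfCLM d).le_opNorm _).trans ?_
      rw [mul_assoc]
      gcongr
      refine ContinuousLinearMap.opNorm_le_bound _ (by positivity) fun h => ?_
      rw [ContinuousLinearMap.flip_apply]
      refine (ContinuousLinearMap.le_opNorm _ _).trans ?_
      calc ‖fderiv ℝ A x h‖ * ‖φ x‖ ≤ (K * ‖h‖) * ‖φ x‖ := by
            gcongr
            exact ((fderiv ℝ A x).le_opNorm h).trans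
              (by gcongr; exact norm_fderiv_le_of_lipschitz ℝ hK)
        _ = K * ‖φ x‖ * ‖h‖ := by ring
  have h3 := norm_H10_le hψ.toH10
  have h4 := norm_fnH_le hφ.toH10
  have h5 := norm_jacH_le hφ.toH10
  have h6 : 0 ≤ ‖matOfCLM d‖ * K := by positivity
  nlinarith

/-- `H¹₀` is stable under multiplication by bounded Lipschitz matrix fields. -/
theorem H10.exists_mul {Ω : Set (Vec d)} {A : Vec d → Vec d →L[ℝ] Vec d} {B : ℝ} {K : ℝ≥0}
    (hB : ∀ x, ‖A x‖ ≤ B) (hK : LipschitzWith K A) (u : H10 Ω) :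
    ∃ v : H10 Ω, fnH v =ᵐ[volume.restrict Ω] fun x => A x (fnH u x) := by
  have hB0 : 0 ≤ B := (norm_nonneg _).trans (hB 0)
  obtain ⟨φ, hφ, hlim⟩ := u.exists_seq_tendsto
  -- `A` is only Lipschitz, so `A φ` need not be smooth. Mollified matrices with the same two bounds
  -- give test functions `A' n (φ n)` that are bounded in `H¹₀` and converge to `A u` in `L²`.
  choose A' h1 h2 h3 h4 using fun n : ℕ =>
    exists_smooth_approx hB hK (ε := 1 / ((n : ℝ) + 1)) (by positivity)
  choose hψ hn using fun n => (hφ n).norm_mul_le (h1 n) (h3 n) (h2 n)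
  have hmem : MemLp (fun x => A x (fnH u x)) 2 (volume.restrict Ω) := by
    refine MemLp.of_le_mul (c := B) (Lp.memLp (fnH u)) ?_ (Filter.Eventually.of_forall fun x => ?_)
    · exact Continuous.comp_aestronglyMeasurable₂
        (g := fun (A : Vec d →L[ℝ] Vec d) (v : Vec d) => A v)
        isBoundedBilinearMap_apply.continuous hK.continuous.aestronglyMeasurable
        (Lp.aestronglyMeasurable (fnH u))
    · exact ((A x).le_opNorm _).trans (by gcongr; exact hB x)
  have hg : Tendsto (fun n => fnH (hψ n).toH10) atTop (𝓝 (hmem.toLp _)) := by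
    rw [tendsto_iff_norm_sub_tendsto_zero]
    have hlim0 : Tendsto (fun n => ‖fnH (hφ n).toH10 - fnH u‖) atTop (𝓝 0) :=
      tendsto_iff_norm_sub_tendsto_zero.1 (((fnHL Ω).continuous.tendsto u).comp hlim)
    refine squeeze_zero (fun n => norm_nonneg _) (g := fun n : ℕ =>
      B * ‖fnH (hφ n).toH10 - fnH u‖ + (1 / ((n : ℝ) + 1)) * ‖fnH u‖) (fun n => ?_) ?_
    · refine Lp_norm_le_add _ _ _ hB0 (by positivity) ?_
      filter_upwards [Lp.coeFn_sub (fnH (hψ n).toH10) (hmem.toLp _), (hψ n).coeFn_fnH,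
        Lp.coeFn_sub (fnH (hφ n).toH10) (fnH u), (hφ n).coeFn_fnH, hmem.coeFn_toLp]
        with x e1 e2 e3 e4 e5
      rw [e1, e3, Pi.sub_apply, Pi.sub_apply, e2, e4, e5]
      have : A' n x (φ n x) - A x (fnH u x) =
          A' n x (φ n x - fnH u x) + (A' n x - A x) (fnH u x) := by simp
      rw [this]
      refine (norm_add_le _ _).trans (add_le_add ?_ ?_)
      · exact ((A' n x).le_opNorm _).trans (by gcongr; exact h3 n x)
      · exact ((A' n x - A x).le_opNorm _).trans (by gcongr; exact h4 n x)
    · simpa using (hlim0.const_mul B).add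
        (tendsto_one_div_add_atTop_nhds_zero_nat.mul_const ‖fnH u‖)
  obtain ⟨v, hv, -⟩ := H10.exists_weak_limit hn (hlim.norm.const_mul _) hg
  exact ⟨v, by rw [hv]; exact hmem.coeFn_toLp⟩

/-! ### Extension by zero -/

section Extension

variable {F : Type*} [NormedAddCommGroup F] [NormedSpace ℝ F]

omit [NormedSpace ℝ F] in
theorem indicator_ae_eq_univ {Ω : Set (Vec d)} (hΩ : MeasurableSet Ω) {f g : Vec d → F}
    (h : f =ᵐ[volume.restrict Ω] g) :
    Ω.indicator f =ᵐ[volume.restrict univ] Ω.indicator g := by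
  rw [Measure.restrict_univ]
  filter_upwards [(ae_restrict_iff' hΩ).1 h] with x hx
  by_cases hxΩ : x ∈ Ω
  · rw [indicator_of_mem hxΩ, indicator_of_mem hxΩ, hx hxΩ]
  · rw [indicator_of_notMem hxΩ, indicator_of_notMem hxΩ]

omit [NormedSpace ℝ F] in
theorem memLp_indicator_coeFn {Ω : Set (Vec d)} (hΩ : MeasurableSet Ω)
    (u : Lp F 2 (volume.restrict Ω)) : MemLp (Ω.indicator u) 2 (volume.restrict univ) := by
  rw [Measure.restrict_univ, memLp_indicator_iff_restrict hΩ]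
  exact Lp.memLp u

/-- Extension by zero of square integrable functions. -/
noncomputable def extLp {Ω : Set (Vec d)} (hΩ : MeasurableSet Ω) :
    Lp F 2 (volume.restrict Ω) →ₗᵢ[ℝ] Lp F 2 (volume.restrict (univ : Set (Vec d))) where
  toFun u := (memLp_indicator_coeFn hΩ u).toLp _
  map_add' u v := by
    rw [← MemLp.toLp_add]
    refine MemLp.toLp_congr _ _ ((indicator_ae_eq_univ hΩ (Lp.coeFn_add u v)).trans ?_)
    rw [indicator_add']
  map_smul' c u := by
    rw [RingHom.id_apply, ← MemLp.toLp_const_smul]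
    refine MemLp.toLp_congr _ _ ((indicator_ae_eq_univ hΩ (Lp.coeFn_smul c u)).trans ?_)
    exact Filter.EventuallyEq.of_eq (indicator_const_smul Ω c u)
  norm_map' u := by
    change ‖(memLp_indicator_coeFn hΩ u).toLp _‖ = _
    rw [Lp.norm_toLp, Lp.norm_def, Measure.restrict_univ, eLpNorm_indicator_eq_eLpNorm_restrict hΩ]

theorem coeFn_extLp {Ω : Set (Vec d)} (hΩ : MeasurableSet Ω) (u : Lp F 2 (volume.restrict Ω)) :
    extLp hΩ u =ᵐ[volume.restrict univ] Ω.indicator u :=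
  (memLp_indicator_coeFn hΩ u).coeFn_toLp

end Extension

theorem IsTest.indicator_eq {Ω : Set (Vec d)} {φ : Vec d → Vec d} (hφ : IsTest Ω φ) :
    Ω.indicator φ = φ :=
  indicator_eq_self.2 fun x hx => by
    by_contra h
    exact hx (hφ.eq_zero h)

theorem IsTest.indicator_jacobian {Ω : Set (Vec d)} {φ : Vec d → Vec d} (hφ : IsTest Ω φ) :
    Ω.indicator (jacobian φ) = jacobian φ :=
  indicator_eq_self.2 fun x hx => by
    by_contra h
    exact hx (by rw [jacobian_eq, hφ.fderiv_eq_zero h, map_zero])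

/-- Extension by zero is isometric on functions and Jacobians and maps test functions to test
functions; since `H¹₀` is closed, this passes to limits and no trace theory is needed. -/
theorem H10.exists_ext {Ω : Set (Vec d)} (hΩ : MeasurableSet Ω) (u : H10 Ω) :
    ∃ U : H10 (univ : Set (Vec d)), fnH U = extLp hΩ (fnH u) ∧ jacH U = extLp hΩ (jacH u) := by
  let Z : H10 Ω → L2Pair (univ : Set (Vec d)) := fun u =>
    WithLp.toLp 2 (extLp hΩ (fnH u), extLp hΩ (jacH u))
  have hZ : Continuous Z := (WithLp.prodContinuousLinearEquiv 2 ℝ _ _).symm.continuous.comp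
    (((extLp hΩ).continuous.comp (fnHL Ω).continuous).prodMk
      ((extLp hΩ).continuous.comp (jacHL Ω).continuous))
  have hcl : IsClosed {z : L2Pair (univ : Set (Vec d)) | z ∈ H10Sub (univ : Set (Vec d))} :=
    Submodule.isClosed_topologicalClosure _
  have : Z u ∈ H10Sub (univ : Set (Vec d)) := by
    refine H10.induction_closed (P := fun u => Z u ∈ H10Sub (univ : Set (Vec d)))
      (hcl.preimage hZ) (fun φ hφ => ?_) u
    have hφ' := hφ.mono (subset_univ Ω)
    have e1 : extLp hΩ (fnH hφ.toH10) = fnH hφ'.toH10 := by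
      refine Lp.ext ((coeFn_extLp hΩ _).trans
        ((indicator_ae_eq_univ hΩ hφ.coeFn_fnH).trans ?_))
      rw [hφ.indicator_eq]
      exact hφ'.coeFn_fnH.symm
    have e2 : extLp hΩ (jacH hφ.toH10) = jacH hφ'.toH10 := by
      refine Lp.ext ((coeFn_extLp hΩ _).trans
        ((indicator_ae_eq_univ hΩ hφ.coeFn_jacH).trans ?_))
      rw [hφ.indicator_jacobian]
      exact hφ'.coeFn_jacH.symm
    have : Z hφ.toH10 = Subtype.val hφ'.toH10 := by
      change WithLp.toLp 2 (_, _) = _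
      rw [e1, e2]
      rfl
    change Z hφ.toH10 ∈ _
    rw [this]
    exact Subtype.property hφ'.toH10
  exact ⟨⟨Z u, this⟩, rfl, rfl⟩

/-- Extension by zero of `H¹₀` fields. -/
noncomputable def extH {Ω : Set (Vec d)} (hΩ : MeasurableSet Ω) (u : H10 Ω) :
    H10 (univ : Set (Vec d)) :=
  (H10.exists_ext hΩ u).choose

theorem fnH_extH {Ω : Set (Vec d)} (hΩ : MeasurableSet Ω) (u : H10 Ω) :
    fnH (extH hΩ u) = extLp hΩ (fnH u) :=
  (H10.exists_ext hΩ u).choose_spec.1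

theorem jacH_extH {Ω : Set (Vec d)} (hΩ : MeasurableSet Ω) (u : H10 Ω) :
    jacH (extH hΩ u) = extLp hΩ (jacH u) :=
  (H10.exists_ext hΩ u).choose_spec.2

theorem inner_extH {Ω : Set (Vec d)} (hΩ : MeasurableSet Ω) (u v : H10 Ω) :
    ⟪extH hΩ u, extH hΩ v⟫ = ⟪u, v⟫ := by
  rw [inner_H10, inner_H10, fnH_extH, fnH_extH, jacH_extH, jacH_extH,
    LinearIsometry.inner_map_map, LinearIsometry.inner_map_map]

end MovingStokes

namespace MovingStokes

open scoped NNReal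
open Filter (Tendsto atTop)

variable {d : ℕ}

/-! ### Smooth truncation -/

/-- A smooth 1-Lipschitz truncation, tending to the identity as `ε → 0`. -/
noncomputable def trunc (ε : ℝ) (v : Vec d) : Vec d := (Real.sqrt (1 + ε * ‖v‖ ^ 2))⁻¹ • v

theorem trunc_zero (ε : ℝ) : trunc ε (0 : Vec d) = 0 := by simp [trunc]

theorem contDiff_trunc {ε : ℝ} (hε : 0 ≤ ε) : ContDiff ℝ ∞ (trunc ε : Vec d → Vec d) := by
  have h1 : ContDiff ℝ ∞ fun v : Vec d => 1 + ε * ‖v‖ ^ 2 :=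
    contDiff_const.add (contDiff_const.mul (contDiff_norm_sq ℝ))
  have h2 : ∀ v : Vec d, 1 + ε * ‖v‖ ^ 2 ≠ 0 := fun v => by positivity
  exact ((h1.sqrt h2).inv fun v => by positivity).smul contDiff_id

/-- With `s = √(1 + ε|v|²)` the derivative is `h ↦ s⁻¹ h - s⁻³ ε ⟪v, h⟫ v`. It is bounded by `s⁻¹ ≤
1`: the second term only shrinks the radial component further, because `ε|v|² ≤ s²`. -/
theorem lipschitz_trunc {ε : ℝ} (hε : 0 ≤ ε) : LipschitzWith 1 (trunc ε : Vec d → Vec d) := by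
  refine lipschitzWith_of_nnnorm_fderiv_le ((contDiff_trunc hε).differentiable (by simp))
    fun v => ?_
  change ‖fderiv ℝ (trunc ε) v‖ ≤ 1
  set s : ℝ := Real.sqrt (1 + ε * ‖v‖ ^ 2) with hs
  have hpos : 0 < 1 + ε * ‖v‖ ^ 2 := by positivity
  have hs0 : 0 < s := Real.sqrt_pos.2 hpos
  have hs2 : s ^ 2 = 1 + ε * ‖v‖ ^ 2 := Real.sq_sqrt hpos.le
  have h1 : HasFDerivAt (fun v : Vec d => 1 + ε * ‖v‖ ^ 2) (ε • (2 • innerSL ℝ v)) v :=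
    ((hasStrictFDerivAt_norm_sq v).hasFDerivAt.const_mul ε).const_add 1
  have h2 := ((hasDerivAt_inv hs0.ne').comp_hasFDerivAt v (h1.sqrt hpos.ne')).smul (hasFDerivAt_id v)
  have h3 := h2.fderiv
  change fderiv ℝ (trunc ε) v = _ at h3
  rw [h3]
  refine ContinuousLinearMap.opNorm_le_bound _ zero_le_one fun h => ?_
  have h4 : ∀ h : Vec d, ((s⁻¹ • ContinuousLinearMap.id ℝ (Vec d)) h +
      (-(s ^ 2)⁻¹ * (1 / (2 * s) * (ε * (2 * ⟪v, h⟫)))) • v) = s⁻¹ • h - (s⁻¹ ^ 3 * ε * ⟪v, h⟫) • v := by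
    intro h
    rw [sub_eq_add_neg, ← neg_smul]
    congr 2
    field_simp
  have h5 : ‖s⁻¹ • h - (s⁻¹ ^ 3 * ε * ⟪v, h⟫) • v‖ ≤ ‖h‖ := by
    refine le_of_sq_le_sq ?_ (norm_nonneg _)
    rw [norm_sub_sq_real, norm_smul, norm_smul, inner_smul_left, inner_smul_right, mul_pow, mul_pow,
      Real.norm_eq_abs, Real.norm_eq_abs, sq_abs, sq_abs, conj_trivial, real_inner_comm v h]
    have hsi : s⁻¹ ≤ 1 := inv_le_one_of_one_le₀ (by nlinarith [mul_nonneg hε (sq_nonneg ‖v‖)])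
    have hsi0 : 0 < s⁻¹ := inv_pos.2 hs0
    have e : s⁻¹ ^ 2 * (ε * ‖v‖ ^ 2) ≤ 1 := by
      rw [inv_pow, inv_mul_le_iff₀ (by positivity), hs2]; linarith
    have e1 : (s⁻¹ ^ 3 * ε * ⟪v, h⟫) ^ 2 * ‖v‖ ^ 2 ≤ s⁻¹ ^ 4 * ε * ⟪v, h⟫ ^ 2 := by
      have : (s⁻¹ ^ 3 * ε * ⟪v, h⟫) ^ 2 * ‖v‖ ^ 2 =
        (s⁻¹ ^ 2 * (ε * ‖v‖ ^ 2)) * (s⁻¹ ^ 4 * ε * ⟪v, h⟫ ^ 2) := by ring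
      rw [this]
      exact mul_le_of_le_one_left (by positivity) e
    have e2 : s⁻¹ ^ 2 * ‖h‖ ^ 2 ≤ ‖h‖ ^ 2 :=
      mul_le_of_le_one_left (sq_nonneg _) (pow_le_one₀ hsi0.le hsi)
    have e3 : 0 ≤ s⁻¹ ^ 4 * ε * ⟪v, h⟫ ^ 2 := by positivity
    nlinarith
  rw [one_mul]
  refine le_of_eq_of_le (congrArg norm ?_) h5
  rw [← h4 h]
  simp [hs]

theorem norm_trunc_le (ε : ℝ) (hε : 0 ≤ ε) (v : Vec d) : ‖trunc ε v‖ ≤ ‖v‖ := by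
  simpa [trunc_zero] using (lipschitz_trunc hε).dist_le_mul v 0

theorem norm_trunc_le_inv {ε : ℝ} (hε : 0 < ε) (v : Vec d) : ‖trunc ε v‖ ≤ (Real.sqrt ε)⁻¹ := by
  have h1 : Real.sqrt ε * ‖v‖ ≤ Real.sqrt (1 + ε * ‖v‖ ^ 2) := by
    refine Real.le_sqrt_of_sq_le ?_
    rw [mul_pow, Real.sq_sqrt hε.le]; linarith
  have h2 : 0 < Real.sqrt ε := Real.sqrt_pos.2 hε
  have h3 : 0 < Real.sqrt (1 + ε * ‖v‖ ^ 2) := Real.sqrt_pos.2 (by positivity)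
  rw [trunc, norm_smul, norm_inv, Real.norm_of_nonneg h3.le, inv_mul_le_iff₀ h3,
    ← div_eq_mul_inv, le_div_iff₀ h2]
  linarith

theorem tendsto_trunc (v : Vec d) : Tendsto (fun n : ℕ => trunc (1 / ((n : ℝ) + 1)) v) atTop (𝓝 v) := by
  have h0 : ContinuousAt (fun ε : ℝ => (Real.sqrt (1 + ε * ‖v‖ ^ 2))⁻¹) 0 :=
    ContinuousAt.inv₀ (by fun_prop) (by simp)
  have h1 : ContinuousAt (fun ε : ℝ => (Real.sqrt (1 + ε * ‖v‖ ^ 2))⁻¹ • v) 0 :=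
    h0.smul continuousAt_const
  have h2 := h1.tendsto.comp (tendsto_one_div_add_atTop_nhds_zero_nat (𝕜 := ℝ))
  simpa [trunc, Function.comp_def] using h2

/-- Truncation of square integrable fields. -/
noncomputable def truncLp {Ω : Set (Vec d)} {ε : ℝ} (hε : 0 ≤ ε) (v : L2 Ω) : L2 Ω :=
  (lipschitz_trunc hε).compLp (trunc_zero ε) v

theorem coeFn_truncLp {Ω : Set (Vec d)} {ε : ℝ} (hε : 0 ≤ ε) (v : L2 Ω) :
    truncLp hε v =ᵐ[volume.restrict Ω] fun x => trunc ε (v x) :=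
  (lipschitz_trunc hε).coeFn_compLp (trunc_zero ε) v

theorem Lp_norm_sq {α F : Type*} [MeasurableSpace α] {μ : Measure α}
    [NormedAddCommGroup F] [InnerProductSpace ℝ F] (f : Lp F 2 μ) :
    ‖f‖ ^ 2 = ∫ x, ‖f x‖ ^ 2 ∂μ := by
  rw [← real_inner_self_eq_norm_sq, L2.inner_def]
  simp only [real_inner_self_eq_norm_sq]

theorem integrable_norm_sq {α F : Type*} [MeasurableSpace α] {μ : Measure α}
    [NormedAddCommGroup F] (f : Lp F 2 μ) : Integrable (fun x => ‖f x‖ ^ 2) μ :=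
  (memLp_two_iff_integrable_sq_norm (Lp.aestronglyMeasurable f)).1 (Lp.memLp f)

theorem tendsto_truncLp {Ω : Set (Vec d)} (v : L2 Ω) :
    Tendsto (fun n : ℕ => truncLp (ε := 1 / ((n : ℝ) + 1)) (by positivity) v) atTop (𝓝 v) := by
  rw [tendsto_iff_norm_sub_tendsto_zero]
  have h : Tendsto (fun n : ℕ => ‖truncLp (ε := 1 / ((n : ℝ) + 1)) (by positivity) v - v‖ ^ 2)
      atTop (𝓝 0) := by
    simp only [Lp_norm_sq]
    suffices h' : Tendsto (fun n : ℕ => ∫ x in Ω,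
        ‖(truncLp (ε := 1 / ((n : ℝ) + 1)) (by positivity) v - v : L2 Ω) x‖ ^ 2) atTop
        (𝓝 (∫ _ in Ω, (0 : ℝ))) by simpa using h'
    refine tendsto_integral_of_dominated_convergence (fun x => 4 * ‖v x‖ ^ 2)
      (fun n => (integrable_norm_sq _).aestronglyMeasurable)
      ((integrable_norm_sq v).const_mul 4) (fun n => ?_) ?_
    · filter_upwards [coeFn_truncLp (ε := 1 / ((n : ℝ) + 1)) (by positivity) v,
        Lp.coeFn_sub (truncLp (ε := 1 / ((n : ℝ) + 1)) (by positivity) v) v] with x h1 h2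
      rw [h2, Pi.sub_apply, h1, Real.norm_of_nonneg (by positivity)]
      have h3 := norm_sub_le (trunc (1 / ((n : ℝ) + 1)) (v x)) (v x)
      have h4 := norm_trunc_le (1 / ((n : ℝ) + 1)) (by positivity) (v x)
      nlinarith [norm_nonneg (v x), norm_nonneg (trunc (1 / ((n : ℝ) + 1)) (v x) - v x)]
    · have h1 : ∀ᵐ x ∂volume.restrict Ω, ∀ n : ℕ,
          (truncLp (ε := 1 / ((n : ℝ) + 1)) (by positivity) v - v : L2 Ω) x =
            trunc (1 / ((n : ℝ) + 1)) (v x) - v x := by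
        refine ae_all_iff.2 fun n => ?_
        filter_upwards [coeFn_truncLp (ε := 1 / ((n : ℝ) + 1)) (by positivity) v,
          Lp.coeFn_sub (truncLp (ε := 1 / ((n : ℝ) + 1)) (by positivity) v) v] with x h1 h2
        rw [h2, Pi.sub_apply, h1]
      filter_upwards [h1] with x hx
      simp only [hx]
      have := (((tendsto_trunc (v x)).sub_const (v x)).norm).pow 2
      simpa using this
  have := h.sqrt
  simpa [Real.sqrt_sq] using this

/-! ### Functionals represented by integrable fields -/

section Represents

variable {Ω : Set (Vec d)} {f : Vec d → Vec d}

theorem Represents.apply_toH10 {ℓ : StrongDual ℝ (H10 Ω)} (h : Represents Ω f ℓ)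
    {φ : Vec d → Vec d} (hφ : IsTest Ω φ) : ℓ hφ.toH10 = ∫ x in Ω, ⟪f x, φ x⟫ :=
  h φ hφ _ hφ.coeFn_fnH

theorem Represents.of_toH10 {ℓ : StrongDual ℝ (H10 Ω)}
    (h : ∀ φ (hφ : IsTest Ω φ), ℓ hφ.toH10 = ∫ x in Ω, ⟪f x, φ x⟫) : Represents Ω f ℓ := by
  intro φ hφ g hg
  rw [← h φ hφ]
  congr 1
  exact fnH_injective Ω (Lp.ext (hg.trans hφ.coeFn_fnH.symm))

theorem Represents.unique {ℓ ℓ' : StrongDual ℝ (H10 Ω)} (h : Represents Ω f ℓ)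
    (h' : Represents Ω f ℓ') : ℓ = ℓ' := by
  ext u
  exact H10.induction_closed (P := fun u => ℓ u = ℓ' u) (isClosed_eq ℓ.continuous ℓ'.continuous)
    (fun φ hφ => by rw [h.apply_toH10 hφ, h'.apply_toH10 hφ]) u

/-- Density of test functions makes the representing functional unique, so the choice made in
`pairing` is immaterial. -/
theorem Represents.pairing_eq {ℓ : StrongDual ℝ (H10 Ω)} (h : Represents Ω f ℓ) (v : H10 Ω) :
    pairing Ω f v = ℓ v := by
  have he : ∃ ℓ : StrongDual ℝ (H10 Ω), Represents Ω f ℓ := ⟨ℓ, h⟩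
  rw [pairing, dif_pos he, he.choose_spec.unique h]

theorem IsTest.integrable_inner {φ : Vec d → Vec d} (hφ : IsTest Ω φ)
    (hf : Integrable f (volume.restrict Ω)) :
    Integrable (fun x => ⟪f x, φ x⟫) (volume.restrict Ω) := by
  obtain ⟨C, hC⟩ := hφ.2.1.exists_bound_of_continuous hφ.1.continuous
  refine Integrable.mono' (hf.norm.mul_const C)
    (hf.aestronglyMeasurable.inner hφ.1.continuous.aestronglyMeasurable)
    (Filter.Eventually.of_forall fun x => ?_)
  exact (norm_inner_le_norm _ _).trans (by gcongr; exact hC x)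

/-- A field in `L¹` whose action on test functions is bounded is in `H⁻¹`. -/
theorem exists_represents (hf : Integrable f (volume.restrict Ω)) {κ : ℝ} (hκ0 : 0 ≤ κ)
    (hκ : ∀ φ (hφ : IsTest Ω φ), |∫ x in Ω, ⟪f x, φ x⟫| ≤ κ * ‖hφ.toH10‖) :
    ∃ ℓ : StrongDual ℝ (H10 Ω), Represents Ω f ℓ ∧ ‖ℓ‖ ≤ κ := by
  have key : ∀ v ∈ testSub Ω, Integrable (fun x => ⟪f x, fnH v x⟫) (volume.restrict Ω) ∧
      |∫ x in Ω, ⟪f x, fnH v x⟫| ≤ κ * ‖v‖ := by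
    rintro _ ⟨φ, hφ, rfl⟩
    have e : (fun x => ⟪f x, fnH hφ.toH10 x⟫) =ᵐ[volume.restrict Ω] fun x => ⟪f x, φ x⟫ := by
      filter_upwards [hφ.coeFn_fnH] with x hx
      rw [hx]
    exact ⟨(hφ.integrable_inner hf).congr e.symm, by rw [integral_congr_ae e]; exact hκ φ hφ⟩
  -- The functional is written through `fnH v`, not through a chosen test function, so it is well
  -- defined without further argument. Hahn–Banach then extends it with the same bound.
  let L : testSub Ω →ₗ[ℝ] ℝ :=
    { toFun := fun v => ∫ x in Ω, ⟪f x, fnH (v : H10 Ω) x⟫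
      map_add' := fun u v => by
        rw [← integral_add (key u u.2).1 (key v v.2).1]
        refine integral_congr_ae ?_
        filter_upwards [Lp.coeFn_add (fnH (u : H10 Ω)) (fnH (v : H10 Ω))] with x hx
        rw [Submodule.coe_add, fnH_add, hx, Pi.add_apply, inner_add_right]
      map_smul' := fun c u => by
        rw [RingHom.id_apply, smul_eq_mul, ← integral_const_mul]
        refine integral_congr_ae ?_
        filter_upwards [Lp.coeFn_smul c (fnH (u : H10 Ω))] with x hx
        rw [Submodule.coe_smul, fnH_smul, hx, Pi.smul_apply, real_inner_smul_right] }
  obtain ⟨ℓ, h1, h2⟩ := exists_extension_norm_eq (testSub Ω)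
    (L.mkContinuous κ fun v => (key v v.2).2)
  refine ⟨ℓ, Represents.of_toH10 fun φ hφ => ?_, h2.trans_le (L.mkContinuous_norm_le hκ0 _)⟩
  have := h1 ⟨hφ.toH10, φ, hφ, rfl⟩
  refine this.trans (integral_congr_ae ?_)
  filter_upwards [hφ.coeFn_fnH] with x hx
  rw [hx]

theorem tendsto_integral_inner_of_bounded (hf : Integrable f (volume.restrict Ω))
    {τ : Vec d → Vec d} (hτ : Continuous τ) {C : ℝ} (hC : ∀ v, ‖τ v‖ ≤ C) {u : ℕ → Vec d → Vec d}
    {v : Vec d → Vec d} (hu : ∀ n, AEStronglyMeasurable (u n) (volume.restrict Ω))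
    (h : ∀ᵐ x ∂volume.restrict Ω, Tendsto (fun n => u n x) atTop (𝓝 (v x))) :
    Tendsto (fun n => ∫ x in Ω, ⟪f x, τ (u n x)⟫) atTop (𝓝 (∫ x in Ω, ⟪f x, τ (v x)⟫)) := by
  refine tendsto_integral_of_dominated_convergence (fun x => ‖f x‖ * C)
    (fun n => hf.aestronglyMeasurable.inner (hτ.comp_aestronglyMeasurable (hu n)))
    (hf.norm.mul_const C) (fun n => Filter.Eventually.of_forall fun x =>
      (norm_inner_le_norm _ _).trans (by gcongr; exact hC _)) ?_
  filter_upwards [h] with x hx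
  exact tendsto_const_nhds.inner ((hτ.tendsto _).comp hx)

theorem exists_subseq_ae {α F : Type*} [MeasurableSpace α] {μ : Measure α}
    [NormedAddCommGroup F] {u : ℕ → Lp F 2 μ} {v : Lp F 2 μ} (h : Tendsto u atTop (𝓝 v)) :
    ∃ ns : ℕ → ℕ, StrictMono ns ∧ ∀ᵐ x ∂μ, Tendsto (fun n => u (ns n) x) atTop (𝓝 (v x)) :=
  (tendstoInMeasure_of_tendsto_Lp h).exists_seq_tendsto_ae

/-- The pairing is the limit of the integrals against truncations. -/
theorem Represents.tendsto_trunc {ℓ : StrongDual ℝ (H10 Ω)} (h : Represents Ω f ℓ)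
    (hf : Integrable f (volume.restrict Ω)) (v : H10 Ω) :
    Tendsto (fun n : ℕ => ∫ x in Ω, ⟪f x, trunc (1 / ((n : ℝ) + 1)) (fnH v x)⟫) atTop
      (𝓝 (ℓ v)) := by
  obtain ⟨φ, hφ, hlim⟩ := v.exists_seq_tendsto
  have hε : ∀ n : ℕ, (0 : ℝ) < 1 / ((n : ℝ) + 1) := fun n => by positivity
  choose hψ w hw1 hw2 hw3 using fun n : ℕ => H10.exists_comp (contDiff_trunc (hε n).le)
    (trunc_zero _) (lipschitz_trunc (hε n).le) v hφ hlim
  -- For fixed `n` the truncation is bounded, so integrability of `f` allows dominated convergence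
  -- along an almost everywhere convergent subsequence of test functions.
  have e : ∀ n, ℓ (w n) = ∫ x in Ω, ⟪f x, trunc (1 / ((n : ℝ) + 1)) (fnH v x)⟫ := by
    intro n
    obtain ⟨ns, hns, hae⟩ := exists_subseq_ae (((fnHL Ω).continuous.tendsto v).comp hlim)
    refine tendsto_nhds_unique ((hw3 n ℓ).comp hns.tendsto_atTop) ?_
    refine (tendsto_integral_inner_of_bounded hf (contDiff_trunc (hε n).le).continuous
      (norm_trunc_le_inv (hε n)) (u := fun k => φ (ns k))
      (fun k => (hφ _).1.continuous.aestronglyMeasurable) ?_).congr fun k => ?_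
    · have : ∀ᵐ x ∂volume.restrict Ω, ∀ k, fnH (hφ k).toH10 x = φ k x :=
        ae_all_iff.2 fun k => (hφ k).coeFn_fnH
      filter_upwards [hae, this] with x hx1 hx2
      exact hx1.congr fun k => hx2 _
    · exact (h.apply_toH10 (hψ n (ns k))).symm
  simp only [← e]
  -- The truncations `w n` are bounded in `H¹₀` by `2 ‖v‖` and converge to `v` in `L²`, hence weakly
  -- in `H¹₀`; apply `ℓ`.
  obtain ⟨v', h1, -, h3⟩ := H10.exists_weak_limit hw2 tendsto_const_nhds (g := fnH v) (by
    simp only [hw1]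
    exact tendsto_truncLp (fnH v))
  rw [← fnH_injective Ω h1]
  exact h3 ℓ

/-- Truncation multiplies the vector `v x` by a scalar in `[0, 1]`, so the truncated integrands are
dominated by the full one, even though `f` and `v` separately might not be. -/
theorem Represents.apply_eq_integral {ℓ : StrongDual ℝ (H10 Ω)} (h : Represents Ω f ℓ)
    (hf : Integrable f (volume.restrict Ω)) (v : H10 Ω)
    (hfv : Integrable (fun x => ⟪f x, fnH v x⟫) (volume.restrict Ω)) :
    ℓ v = ∫ x in Ω, ⟪f x, fnH v x⟫ := by
  refine tendsto_nhds_unique (h.tendsto_trunc hf v) ?_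
  refine tendsto_integral_of_dominated_convergence (fun x => ‖⟪f x, fnH v x⟫‖)
    (fun n => hf.aestronglyMeasurable.inner ((contDiff_trunc (by positivity)).continuous
      |>.comp_aestronglyMeasurable (Lp.aestronglyMeasurable _))) hfv.norm
    (fun n => Filter.Eventually.of_forall fun x => ?_)
    (Filter.Eventually.of_forall fun x =>
      tendsto_const_nhds.inner (MovingStokes.tendsto_trunc (fnH v x)))
  rw [trunc, real_inner_smul_right, norm_mul]
  refine mul_le_of_le_one_left (norm_nonneg _) ?_
  rw [norm_inv, Real.norm_of_nonneg (Real.sqrt_nonneg _)]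
  refine inv_le_one_of_one_le₀ (Real.one_le_sqrt.2 ?_)
  have : 0 ≤ 1 / ((n : ℝ) + 1) * ‖fnH v x‖ ^ 2 := by positivity
  linarith

end Represents

end MovingStokes

namespace MovingStokes

open scoped NNReal
open Filter (Tendsto atTop)

variable {d : ℕ}

/-! ### The convective term -/

/-- The product of a matrix and a vector. -/
noncomputable def matVec (A : Mat d) (v : Vec d) : Vec d :=
  WithLp.toLp 2 fun i => ∑ j, v j * A (i, j)

theorem matVec_apply (A : Mat d) (v : Vec d) (i : Fin d) : matVec A v i = ∑ j, v j * A (i, j) :=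
  rfl

/-- The matrix `v ⊗ w`. -/
noncomputable def outer (v w : Vec d) : Mat d := WithLp.toLp 2 fun ij => w ij.2 * v ij.1

/-- Moving both vectors to one side exhibits the convective integrand as the Jacobian paired with a
fixed matrix field, so that square integrability of the latter is the only question. -/
theorem inner_matVec (A : Mat d) (v w : Vec d) : ⟪matVec A v, w⟫ = ⟪A, outer w v⟫ := by
  simp only [PiLp.inner_apply, RCLike.inner_apply, conj_trivial, matVec_apply, outer,
    Fintype.sum_prod_type, Finset.mul_sum]
  refine Finset.sum_congr rfl fun i _ => Finset.sum_congr rfl fun j _ => by ring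

theorem norm_outer (v w : Vec d) : ‖outer v w‖ = ‖w‖ * ‖v‖ := by
  rw [← sq_eq_sq₀ (norm_nonneg _) (by positivity), mul_pow, EuclideanSpace.norm_sq_eq,
    EuclideanSpace.norm_sq_eq, EuclideanSpace.norm_sq_eq, Fintype.sum_prod_type,
    Finset.sum_mul_sum, Finset.sum_comm]
  simp [outer, mul_pow]

theorem norm_matVec_le (A : Mat d) (v : Vec d) : ‖matVec A v‖ ≤ ‖A‖ * ‖v‖ := by
  rcases eq_or_lt_of_le (norm_nonneg (matVec A v)) with h | h
  · rw [← h]; positivity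
  have h1 : ‖matVec A v‖ * ‖matVec A v‖ ≤ ‖A‖ * ‖v‖ * ‖matVec A v‖ := by
    rw [← real_inner_self_eq_norm_mul_norm, inner_matVec, mul_assoc, ← norm_outer]
    exact real_inner_le_norm _ _
  exact le_of_mul_le_mul_right h1 h

theorem continuous_matVec : Continuous fun q : Mat d × Vec d => matVec q.1 q.2 := by
  unfold matVec
  fun_prop

theorem continuous_outer : Continuous fun q : Vec d × Vec d => outer q.1 q.2 := by
  unfold outer
  fun_prop

theorem matVec_add_left (A B : Mat d) (v : Vec d) : matVec (A + B) v = matVec A v + matVec B v := by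
  ext i
  simp [matVec_apply, mul_add, Finset.sum_add_distrib]

theorem matVec_smul_left (c : ℝ) (A : Mat d) (v : Vec d) : matVec (c • A) v = c • matVec A v := by
  ext i
  simp only [matVec_apply, PiLp.smul_apply, smul_eq_mul, Finset.mul_sum]
  exact Finset.sum_congr rfl fun j _ => by ring

theorem matVec_matOfCLM (A : Vec d →L[ℝ] Vec d) (v : Vec d) : matVec (matOfCLM d A) v = A v := by
  ext i
  conv_rhs => rw [← (EuclideanSpace.basisFun (Fin d) ℝ).sum_repr v]
  simp [matVec_apply, matOfCLM]

section

variable {Ω : Set (Vec d)} {b : Vec d → Vec d}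

theorem integrable_matVec {μ : Measure (Vec d)} (hb : MemLp b 2 μ) {J : Vec d → Mat d}
    (hJ : MemLp J 2 μ) : Integrable (fun x => matVec (J x) (b x)) μ := by
  refine (hJ.norm.integrable_mul hb.norm).mono'
    (continuous_matVec.comp_aestronglyMeasurable (hJ.1.prodMk hb.1))
    (Filter.Eventually.of_forall fun x => norm_matVec_le _ _)

theorem memLp_outer {μ : Measure (Vec d)} (hb : MemLp b 2 μ) {φ : Vec d → Vec d}
    (hφ : AEStronglyMeasurable φ μ) {C : ℝ} (hC : ∀ x, ‖φ x‖ ≤ C) :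
    MemLp (fun x => outer (φ x) (b x)) 2 μ := by
  refine hb.of_le_mul (c := C) (continuous_outer.comp_aestronglyMeasurable (hφ.prodMk hb.1))
    (Filter.Eventually.of_forall fun x => ?_)
  rw [norm_outer, mul_comm]
  gcongr
  exact hC x

variable (Ω b) in
/-- The trilinear convective form with advecting field `b` is bounded on test functions. -/
structure IsAdvecting (κ : ℝ) : Prop where
  memLp : MemLp b 2 (volume.restrict Ω)
  nonneg : 0 ≤ κ
  bound : ∀ ψ φ (hψ : IsTest Ω ψ) (hφ : IsTest Ω φ),
    |∫ x in Ω, ⟪matVec (jacobian ψ x) (b x), φ x⟫| ≤ κ * ‖hψ.toH10‖ * ‖hφ.toH10‖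

namespace IsAdvecting

variable {κ : ℝ}

theorem integrable (h : IsAdvecting Ω b κ) (u : H10 Ω) :
    Integrable (fun x => matVec (jacH u x) (b x)) (volume.restrict Ω) :=
  integrable_matVec h.memLp (Lp.memLp _)

/-- For a fixed test function `φ` the field `φ ⊗ b` is square integrable, so the integral is
continuous in `u` and the bound passes from test functions to `H¹₀`. -/
theorem bound' (h : IsAdvecting Ω b κ) (u : H10 Ω) {φ : Vec d → Vec d} (hφ : IsTest Ω φ) :
    |∫ x in Ω, ⟪matVec (jacH u x) (b x), φ x⟫| ≤ κ * ‖u‖ * ‖hφ.toH10‖ := by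
  obtain ⟨C, hC⟩ := hφ.2.1.exists_bound_of_continuous hφ.1.continuous
  have hm := memLp_outer h.memLp hφ.1.continuous.aestronglyMeasurable hC
  have hc : Continuous fun u : H10 Ω => ∫ x in Ω, ⟪matVec (jacH u x) (b x), φ x⟫ := by
    simp only [inner_matVec]
    exact (continuous_integral_inner hm).comp (jacHL Ω).continuous
  refine H10.induction_closed (P := fun u => |∫ x in Ω, ⟪matVec (jacH u x) (b x), φ x⟫|
    ≤ κ * ‖u‖ * ‖hφ.toH10‖) (isClosed_le hc.abs (by fun_prop)) (fun ψ hψ => ?_) u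
  refine le_of_eq_of_le (congrArg _ (integral_congr_ae ?_)) (h.bound ψ φ hψ hφ)
  filter_upwards [hψ.coeFn_jacH] with x hx
  rw [hx]

/-- For each `u` the field `(b·∇)u` is integrable and bounded on test functions, hence represents a
functional; uniqueness of the functional makes it linear in `u`. -/
theorem exists_bilin (h : IsAdvecting Ω b κ) : ∃ B : H10 Ω →L[ℝ] H10 Ω →L[ℝ] ℝ,
    (∀ u, Represents Ω (fun x => matVec (jacH u x) (b x)) (B u)) ∧
    ∀ u v, |B u v| ≤ κ * ‖u‖ * ‖v‖ := by
  choose ℓ h1 h2 using fun u : H10 Ω => exists_represents (h.integrable u)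
    (mul_nonneg h.nonneg (norm_nonneg u)) fun φ hφ => h.bound' u hφ
  let L : H10 Ω →ₗ[ℝ] StrongDual ℝ (H10 Ω) :=
    { toFun := ℓ
      map_add' := fun u v => by
        refine (h1 (u + v)).unique (Represents.of_toH10 fun φ hφ => ?_)
        rw [add_apply, (h1 u).apply_toH10 hφ, (h1 v).apply_toH10 hφ,
          ← integral_add (hφ.integrable_inner (h.integrable u))
            (hφ.integrable_inner (h.integrable v))]
        refine integral_congr_ae ?_
        filter_upwards [Lp.coeFn_add (jacH u) (jacH v)] with x hx
        rw [jacH_add, hx, Pi.add_apply, matVec_add_left, inner_add_left]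
      map_smul' := fun c u => by
        refine (h1 (c • u)).unique (Represents.of_toH10 fun φ hφ => ?_)
        rw [RingHom.id_apply, smul_apply, (h1 u).apply_toH10 hφ, smul_eq_mul,
          ← integral_const_mul]
        refine integral_congr_ae ?_
        filter_upwards [Lp.coeFn_smul c (jacH u)] with x hx
        rw [jacH_smul, hx, Pi.smul_apply, matVec_smul_left, real_inner_smul_left] }
  refine ⟨L.mkContinuous κ h2, h1, fun u v => ?_⟩
  exact ((ℓ u).le_opNorm v).trans (by gcongr; exact h2 u)

/-- The convective form of a divergence free field is antisymmetric. -/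
theorem pairing_self (h : IsAdvecting Ω b κ)
    (hdiv : ∀ φ, IsTest Ω φ → ∫ x in Ω, ⟪matVec (jacobian φ x) (b x), φ x⟫ = 0) (u : H10 Ω) :
    pairing Ω (fun x => matVec (jacH u x) (b x)) u = 0 := by
  obtain ⟨B, hB, -⟩ := h.exists_bilin
  rw [(hB u).pairing_eq]
  refine H10.induction_closed (P := fun u => B u u = 0)
    (isClosed_eq (by fun_prop) continuous_const) (fun φ hφ => ?_) u
  rw [(hB _).apply_toH10 hφ, ← hdiv φ hφ]
  refine integral_congr_ae ?_
  filter_upwards [hφ.coeFn_jacH] with x hx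
  rw [hx]

end IsAdvecting

/-- For a weakly divergence free field the convective form vanishes on the diagonal. -/
theorem WeaklyDivFree.integral_matVec (h : WeaklyDivFree Ω b) {φ : Vec d → Vec d}
    (hφ : IsTest Ω φ) : ∫ x in Ω, ⟪matVec (jacobian φ x) (b x), φ x⟫ = 0 := by
  have hd := hφ.differentiable
  -- The divergence condition is tested with `|φ|²`, since `b · ∇|φ|² = 2 ((b·∇)φ) · φ`.
  have hq : IsC1c Ω fun x => ‖φ x‖ ^ 2 := by
    refine ⟨(hφ.1.norm_sq ℝ).of_le (by simp), ?_, ?_⟩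
    · exact hφ.2.1.comp_left (g := fun v : Vec d => ‖v‖ ^ 2) (by simp)
    · exact (closure_mono fun x hx => by
        contrapose! hx
        simp [Function.notMem_support.1 hx]).trans hφ.2.2
  have h1 := h _ hq
  have h2 : ∀ x, ⟪b x, gradient (fun x => ‖φ x‖ ^ 2) x⟫ =
      2 * ⟪matVec (jacobian φ x) (b x), φ x⟫ := by
    intro x
    rw [real_inner_comm, gradient, InnerProductSpace.toDual_symm_apply,
      ((hd x).hasFDerivAt.norm_sq).fderiv, jacobian_eq, matVec_matOfCLM, real_inner_comm]
    simp
  simp only [h2, integral_const_mul] at h1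
  simpa using h1

theorem WeaklyDivFree.sub {b' : Vec d → Vec d} (h : WeaklyDivFree Ω b) (h' : WeaklyDivFree Ω b')
    (hb : LocallyIntegrable b (volume.restrict Ω)) (hb' : LocallyIntegrable b' (volume.restrict Ω)) :
    WeaklyDivFree Ω (fun x => b x - b' x) := by
  intro q hq
  have hc : Continuous (gradient q) :=
    (InnerProductSpace.toDual ℝ (Vec d)).symm.continuous.comp (hq.1.continuous_fderiv (by simp))
  have hs : HasCompactSupport (gradient q) :=
    (hq.2.1.fderiv (𝕜 := ℝ)).comp_left (map_zero _)
  have hint : ∀ {f : Vec d → Vec d}, LocallyIntegrable f (volume.restrict Ω) →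
      Integrable (fun x => ⟪f x, gradient q x⟫) (volume.restrict Ω) := by
    intro f hf
    have h1 : IntegrableOn (fun x => ⟪f x, gradient q x⟫) (tsupport (gradient q))
        (volume.restrict Ω) := by
      obtain ⟨C, hC⟩ := hs.exists_bound_of_continuous hc
      refine Integrable.mono' ((hf.integrableOn_isCompact hs).norm.mul_const C)
        ((hf.integrableOn_isCompact hs).aestronglyMeasurable.inner hc.aestronglyMeasurable)
        (Filter.Eventually.of_forall fun x =>
          (norm_inner_le_norm _ _).trans (by gcongr; exact hC x))
    refine (integrableOn_iff_integrable_of_support_subset fun x hx => ?_).1 h1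
    refine subset_tsupport _ fun h0 => hx ?_
    simp [h0]
  simp only [inner_sub_left]
  rw [integral_sub (hint hb) (hint hb'), h q hq, h' q hq, sub_zero]

end

end MovingStokes

namespace MovingStokes

open scoped NNReal
open Filter (Tendsto atTop)

variable {d : ℕ}

/-! ### Subcritical advecting fields -/

theorem norm_fderiv_le_jacobian (f : Vec d → Vec d) (x : Vec d) :
    ‖fderiv ℝ f x‖ ≤ ‖jacobian f x‖ := by
  refine ContinuousLinearMap.opNorm_le_bound _ (norm_nonneg _) fun v => ?_
  rw [← matVec_matOfCLM (fderiv ℝ f x) v]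
  exact norm_matVec_le _ _

theorem isFiniteMeasure_restrict_of_subset {Ω : Set (Vec d)} {R : ℝ}
    (hΩ : Ω ⊆ Metric.closedBall 0 R) : IsFiniteMeasure (volume.restrict Ω) :=
  ⟨by
    rw [Measure.restrict_apply_univ]
    exact (measure_mono hΩ).trans_lt measure_closedBall_lt_top⟩

theorem IsTest.eLpNorm_jacobian {Ω : Set (Vec d)} {φ : Vec d → Vec d} (hφ : IsTest Ω φ) :
    eLpNorm (jacobian φ) 2 volume = ENNReal.ofReal ‖jacH hφ.toH10‖ := by
  rw [← eLpNorm_restrict_eq_of_support_subset (s := Ω), ← eLpNorm_congr_ae hφ.coeFn_jacH,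
    Lp.norm_def, ENNReal.ofReal_toReal (Lp.eLpNorm_ne_top _)]
  intro x hx
  by_contra h
  exact hx (by rw [jacobian_eq, hφ.fderiv_eq_zero h, map_zero])

/-- A Sobolev inequality in `H¹₀`, uniform over the subdomains of a ball. -/
theorem exists_sobolev (R : ℝ) {s p : ℝ≥0} (hp : 1 ≤ p) (hp2 : p ≤ 2) (hpd : p < d)
    (hps : (p : ℝ)⁻¹ - (d : ℝ)⁻¹ ≤ (s : ℝ)⁻¹) :
    ∃ C : ℝ≥0, ∀ Ω : Set (Vec d), Ω ⊆ Metric.closedBall 0 R → ∀ v : H10 Ω,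
      eLpNorm (fnH v) s (volume.restrict Ω) ≤ C * ENNReal.ofReal ‖v‖ := by
  -- Both the Sobolev constant and the Hölder factor refer to the ball, which makes them independent
  -- of `Ω`.
  set S : Set (Vec d) := Metric.closedBall 0 R
  have hfin := isFiniteMeasure_restrict_of_subset (d := d) (R := R) subset_rfl
  set m : ℝ≥0∞ := volume.restrict S univ ^ (1 / (p : ℝ≥0∞).toReal - 1 / (2 : ℝ≥0∞).toReal)
  have hm : m ≠ ⊤ := by
    refine ENNReal.rpow_ne_top_of_nonneg ?_ (measure_ne_top _ _)
    rw [sub_nonneg]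
    have : (0 : ℝ) < p := zero_lt_one.trans_le (by exact_mod_cast hp)
    simpa using inv_anti₀ this (by exact_mod_cast hp2)
  set C₀ := eLpNormLESNormFDerivOfLeConst (Vec d) (volume : Measure (Vec d)) S p s
  refine ⟨C₀ * m.toNNReal, fun Ω hΩ v => ?_⟩
  have htest : ∀ φ (hφ : IsTest Ω φ), eLpNorm (fnH hφ.toH10) s (volume.restrict Ω) ≤
      (C₀ * m.toNNReal : ℝ≥0) * ENNReal.ofReal ‖hφ.toH10‖ := by
    intro φ hφ
    calc eLpNorm (fnH hφ.toH10) s (volume.restrict Ω)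
        = eLpNorm φ s (volume.restrict Ω) := eLpNorm_congr_ae hφ.coeFn_fnH
      _ ≤ eLpNorm φ s volume := eLpNorm_mono_measure _ Measure.restrict_le_self
      _ ≤ C₀ * eLpNorm (fderiv ℝ φ) p volume := by
          refine eLpNorm_le_eLpNorm_fderiv_of_le volume (hφ.1.of_le (by simp))
            (fun x hx => by_contra fun h => hx (hφ.eq_zero fun h' => h (hΩ h'))) hp
            (by simpa using hpd) (by simpa using hps) Metric.isBounded_closedBall
      _ ≤ C₀ * eLpNorm (jacobian φ) p volume := by
          gcongr
          exact eLpNorm_mono fun x => norm_fderiv_le_jacobian φ x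
      _ ≤ C₀ * (eLpNorm (jacobian φ) 2 volume * m) := by
          gcongr
          rw [← eLpNorm_restrict_eq_of_support_subset (s := S)]
          · refine (eLpNorm_le_eLpNorm_mul_rpow_measure_univ (q := 2) (by exact_mod_cast hp2)
              (continuous_jacobian (hφ.1.of_le (by simp))).aestronglyMeasurable).trans ?_
            exact mul_le_mul' (eLpNorm_mono_measure _ Measure.restrict_le_self) le_rfl
          · intro x hx
            by_contra h
            exact hx (by rw [jacobian_eq, hφ.fderiv_eq_zero fun h' => h (hΩ h'), map_zero])
      _ ≤ (C₀ * m.toNNReal : ℝ≥0) * ENNReal.ofReal ‖hφ.toH10‖ := by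
          rw [hφ.eLpNorm_jacobian, ENNReal.coe_mul, ENNReal.coe_toNNReal hm, mul_assoc,
            mul_comm m]
          gcongr
          exact norm_jacH_le _
  -- The inequality passes to `v` by lower semicontinuity of the `L^s` norm along an almost
  -- everywhere convergent subsequence.
  obtain ⟨φ, hφ, hlim⟩ := v.exists_seq_tendsto
  obtain ⟨ns, hns, hae⟩ := exists_subseq_ae (((fnHL Ω).continuous.tendsto v).comp hlim)
  refine (Lp.eLpNorm_lim_le_liminf_eLpNorm (fun n => Lp.aestronglyMeasurable _) _ hae).trans ?_
  have h1 : Tendsto (fun n => ((C₀ * m.toNNReal : ℝ≥0) : ℝ≥0∞) *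
      ENNReal.ofReal ‖(hφ (ns n)).toH10‖) atTop
      (𝓝 ((C₀ * m.toNNReal : ℝ≥0) * ENNReal.ofReal ‖v‖)) :=
    ENNReal.Tendsto.const_mul (ENNReal.tendsto_ofReal ((hlim.comp hns.tendsto_atTop).norm))
      (Or.inr ENNReal.coe_ne_top)
  rw [← h1.liminf_eq]
  exact Filter.liminf_le_liminf (Filter.Eventually.of_forall fun n => htest _ (hφ (ns n)))

section

variable {Ω : Set (Vec d)} {b : Vec d → Vec d} {r s : ℝ≥0∞} {C M : ℝ≥0}

theorem eLpNorm_outer_fnH_le [ENNReal.HolderTriple s r 2]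
    (hb : AEStronglyMeasurable b (volume.restrict Ω))
    (hM : eLpNorm b r (volume.restrict Ω) ≤ M)
    (hC : ∀ v : H10 Ω, eLpNorm (fnH v) s (volume.restrict Ω) ≤ C * ENNReal.ofReal ‖v‖)
    (v : H10 Ω) : eLpNorm (fun x => outer (fnH v x) (b x)) 2 (volume.restrict Ω) ≤
      C * ENNReal.ofReal ‖v‖ * M := by
  refine (eLpNorm_le_eLpNorm_mul_eLpNorm'_of_norm (p := s) (q := r)
    (Lp.aestronglyMeasurable (fnH v)) hb outer 1 (Filter.Eventually.of_forall fun x => ?_)).trans ?_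
  · rw [norm_outer, NNReal.coe_one, one_mul, mul_comm]
  · rw [ENNReal.coe_one, one_mul]
    gcongr
    exact hC v

theorem memLp_outer_fnH [ENNReal.HolderTriple s r 2]
    (hb : AEStronglyMeasurable b (volume.restrict Ω))
    (hM : eLpNorm b r (volume.restrict Ω) ≤ M)
    (hC : ∀ v : H10 Ω, eLpNorm (fnH v) s (volume.restrict Ω) ≤ C * ENNReal.ofReal ‖v‖)
    (v : H10 Ω) : MemLp (fun x => outer (fnH v x) (b x)) 2 (volume.restrict Ω) :=
  ⟨continuous_outer.comp_aestronglyMeasurable ((Lp.aestronglyMeasurable (fnH v)).prodMk hb),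
    (eLpNorm_outer_fnH_le hb hM hC v).trans_lt
      (ENNReal.mul_lt_top (ENNReal.mul_lt_top ENNReal.coe_lt_top ENNReal.ofReal_lt_top)
        ENNReal.coe_lt_top)⟩

theorem integrable_matVec_inner [ENNReal.HolderTriple s r 2]
    (hb : AEStronglyMeasurable b (volume.restrict Ω))
    (hM : eLpNorm b r (volume.restrict Ω) ≤ M)
    (hC : ∀ v : H10 Ω, eLpNorm (fnH v) s (volume.restrict Ω) ≤ C * ENNReal.ofReal ‖v‖)
    (u v : H10 Ω) :
    Integrable (fun x => ⟪matVec (jacH u x) (b x), fnH v x⟫) (volume.restrict Ω) := by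
  simp only [inner_matVec]
  have h := memLp_outer_fnH hb hM hC v
  refine (L2.integrable_inner (𝕜 := ℝ) (jacH u) (h.toLp _)).congr ?_
  filter_upwards [h.coeFn_toLp] with x hx
  rw [hx]

/-- Hölder with `1/s + 1/r = 1/2` puts `φ ⊗ b` in `L²`, the `L^s` norm of `φ` being controlled by
`H¹₀`; Cauchy–Schwarz against the Jacobian of `ψ` finishes. `2 ≤ r` is what gives `b ∈ L²`. -/
theorem isAdvecting_of_eLpNorm_le [ENNReal.HolderTriple s r 2] [IsFiniteMeasure (volume.restrict Ω)]
    (hr : 2 ≤ r) (hb : AEStronglyMeasurable b (volume.restrict Ω))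
    (hM : eLpNorm b r (volume.restrict Ω) ≤ M)
    (hC : ∀ v : H10 Ω, eLpNorm (fnH v) s (volume.restrict Ω) ≤ C * ENNReal.ofReal ‖v‖) :
    IsAdvecting Ω b (C * M) where
  memLp := MemLp.mono_exponent ⟨hb, hM.trans_lt ENNReal.coe_lt_top⟩ hr
  nonneg := by positivity
  bound := fun ψ φ hψ hφ => by
    have h := memLp_outer_fnH hb hM hC hφ.toH10
    have e : ∫ x in Ω, ⟪matVec (jacobian ψ x) (b x), φ x⟫ = ⟪jacH hψ.toH10, h.toLp _⟫ := by
      rw [L2.inner_def]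
      refine integral_congr_ae ?_
      filter_upwards [h.coeFn_toLp, hψ.coeFn_jacH, hφ.coeFn_fnH] with x h1 h2 h3
      rw [h1, h2, inner_matVec, h3]
    rw [e]
    refine (abs_real_inner_le_norm _ _).trans ?_
    have h2 : ‖h.toLp _‖ ≤ C * ‖hφ.toH10‖ * M := by
      rw [Lp.norm_toLp]
      refine ENNReal.toReal_le_of_le_ofReal (by positivity)
        ((eLpNorm_outer_fnH_le hb hM hC hφ.toH10).trans_eq ?_)
      rw [ENNReal.ofReal_mul (by positivity), ENNReal.ofReal_mul (by positivity),
        ENNReal.ofReal_coe_nnreal, ENNReal.ofReal_coe_nnreal]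
    calc ‖jacH hψ.toH10‖ * ‖h.toLp _‖ ≤ ‖hψ.toH10‖ * (C * ‖hφ.toH10‖ * M) :=
          mul_le_mul (norm_jacH_le _) h2 (norm_nonneg _) (norm_nonneg _)
      _ = C * M * ‖hψ.toH10‖ * ‖hφ.toH10‖ := by ring

end

/-- Fields in `L^p`, with `p ≥ 3` in dimension three and `p > 2` in dimension two, are advecting,
uniformly over the subdomains of a ball. -/
theorem exists_isAdvecting_subcritical (hd : d = 2 ∨ d = 3) {p : ℝ≥0∞} (hp : (d : ℝ≥0∞) ≤ p)
    (hp2 : d = 2 → 2 < p) (R : ℝ) (M : ℝ≥0) :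
    ∃ κ : ℝ, ∀ Ω : Set (Vec d), Ω ⊆ Metric.closedBall 0 R → ∀ b : Vec d → Vec d,
      AEStronglyMeasurable b (volume.restrict Ω) → eLpNorm b p (volume.restrict Ω) ≤ M →
      IsAdvecting Ω b κ ∧ ∀ u v : H10 Ω,
        Integrable (fun x => ⟪matVec (jacH u x) (b x), fnH v x⟫) (volume.restrict Ω) := by
  -- Exponents: in dimension three `r = 3`, `s = 6`, `q = 2`. In dimension two `r` lies strictly
  -- between `2` and `p`, `1/s = 1/2 - 1/r`, and `1/q = 1/s + 1/2` gives `q < 2` with Sobolev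
  -- exponent exactly `s`.
  obtain ⟨r, s, q, hr, hrp, hq1, hq2, hqd, hqs, hrs⟩ : ∃ r s q : ℝ≥0, 2 < r ∧ (r : ℝ≥0∞) ≤ p ∧
      1 ≤ q ∧ q ≤ 2 ∧ q < d ∧ (q : ℝ)⁻¹ - (d : ℝ)⁻¹ ≤ (s : ℝ)⁻¹ ∧
      s⁻¹ + r⁻¹ = (2 : ℝ≥0)⁻¹ := by
    rcases hd with rfl | rfl
    · obtain ⟨r, hr1, hr2⟩ := ENNReal.lt_iff_exists_nnreal_btwn.1 (hp2 rfl)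
      have hr1' : 2 < r := by exact_mod_cast hr1
      have hr0 : 0 < r := by positivity
      have hri : r⁻¹ < 2⁻¹ := inv_strictAnti₀ (by norm_num) hr1'
      set t : ℝ≥0 := 2⁻¹ - r⁻¹ with ht
      have ht0 : 0 < t := tsub_pos_of_lt hri
      have htr : t + r⁻¹ = 2⁻¹ := tsub_add_cancel_of_le hri.le
      have ht2 : t ≤ 2⁻¹ := by rw [← htr]; exact le_self_add
      refine ⟨r, t⁻¹, (t + 2⁻¹)⁻¹, hr1', hr2.le, ?_, ?_, ?_, ?_, ?_⟩
      · refine (one_le_inv₀ (by positivity)).2 ?_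
        calc t + 2⁻¹ ≤ 2⁻¹ + 2⁻¹ := by gcongr
          _ = 1 := by rw [← two_mul]; exact mul_inv_cancel₀ two_ne_zero
      · rw [inv_le_comm₀ (by positivity) (by norm_num)]
        exact le_add_self
      · rw [Nat.cast_ofNat, inv_lt_comm₀ (by positivity) (by norm_num)]
        exact lt_add_of_pos_left _ ht0
      · simp
      · rwa [inv_inv]
    · refine ⟨3, 6, 2, by norm_num, by exact_mod_cast hp, by norm_num, le_rfl, by norm_num,
        by norm_num, ?_⟩
      rw [← NNReal.coe_inj]
      push_cast
      norm_num
  obtain ⟨C, hC⟩ := exists_sobolev (d := d) R hq1 hq2 hqd hqs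
  have hs0 : s ≠ 0 := by
    rintro rfl
    rw [inv_zero, zero_add] at hrs
    exact hr.ne' (inv_injective hrs)
  have hr0 : r ≠ 0 := by positivity
  have : ENNReal.HolderTriple (s : ℝ≥0∞) r 2 := ⟨by
    rw [← ENNReal.coe_inv hs0, ← ENNReal.coe_inv hr0, ← ENNReal.coe_add, hrs,
      ENNReal.coe_inv two_ne_zero, ENNReal.coe_ofNat]⟩
  set S : Set (Vec d) := Metric.closedBall 0 R
  have hfin := isFiniteMeasure_restrict_of_subset (d := d) (R := R) subset_rfl
  set m : ℝ≥0∞ := volume.restrict S univ ^ (1 / (r : ℝ≥0∞).toReal - 1 / p.toReal)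
  have hm : m ≠ ⊤ := by
    refine ENNReal.rpow_ne_top_of_nonneg ?_ (measure_ne_top _ _)
    rw [sub_nonneg]
    rcases eq_or_ne p ⊤ with rfl | hpt
    · simp
    · simp only [one_div]
      exact inv_anti₀ (by simpa using hr0.bot_lt) (ENNReal.toReal_mono hpt hrp)
  refine ⟨C * ((M * m.toNNReal : ℝ≥0) : ℝ), fun Ω hΩ b hb hM => ?_⟩
  have hfinΩ := isFiniteMeasure_restrict_of_subset hΩ
  have hM' : eLpNorm b r (volume.restrict Ω) ≤ (M * m.toNNReal : ℝ≥0) := by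
    refine (eLpNorm_le_eLpNorm_mul_rpow_measure_univ hrp hb).trans ?_
    rw [ENNReal.coe_mul, ENNReal.coe_toNNReal hm]
    refine mul_le_mul' hM (ENNReal.rpow_le_rpow ?_ ?_)
    · simp only [Measure.restrict_apply_univ]
      exact measure_mono hΩ
    · rw [sub_nonneg]
      rcases eq_or_ne p ⊤ with rfl | hpt
      · simp
      · simp only [one_div]
        exact inv_anti₀ (by simpa using hr0.bot_lt) (ENNReal.toReal_mono hpt hrp)
  exact ⟨isAdvecting_of_eLpNorm_le (s := s) (r := r) (by exact_mod_cast hr.le) hb hM' (hC Ω hΩ),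
    integrable_matVec_inner (s := s) (r := r) hb hM' (hC Ω hΩ)⟩

end MovingStokes

namespace MovingStokes

open scoped NNReal
open Filter (Tendsto atTop)

variable {d : ℕ}

/-! ### Integration by parts -/

theorem fderiv_apply_eq_sum (ψ : Vec d → ℝ) (x v : Vec d) :
    fderiv ℝ ψ x v = ∑ i, v i * fderiv ℝ ψ x (EuclideanSpace.single i 1) := by
  conv_lhs => rw [← (EuclideanSpace.basisFun (Fin d) ℝ).sum_repr v]
  simp

theorem integral_fderiv_apply_eq_neg {g : Vec d → Vec d} {ψ : Vec d → ℝ} (hg : ContDiff ℝ 1 g)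
    (hψ : ContDiff ℝ 1 ψ) (hc : HasCompactSupport ψ) :
    ∫ x, fderiv ℝ ψ x (g x) = -∫ x, divergence g x * ψ x := by
  have hψ' : ∀ i : Fin d, Continuous fun x => fderiv ℝ ψ x (EuclideanSpace.single i (1 : ℝ)) :=
    fun i => (hψ.continuous_fderiv (by simp)).clm_apply continuous_const
  have hψc : ∀ i : Fin d, HasCompactSupport fun x => fderiv ℝ ψ x (EuclideanSpace.single i (1 : ℝ)) :=
    fun i => (hc.fderiv ℝ).comp_left (g := fun L : Vec d →L[ℝ] ℝ => L (EuclideanSpace.single i 1))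
      (by simp)
  have hgi : ∀ i : Fin d, ContDiff ℝ 1 fun x => g x i := fun i =>
    (EuclideanSpace.proj i : Vec d →L[ℝ] ℝ).contDiff.comp hg
  have hgd : ∀ (i : Fin d) x v, fderiv ℝ (fun x => g x i) x v = fderiv ℝ g x v i := fun i x v => by
    have := ((EuclideanSpace.proj i : Vec d →L[ℝ] ℝ).hasFDerivAt.comp x
      ((hg.differentiable (by simp)) x).hasFDerivAt).fderiv
    rw [show (fun x => g x i) = (EuclideanSpace.proj i : Vec d →L[ℝ] ℝ) ∘ g from rfl, this]
    rfl
  have hg' : ∀ i : Fin d, Continuous fun x => fderiv ℝ g x (EuclideanSpace.single i (1 : ℝ)) i :=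
    fun i => by
      simp only [← hgd]
      exact ((hgi i).continuous_fderiv (by simp)).clm_apply continuous_const
  have hint1 : ∀ i : Fin d, Integrable fun x => g x i * fderiv ℝ ψ x (EuclideanSpace.single i 1) :=
    fun i => ((hgi i).continuous.mul (hψ' i)).integrable_of_hasCompactSupport (hψc i).mul_left
  have hint2 : ∀ i : Fin d, Integrable fun x => fderiv ℝ g x (EuclideanSpace.single i 1) i * ψ x :=
    fun i => ((hg' i).mul hψ.continuous).integrable_of_hasCompactSupport hc.mul_left
  simp only [fderiv_apply_eq_sum ψ _ (g _), divergence, Finset.sum_mul]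
  rw [integral_finsetSum _ fun i _ => hint1 i, integral_finsetSum _ fun i _ => hint2 i,
    ← Finset.sum_neg_distrib]
  refine Finset.sum_congr rfl fun i _ => ?_
  have := integral_mul_fderiv_eq_neg_fderiv_mul_of_integrable (μ := (volume : Measure (Vec d)))
    (f := fun x => g x i) (g := ψ) (v := EuclideanSpace.single i (1 : ℝ))
    (by simpa only [hgd] using hint2 i) (hint1 i)
    (((hgi i).continuous.mul hψ.continuous).integrable_of_hasCompactSupport hc.mul_left)
    (fun x _ => (hgi i).differentiable (by simp) x) (fun x _ => hψ.differentiable (by simp) x)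
  simpa only [hgd] using this

theorem inner_gradient_eq (b : Vec d) (q : Vec d → ℝ) (x : Vec d) :
    ⟪b, gradient q x⟫ = fderiv ℝ q x b := by
  rw [real_inner_comm, gradient, InnerProductSpace.toDual_symm_apply]

theorem weaklyDivFree_of_divergence {Ω : Set (Vec d)} {g : Vec d → Vec d} (hg : ContDiff ℝ 1 g)
    (h0 : ∀ x, divergence g x = 0) : WeaklyDivFree Ω g := by
  intro q hq
  simp only [inner_gradient_eq]
  rw [setIntegral_eq_integral_of_forall_compl_eq_zero, integral_fderiv_apply_eq_neg hg hq.1 hq.2.1]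
  · simp [h0]
  · intro x hx
    rw [image_eq_zero_of_notMem_tsupport fun h => hx (hq.2.2 (tsupport_fderiv_subset ℝ h))]
    rfl

theorem integral_mul_le_of_sq {α : Type*} [MeasurableSpace α] {μ : Measure α} {f g : α → ℝ}
    (hf : MemLp f 2 μ) (hg : MemLp g 2 μ) {A B : ℝ} (hA0 : 0 ≤ A) (hB0 : 0 ≤ B)
    (hA : ∫ x, f x ^ 2 ∂μ ≤ A ^ 2) (hB : ∫ x, g x ^ 2 ∂μ ≤ B ^ 2) :
    |∫ x, f x * g x ∂μ| ≤ A * B := by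
  have key : ∀ {f : α → ℝ} (hf : MemLp f 2 μ) {A : ℝ}, 0 ≤ A → ∫ x, f x ^ 2 ∂μ ≤ A ^ 2 →
      ‖hf.toLp f‖ ≤ A := by
    intro f hf A hA0 hA
    refine le_of_sq_le_sq ?_ hA0
    rw [Lp_norm_sq]
    refine le_of_eq_of_le (integral_congr_ae ?_) hA
    filter_upwards [hf.coeFn_toLp] with x hx
    rw [hx, Real.norm_eq_abs, sq_abs]
  have h : ∫ x, f x * g x ∂μ = ⟪hg.toLp g, hf.toLp f⟫ := by
    rw [L2.inner_def]
    refine integral_congr_ae ?_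
    filter_upwards [hf.coeFn_toLp, hg.coeFn_toLp] with x h1 h2
    rw [h1, h2]
    rfl
  rw [h, mul_comm]
  exact (abs_real_inner_le_norm _ _).trans
    (mul_le_mul (key hg hB0 hB) (key hf hA0 hA) (norm_nonneg _) hB0)

/-! ### The regularized logarithmic kernel -/

/-- The regularized logarithmic kernel. -/
noncomputable def logKer (ε : ℝ) (z : Vec d) : ℝ := Real.log (‖z‖ ^ 2 + ε ^ 2) / 2

/-- The gradient of the regularized logarithmic kernel. -/
noncomputable def logKerGrad (ε : ℝ) (z : Vec d) : Vec d := (‖z‖ ^ 2 + ε ^ 2)⁻¹ • z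

/-- The Laplacian of the regularized logarithmic kernel, in dimension two. -/
noncomputable def logKerLap (ε : ℝ) (z : Vec 2) : ℝ := 2 * ε ^ 2 / (‖z‖ ^ 2 + ε ^ 2) ^ 2

section Kernel

variable {ε : ℝ}

theorem hasFDerivAt_norm_sq_add (c : ℝ) (z : Vec d) :
    HasFDerivAt (fun z : Vec d => ‖z‖ ^ 2 + c) (2 • innerSL ℝ z) z :=
  (hasStrictFDerivAt_norm_sq z).hasFDerivAt.add_const c

theorem hasFDerivAt_logKer (hε : 0 < ε) (z : Vec d) :
    HasFDerivAt (logKer ε) (innerSL ℝ (logKerGrad ε z)) z := by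
  have hpos : 0 < ‖z‖ ^ 2 + ε ^ 2 := by positivity
  have h := ((hasFDerivAt_norm_sq_add (ε ^ 2) z).log hpos.ne').mul_const (2⁻¹ : ℝ)
  refine h.congr_fderiv ?_
  ext v
  simp only [logKerGrad, smul_apply, innerSL_apply_apply, real_inner_smul_left, smul_eq_mul,
    nsmul_eq_mul]
  push_cast
  ring

theorem contDiff_logKerGrad (hε : 0 < ε) : ContDiff ℝ 1 (logKerGrad ε : Vec d → Vec d) := by
  refine ContDiff.smul (ContDiff.inv ((contDiff_norm_sq ℝ).add contDiff_const) fun z => ?_)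
    contDiff_id
  positivity

theorem continuous_logKer (hε : 0 < ε) : Continuous (logKer ε : Vec d → ℝ) :=
  continuous_iff_continuousAt.2 fun z => (hasFDerivAt_logKer hε z).continuousAt

theorem contDiff_logKer (hε : 0 < ε) : ContDiff ℝ 1 (logKer ε : Vec d → ℝ) := by
  refine ContDiff.div_const (ContDiff.log ((contDiff_norm_sq ℝ).add contDiff_const) fun z => ?_) _
  positivity

theorem norm_logKerGrad_le (hε : 0 < ε) (z : Vec d) : ‖logKerGrad ε z‖ ≤ ε⁻¹ := by
  have hpos : 0 < ‖z‖ ^ 2 + ε ^ 2 := by positivity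
  rw [logKerGrad, norm_smul, norm_inv, Real.norm_of_nonneg hpos.le, inv_mul_le_iff₀ hpos,
    ← div_eq_mul_inv, le_div_iff₀ hε]
  nlinarith [sq_nonneg (‖z‖ - ε), sq_nonneg ‖z‖, sq_nonneg ε]

theorem divergence_logKerGrad (hε : 0 < ε) (z : Vec 2) :
    divergence (logKerGrad ε) z = logKerLap ε z := by
  have hpos : 0 < ‖z‖ ^ 2 + ε ^ 2 := by positivity
  have h := ((hasDerivAt_inv hpos.ne').comp_hasFDerivAt z
    (hasFDerivAt_norm_sq_add (ε ^ 2) z)).smul (hasFDerivAt_id z)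
  have h' : fderiv ℝ (logKerGrad ε) z = _ := h.fderiv
  rw [divergence, h']
  have hz : ‖z‖ ^ 2 = z 0 ^ 2 + z 1 ^ 2 := by
    rw [EuclideanSpace.norm_sq_eq, Fin.sum_univ_two, Real.norm_eq_abs, Real.norm_eq_abs, sq_abs,
      sq_abs]
  rw [logKerLap, Fin.sum_univ_two]
  simp [PiLp.inner_apply]
  rw [hz] at hpos ⊢
  field_simp
  ring

theorem continuous_logKerLap (hε : 0 < ε) : Continuous (logKerLap ε) := by
  unfold logKerLap
  refine Continuous.div (by fun_prop) (by fun_prop) fun z => ?_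
  positivity

theorem logKerLap_nonneg (z : Vec 2) : 0 ≤ logKerLap ε z := by unfold logKerLap; positivity

theorem integrable_logKerLap_one : Integrable (logKerLap 1) := by
  -- The decay rate `4` exceeds the dimension `2`. The factor `8` is the `2` in the kernel times the
  -- `4` from `(1 + |z|)⁴ ≤ 4 (|z|² + 1)²`.
  have h := (integrable_one_add_norm (E := Vec 2) (μ := volume) (r := 4) (by simp; norm_num)).const_mul 8
  refine h.mono' (continuous_logKerLap one_pos).aestronglyMeasurable
    (Filter.Eventually.of_forall fun z => ?_)
  rw [Real.norm_of_nonneg (logKerLap_nonneg z), logKerLap, Real.rpow_neg (by positivity)]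
  have h4 : (1 + ‖z‖) ^ (4 : ℝ) = (1 + ‖z‖) ^ 4 := by exact_mod_cast Real.rpow_natCast _ 4
  rw [h4, div_le_iff₀ (by positivity), mul_assoc, inv_mul_eq_div, ← mul_div_assoc,
    le_div_iff₀ (by positivity)]
  have h1 : (1 + ‖z‖) ^ 2 ≤ 2 * (‖z‖ ^ 2 + 1) := by nlinarith [sq_nonneg (‖z‖ - 1)]
  have h2 : ((1 + ‖z‖) ^ 2) ^ 2 ≤ (2 * (‖z‖ ^ 2 + 1)) ^ 2 := by gcongr
  nlinarith

/-- Only positivity of the mass matters later, since one divides by it; its value is never computed.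
-/
theorem integral_logKerLap_one_pos : 0 < ∫ z, logKerLap 1 z := by
  refine (integral_pos_iff_support_of_nonneg logKerLap_nonneg integrable_logKerLap_one).2 ?_
  have : Function.support (logKerLap 1) = univ := by
    ext z
    have : logKerLap 1 z ≠ 0 := by unfold logKerLap; positivity
    simpa using this
  rw [this]
  simp

/-- In the plane the Laplacian of the regularized kernel scales like an approximate identity, `ε⁻²
k(·/ε)`. After the substitution the mollification acts on `ψ`, with a fixed kernel. -/
theorem integral_logKerLap_mul (hε : 0 < ε) (ψ : Vec 2 → ℝ) (y : Vec 2) :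
    ∫ x, logKerLap ε (x - y) * ψ x = ∫ z, logKerLap 1 z * ψ (y + ε • z) := by
  have h1 : ∫ x, logKerLap ε (x - y) * ψ x = ∫ x, logKerLap ε x * ψ (y + x) := by
    rw [← integral_add_right_eq_self (μ := (volume : Measure (Vec 2)))
      (fun x => logKerLap ε (x - y) * ψ x) y]
    simp [add_comm]
  have h2 := Measure.integral_comp_smul (volume : Measure (Vec 2))
    (fun x => logKerLap ε x * ψ (y + x)) ε
  have h3 : ∀ z, logKerLap ε (ε • z) = (ε ^ 2)⁻¹ * logKerLap 1 z := by
    intro z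
    have : ‖ε • z‖ ^ 2 + ε ^ 2 = ε ^ 2 * (‖z‖ ^ 2 + 1 ^ 2) := by
      rw [norm_smul, mul_pow, Real.norm_eq_abs, sq_abs]; ring
    rw [logKerLap, logKerLap, this]
    have : ‖z‖ ^ 2 + 1 ^ 2 ≠ 0 := by positivity
    field_simp
  simp only [h3, mul_assoc, integral_const_mul] at h2
  rw [h1]
  have he : (ε ^ 2)⁻¹ ≠ 0 := by positivity
  refine (mul_left_cancel₀ he (h2.trans ?_)).symm
  simp [abs_of_pos hε]

theorem integral_fderiv_logKerGrad (hε : 0 < ε) {ψ : Vec 2 → ℝ} (hψ : ContDiff ℝ 1 ψ)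
    (hc : HasCompactSupport ψ) (y : Vec 2) :
    ∫ x, fderiv ℝ ψ x (logKerGrad ε (x - y)) = -∫ z, logKerLap 1 z * ψ (y + ε • z) := by
  have hg : ContDiff ℝ 1 fun x : Vec 2 => logKerGrad ε (x - y) :=
    (contDiff_logKerGrad hε).comp (contDiff_id.sub contDiff_const)
  rw [integral_fderiv_apply_eq_neg hg hψ hc, ← integral_logKerLap_mul hε]
  congr 2
  ext x
  rw [← divergence_logKerGrad hε]
  simp only [divergence]
  rw [fderiv_comp_sub]

end Kernel

end MovingStokes

namespace MovingStokes

open scoped NNReal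
open Filter (Tendsto atTop)

/-! ### Regularized logarithmic potentials -/

section Potential

variable {Ω : Set (Vec 2)} {ε : ℝ} {f : Vec 2 → ℝ}

/-- The regularized logarithmic potential of `f`. -/
noncomputable def logPot (Ω : Set (Vec 2)) (ε : ℝ) (f : Vec 2 → ℝ) (x : Vec 2) : ℝ :=
  ∫ y in Ω, f y * logKer ε (x - y)

/-- The gradient of the regularized logarithmic potential of `f`. -/
noncomputable def logPotGrad (Ω : Set (Vec 2)) (ε : ℝ) (f : Vec 2 → ℝ) (x : Vec 2) : Vec 2 :=
  ∫ y in Ω, f y • logKerGrad ε (x - y)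

theorem norm_smul_logKerGrad_le (hε : 0 < ε) (x y : Vec 2) :
    ‖f y • logKerGrad ε (x - y)‖ ≤ ‖f y‖ * ε⁻¹ := by
  rw [norm_smul]
  gcongr
  exact norm_logKerGrad_le hε _

theorem aestronglyMeasurable_smul_logKerGrad (hf : Integrable f (volume.restrict Ω)) (hε : 0 < ε)
    (x : Vec 2) : AEStronglyMeasurable (fun y => f y • logKerGrad ε (x - y))
      (volume.restrict Ω) :=
  hf.aestronglyMeasurable.smul ((contDiff_logKerGrad hε).continuous.comp
    (continuous_const.sub continuous_id)).aestronglyMeasurable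

theorem integrable_smul_logKerGrad (hf : Integrable f (volume.restrict Ω)) (hε : 0 < ε)
    (x : Vec 2) : Integrable (fun y => f y • logKerGrad ε (x - y)) (volume.restrict Ω) :=
  (hf.norm.mul_const ε⁻¹).mono' (aestronglyMeasurable_smul_logKerGrad hf hε x)
    (Filter.Eventually.of_forall fun y => norm_smul_logKerGrad_le hε x y)

theorem continuous_logPotGrad (hf : Integrable f (volume.restrict Ω)) (hε : 0 < ε) :
    Continuous (logPotGrad Ω ε f) := by
  refine continuous_of_dominated (fun x => aestronglyMeasurable_smul_logKerGrad hf hε x)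
    (fun x => Filter.Eventually.of_forall fun y => norm_smul_logKerGrad_le hε x y)
    (hf.norm.mul_const ε⁻¹) (Filter.Eventually.of_forall fun y => ?_)
  have hk : Continuous fun x : Vec 2 => logKerGrad ε (x - y) :=
    (contDiff_logKerGrad hε).continuous.comp (continuous_id.sub continuous_const)
  exact hk.const_smul (f y)

/-- Differentiation under the integral: the gradient of the kernel is bounded by `ε⁻¹`. The kernel
itself grows at infinity, and boundedness of `Ω` makes the potential finite. -/
theorem hasFDerivAt_logPot {R : ℝ} (hΩ : Ω ⊆ Metric.closedBall 0 R) (hΩm : MeasurableSet Ω)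
    (hf : Integrable f (volume.restrict Ω)) (hε : 0 < ε) (x : Vec 2) :
    HasFDerivAt (logPot Ω ε f) (innerSL ℝ (logPotGrad Ω ε f x)) x := by
  have hm : ∀ x, AEStronglyMeasurable (fun y => f y * logKer ε (x - y)) (volume.restrict Ω) :=
    fun x => hf.aestronglyMeasurable.mul ((continuous_logKer hε).comp
      (continuous_const.sub continuous_id)).aestronglyMeasurable
  have hint : Integrable (fun y => f y * logKer ε (x - y)) (volume.restrict Ω) := by
    obtain ⟨C, hC⟩ := (isCompact_closedBall (0 : Vec 2) R).exists_bound_of_continuousOn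
      ((continuous_logKer hε).comp (continuous_const.sub continuous_id)
        : Continuous fun y => logKer ε (x - y)).continuousOn
    refine (hf.norm.mul_const C).mono' (hm x) ((ae_restrict_iff' hΩm).2
      (Filter.Eventually.of_forall fun y hy => ?_))
    rw [norm_mul]
    gcongr
    exact hC y (hΩ hy)
  have h := hasFDerivAt_integral_of_dominated_of_fderiv_le (μ := volume.restrict Ω)
    (F := fun x y => f y * logKer ε (x - y))
    (F' := fun x y => innerSL ℝ (f y • logKerGrad ε (x - y))) (x₀ := x) (s := univ)
    (bound := fun y => ‖f y‖ * ε⁻¹) Filter.univ_mem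
    (Filter.Eventually.of_forall hm) hint
    ((innerSL ℝ).continuous.comp_aestronglyMeasurable
      (aestronglyMeasurable_smul_logKerGrad hf hε x))
    (Filter.Eventually.of_forall fun y x _ => by
      rw [innerSL_apply_norm]; exact norm_smul_logKerGrad_le hε x y)
    (hf.norm.mul_const ε⁻¹) (Filter.Eventually.of_forall fun y x _ => ?_)
  · refine h.congr_fderiv ?_
    exact ContinuousLinearMap.integral_comp_comm (innerSL ℝ) (integrable_smul_logKerGrad hf hε x)
  · rw [map_smul]
    exact ((hasFDerivAt_logKer hε (x - y)).comp x ((hasFDerivAt_id x).sub_const y)).const_mul (f y)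

theorem contDiff_logPot {R : ℝ} (hΩ : Ω ⊆ Metric.closedBall 0 R) (hΩm : MeasurableSet Ω)
    (hf : Integrable f (volume.restrict Ω)) (hε : 0 < ε) : ContDiff ℝ 1 (logPot Ω ε f) := by
  rw [contDiff_one_iff_fderiv]
  refine ⟨fun x => (hasFDerivAt_logPot hΩ hΩm hf hε x).differentiableAt, ?_⟩
  have : fderiv ℝ (logPot Ω ε f) = fun x => innerSL ℝ (logPotGrad Ω ε f x) :=
    funext fun x => (hasFDerivAt_logPot hΩ hΩm hf hε x).fderiv
  rw [this]
  exact (innerSL ℝ).continuous.comp (continuous_logPotGrad hf hε)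

/-- Weak form of the equation that the Laplacian of the potential is a mollification of `f`. Fubini
reduces it to the Laplacian of the kernel, and the mollification falls on the test function. -/
theorem integral_fderiv_logPotGrad (hf : Integrable f (volume.restrict Ω)) (hε : 0 < ε)
    {ψ : Vec 2 → ℝ} (hψ : ContDiff ℝ 1 ψ) (hc : HasCompactSupport ψ) :
    ∫ x, fderiv ℝ ψ x (logPotGrad Ω ε f x) =
      -∫ y in Ω, f y * ∫ z, logKerLap 1 z * ψ (y + ε • z) := by
  have hψ' : Continuous (fderiv ℝ ψ) := hψ.continuous_fderiv (by simp)
  have h1 : ∀ x, fderiv ℝ ψ x (logPotGrad Ω ε f x) =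
      ∫ y in Ω, f y * fderiv ℝ ψ x (logKerGrad ε (x - y)) := by
    intro x
    rw [logPotGrad, ← ContinuousLinearMap.integral_comp_comm _ (integrable_smul_logKerGrad hf hε x)]
    simp
  simp only [h1]
  rw [integral_integral_swap, ← integral_neg]
  · refine integral_congr_ae (Filter.Eventually.of_forall fun y => ?_)
    simp only []
    rw [integral_const_mul, integral_fderiv_logKerGrad hε hψ hc, mul_neg]
  · have hi : Integrable (fderiv ℝ ψ) volume := hψ'.integrable_of_hasCompactSupport (hc.fderiv ℝ)
    refine (hi.norm.mul_prod (hf.norm.mul_const ε⁻¹)).mono' ?_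
      (Filter.Eventually.of_forall fun p => ?_)
    · refine hf.aestronglyMeasurable.comp_snd.mul (Continuous.aestronglyMeasurable ?_)
      exact (hψ'.comp continuous_fst).clm_apply ((contDiff_logKerGrad hε).continuous.comp
        (continuous_fst.sub continuous_snd))
    · simp only [Function.uncurry]
      rw [norm_mul]
      have := (fderiv ℝ ψ p.1).le_of_opNorm_le_of_le le_rfl (norm_logKerGrad_le hε (p.1 - p.2))
      calc ‖f p.2‖ * ‖fderiv ℝ ψ p.1 (logKerGrad ε (p.1 - p.2))‖
          ≤ ‖f p.2‖ * (‖fderiv ℝ ψ p.1‖ * ε⁻¹) := by gcongr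
        _ = _ := by ring

theorem abs_integral_logKerLap_mul_le {ψ : Vec 2 → ℝ} {C : ℝ} (hC : ∀ x, |ψ x| ≤ C) (ε : ℝ)
    (y : Vec 2) : |∫ z, logKerLap 1 z * ψ (y + ε • z)| ≤ (∫ z, logKerLap 1 z) * C := by
  rw [← integral_mul_const, ← Real.norm_eq_abs]
  refine norm_integral_le_of_norm_le (integrable_logKerLap_one.mul_const C)
    (Filter.Eventually.of_forall fun z => ?_)
  rw [norm_mul, Real.norm_of_nonneg (logKerLap_nonneg z)]
  exact mul_le_mul_of_nonneg_left (hC _) (logKerLap_nonneg z)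

theorem fderiv_sq_mul_apply_self {χ N : Vec 2 → ℝ} {x v : Vec 2} (hχ : DifferentiableAt ℝ χ x)
    (hN : HasFDerivAt N (innerSL ℝ v) x) : fderiv ℝ (fun x => χ x ^ 2 * N x) x v =
      (χ x * ‖v‖) ^ 2 + 2 * (χ x * N x * fderiv ℝ χ x v) := by
  have h : fderiv ℝ (fun x => χ x ^ 2 * N x) x = _ := ((hχ.hasFDerivAt.pow 2).mul hN).fderiv
  rw [h]
  simp only [add_apply, smul_apply, innerSL_apply_apply, smul_eq_mul, real_inner_self_eq_norm_sq,
    nsmul_eq_mul]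
  push_cast
  ring

/-- Young's inequality. The term occurs twice in the energy identity, so the weight `1/4` absorbs
exactly half of the energy. -/
theorem abs_inner_le_energy {a b g n m M : ℝ} (ha : 0 ≤ a) (hM : 0 ≤ M)
    (hn : |n| ≤ M) (hb : |b| ≤ m * g) : |a * n * b| ≤ (a * g) ^ 2 * 4⁻¹ + M ^ 2 * m ^ 2 := by
  have e1 : |a * n * b| ≤ (a * g) * (M * m) := by
    rw [abs_mul, abs_mul, abs_of_nonneg ha]
    calc a * |n| * |b| ≤ a * M * (m * g) := by gcongr
      _ = _ := by ring
  nlinarith [sq_nonneg (a * g - 2 * (M * m))]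

/-- The energy of a bounded logarithmic potential. -/
theorem integral_sq_logPotGrad_le {R : ℝ} (hΩ : Ω ⊆ Metric.closedBall 0 R) (hΩm : MeasurableSet Ω)
    (hf : Integrable f (volume.restrict Ω)) (hε : 0 < ε) {M : ℝ} (hM : ∀ x, |logPot Ω ε f x| ≤ M)
    {χ : Vec 2 → ℝ} (hχ : ContDiff ℝ 1 χ) (hc : HasCompactSupport χ) (hχ1 : ∀ x, |χ x| ≤ 1) :
    ∫ x, (χ x * ‖logPotGrad Ω ε f x‖) ^ 2 ≤
      2 * ((∫ z, logKerLap 1 z) * M * ∫ y in Ω, |f y|) + 4 * M ^ 2 * ∫ x, ‖fderiv ℝ χ x‖ ^ 2 := by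
  set N := logPot Ω ε f with hN
  set G := logPotGrad Ω ε f with hG
  have hNc : ContDiff ℝ 1 N := contDiff_logPot hΩ hΩm hf hε
  have hGc : Continuous G := continuous_logPotGrad hf hε
  have hχ' : Continuous (fderiv ℝ χ) := hχ.continuous_fderiv (by simp)
  -- The equation is tested with `χ² N`: its gradient paired with that of `N` is `χ² |∇N|² + 2 χ N
  -- ∇χ·∇N`, while the right side is at most the mass of the kernel times `M ‖f‖₁`.
  have hψ : ContDiff ℝ 1 fun x => χ x ^ 2 * N x := (hχ.pow 2).mul hNc
  have hc0 : HasCompactSupport fun x => χ x ^ 2 := by simpa only [sq] using! hc.mul_right (f' := χ)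
  have hc2 : HasCompactSupport fun x => χ x ^ 2 * N x := hc0.mul_right
  have h1 : ∫ x, fderiv ℝ (fun x => χ x ^ 2 * N x) x (G x) = _ :=
    integral_fderiv_logPotGrad hf hε hψ hc2
  have hd : ∀ x, fderiv ℝ (fun x => χ x ^ 2 * N x) x (G x) =
      (χ x * ‖G x‖) ^ 2 + 2 * (χ x * N x * fderiv ℝ χ x (G x)) := fun x =>
    fderiv_sq_mul_apply_self (hχ.differentiable (by simp) x) (hasFDerivAt_logPot hΩ hΩm hf hε x)
  have hM0 : 0 ≤ M := (abs_nonneg _).trans (hM 0)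
  have hb : |∫ y in Ω, f y * ∫ z, logKerLap 1 z * (fun x => χ x ^ 2 * N x) (y + ε • z)| ≤
      (∫ z, logKerLap 1 z) * M * ∫ y in Ω, |f y| := by
    rw [← integral_const_mul, ← Real.norm_eq_abs]
    refine norm_integral_le_of_norm_le (hf.abs.const_mul _)
      (Filter.Eventually.of_forall fun y => ?_)
    rw [norm_mul, mul_comm, Real.norm_eq_abs, Real.norm_eq_abs]
    gcongr
    refine abs_integral_logKerLap_mul_le (ψ := fun x => χ x ^ 2 * N x) (fun x => ?_) ε y
    rw [abs_mul, abs_pow]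
    calc |χ x| ^ 2 * |N x| ≤ 1 ^ 2 * M := by gcongr; exacts [hχ1 x, hM x]
      _ = M := by ring
  have hcG : HasCompactSupport fun x => χ x * ‖G x‖ := hc.mul_right
  have i1 : Integrable fun x => (χ x * ‖G x‖) ^ 2 :=
    ((hχ.continuous.mul hGc.norm).memLp_of_hasCompactSupport hcG).integrable_sq
  have hcN : HasCompactSupport fun x => χ x * N x := hc.mul_right
  have hcF : HasCompactSupport fun x => χ x * N x * fderiv ℝ χ x (G x) := hcN.mul_right
  have i2 : Integrable fun x => 2 * (χ x * N x * fderiv ℝ χ x (G x)) :=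
    (((hχ.continuous.mul hNc.continuous).mul
      (hχ'.clm_apply hGc)).integrable_of_hasCompactSupport hcF).const_mul 2
  have i3 : Integrable fun x => ‖fderiv ℝ χ x‖ ^ 2 :=
    (hχ'.norm.memLp_of_hasCompactSupport (hc.fderiv ℝ).norm).integrable_sq
  simp only [hd] at h1
  rw [integral_add i1 i2] at h1
  have h2 : -∫ x, 2 * (χ x * N x * fderiv ℝ χ x (G x)) ≤
      ∫ x, ((χ x * ‖G x‖) ^ 2 * 2⁻¹ + 2 * M ^ 2 * ‖fderiv ℝ χ x‖ ^ 2) := by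
    rw [← integral_neg]
    refine integral_mono i2.neg ((i1.mul_const _).add (i3.const_mul _)) fun x => ?_
    simp only []
    have e1 := abs_inner_le_energy (abs_nonneg (χ x)) hM0 (hM x) ((fderiv ℝ χ x).le_opNorm (G x))
    have e2 : (χ x * ‖G x‖) ^ 2 = (|χ x| * ‖G x‖) ^ 2 := by rw [mul_pow, mul_pow, sq_abs]
    have e3 : |(|χ x| * N x * fderiv ℝ χ x (G x))| = |χ x * N x * fderiv ℝ χ x (G x)| := by
      rw [abs_mul, abs_mul, abs_abs, abs_mul, abs_mul]
    have e4 := neg_abs_le (χ x * N x * fderiv ℝ χ x (G x))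
    rw [e2]
    linarith
  rw [integral_add (i1.mul_const _) (i3.const_mul _)] at h2
  simp only [integral_const_mul, integral_mul_const] at h1 h2
  beta_reduce at hb
  have h3 := neg_abs_le (∫ y in Ω, f y * ∫ z, logKerLap 1 z * (χ (y + ε • z) ^ 2 * N (y + ε • z)))
  linarith

/-- Functions with uniformly bounded logarithmic potentials are in the dual of `H¹₀`. -/
theorem abs_integral_mul_le_of_logPot {R : ℝ} (hΩ : Ω ⊆ Metric.closedBall 0 R)
    (hΩm : MeasurableSet Ω) (hf : Integrable f (volume.restrict Ω)) {M F : ℝ}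
    (hM : ∀ ε : ℝ, 0 < ε → ∀ x, |logPot Ω ε f x| ≤ M) (hF : ∫ y in Ω, |f y| ≤ F)
    {χ : Vec 2 → ℝ} (hχ : ContDiff ℝ 1 χ) (hc : HasCompactSupport χ) (hχ1 : ∀ x, |χ x| ≤ 1)
    (hχΩ : ∀ x ∈ Ω, χ x = 1) {φ : Vec 2 → ℝ} (hφ : ContDiff ℝ 1 φ) (hφc : HasCompactSupport φ)
    (hφΩ : tsupport φ ⊆ Ω) {P : ℝ} (hP0 : 0 ≤ P) (hP : ∫ x, ‖fderiv ℝ φ x‖ ^ 2 ≤ P ^ 2) :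
    (∫ z, logKerLap 1 z) * |∫ y in Ω, f y * φ y| ≤
      Real.sqrt (2 * ((∫ z, logKerLap 1 z) * M * F) +
        4 * M ^ 2 * ∫ x, ‖fderiv ℝ χ x‖ ^ 2) * P := by
  have hM0 : 0 ≤ M := (abs_nonneg _).trans (hM 1 one_pos 0)
  have hφ' : Continuous (fderiv ℝ φ) := hφ.continuous_fderiv (by simp)
  obtain ⟨C, hC⟩ := hφc.exists_bound_of_continuous hφ.continuous
  simp only [Real.norm_eq_abs] at hC
  set A := 2 * ((∫ z, logKerLap 1 z) * M * F) + 4 * M ^ 2 * ∫ x, ‖fderiv ℝ χ x‖ ^ 2 with hA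
  -- At fixed `ε` the mollified pairing equals `-∫ ∇φ · ∇N`. The cutoff is `1` where `∇φ` is
  -- nonzero, so Cauchy–Schwarz and the energy bound apply, uniformly in `ε`.
  have hbound : ∀ ε : ℝ, 0 < ε → |∫ y in Ω, f y * ∫ z, logKerLap 1 z * φ (y + ε • z)| ≤
      Real.sqrt A * P := by
    intro ε hε
    have hGc := continuous_logPotGrad hf hε
    have hE : ∫ x, (χ x * ‖logPotGrad Ω ε f x‖) ^ 2 ≤ A := by
      refine (integral_sq_logPotGrad_le hΩ hΩm hf hε (hM ε hε) hχ hc hχ1).trans ?_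
      rw [hA]
      gcongr
      exact mul_nonneg integral_logKerLap_one_pos.le hM0
    have hA0 : 0 ≤ A := (integral_nonneg fun x => sq_nonneg _).trans hE
    rw [← abs_neg, ← integral_fderiv_logPotGrad hf hε hφ hφc]
    have h1 := integral_mul_le_of_sq (μ := (volume : Measure (Vec 2)))
      (f := fun x => χ x * ‖logPotGrad Ω ε f x‖) (g := fun x => ‖fderiv ℝ φ x‖)
      ((hχ.continuous.mul hGc.norm).memLp_of_hasCompactSupport
        (hc.mul_right (f' := fun x => ‖logPotGrad Ω ε f x‖)))
      (hφ'.norm.memLp_of_hasCompactSupport (hφc.fderiv ℝ).norm)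
      (Real.sqrt_nonneg A) hP0 (hE.trans_eq (Real.sq_sqrt hA0).symm) hP
    refine le_trans ?_ ((le_abs_self _).trans h1)
    rw [← Real.norm_eq_abs]
    refine norm_integral_le_of_norm_le ?_ (Filter.Eventually.of_forall fun x => ?_)
    · exact ((hχ.continuous.mul hGc.norm).mul hφ'.norm).integrable_of_hasCompactSupport
        ((hφc.fderiv ℝ).norm.mul_left (f := fun x => χ x * ‖logPotGrad Ω ε f x‖))
    · by_cases hx : x ∈ Ω
      · simp only [hχΩ x hx, one_mul]
        rw [mul_comm]
        exact (fderiv ℝ φ x).le_opNorm _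
      · have : fderiv ℝ φ x = 0 :=
          image_eq_zero_of_notMem_tsupport fun h => hx (hφΩ (tsupport_fderiv_subset ℝ h))
        simp [this]
  have hinner : ∀ y, Tendsto (fun n : ℕ => ∫ z, logKerLap 1 z * φ (y + (1 / ((n : ℝ) + 1)) • z))
      atTop (𝓝 ((∫ z, logKerLap 1 z) * φ y)) := by
    intro y
    rw [← integral_mul_const]
    refine tendsto_integral_of_dominated_convergence (fun z => logKerLap 1 z * C) (fun n => ?_)
      (integrable_logKerLap_one.mul_const C) (fun n => Filter.Eventually.of_forall fun z => ?_)
      (Filter.Eventually.of_forall fun z => ?_)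
    · refine ((continuous_logKerLap one_pos).mul (hφ.continuous.comp ?_)).aestronglyMeasurable
      fun_prop
    · rw [norm_mul, Real.norm_of_nonneg (logKerLap_nonneg z)]
      exact mul_le_mul_of_nonneg_left (hC _) (logKerLap_nonneg z)
    · refine tendsto_const_nhds.mul ((hφ.continuous.tendsto y).comp ?_)
      have := (tendsto_one_div_add_atTop_nhds_zero_nat (𝕜 := ℝ)).smul_const z
      simpa using this.const_add y
  -- As `ε → 0` the mollification of `φ` tends boundedly to the mass of the kernel times `φ`.
  have hlim : Tendsto (fun n : ℕ =>
      ∫ y in Ω, f y * ∫ z, logKerLap 1 z * φ (y + (1 / ((n : ℝ) + 1)) • z))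
      atTop (𝓝 (∫ y in Ω, f y * ((∫ z, logKerLap 1 z) * φ y))) := by
    refine tendsto_integral_of_dominated_convergence
      (fun y => |f y| * ((∫ z, logKerLap 1 z) * C)) (fun n => ?_) (hf.abs.mul_const _)
      (fun n => Filter.Eventually.of_forall fun y => ?_)
      (Filter.Eventually.of_forall fun y => tendsto_const_nhds.mul (hinner y))
    · refine hf.aestronglyMeasurable.mul (Continuous.aestronglyMeasurable ?_)
      refine continuous_of_dominated (bound := fun z => logKerLap 1 z * C) (fun y => ?_)
        (fun y => Filter.Eventually.of_forall fun z => ?_) (integrable_logKerLap_one.mul_const C)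
        (Filter.Eventually.of_forall fun z => ?_)
      · refine ((continuous_logKerLap one_pos).mul (hφ.continuous.comp ?_)).aestronglyMeasurable
        fun_prop
      · rw [norm_mul, Real.norm_of_nonneg (logKerLap_nonneg z)]
        exact mul_le_mul_of_nonneg_left (hC _) (logKerLap_nonneg z)
      · exact continuous_const.mul (hφ.continuous.comp (by fun_prop))
    · rw [norm_mul, Real.norm_eq_abs, Real.norm_eq_abs]
      gcongr
      exact abs_integral_logKerLap_mul_le hC _ y
  have hfin := le_of_tendsto hlim.abs (Filter.Eventually.of_forall fun n =>
    hbound (1 / ((n : ℝ) + 1)) (by positivity))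
  refine le_of_eq_of_le ?_ hfin
  rw [← abs_of_pos integral_logKerLap_one_pos, ← abs_mul, ← integral_const_mul,
    abs_of_pos integral_logKerLap_one_pos]
  congr 1
  refine integral_congr_ae (Filter.Eventually.of_forall fun y => ?_)
  simp only []
  ring

end Potential

end MovingStokes

namespace MovingStokes

open scoped NNReal
open Filter (Tendsto atTop)

/-! ### Rotations of the plane -/

instance instFactFinrankVecTwo : Fact (Module.finrank ℝ (Vec 2) = 2) := ⟨by simp⟩

/-- The standard orientation of the plane. -/
noncomputable def planeOrientation : Orientation ℝ (Vec 2) (Fin 2) :=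
  (EuclideanSpace.basisFun (Fin 2) ℝ).toBasis.orientation

/-- The rotation of the plane by the angle `θ`. -/
@[irreducible] noncomputable def rot (θ : ℝ) : Vec 2 ≃ₗᵢ[ℝ] Vec 2 := planeOrientation.rotation θ

theorem rot_apply (θ : ℝ) (v : Vec 2) :
    rot θ v = Real.cos θ • v + Real.sin θ • planeOrientation.rightAngleRotation v := by
  rw [rot, Orientation.rotation_apply, Real.Angle.cos_coe, Real.Angle.sin_coe]

theorem continuous_rot : Continuous fun p : ℝ × Vec 2 => rot p.1 p.2 := by
  simp only [rot_apply]
  have := planeOrientation.rightAngleRotation.continuous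
  fun_prop

theorem continuous_rot_left (v : Vec 2) : Continuous fun θ => rot θ v := by
  simp only [rot_apply]
  fun_prop

theorem hasDerivAt_rot (θ : ℝ) (v : Vec 2) :
    HasDerivAt (fun θ => rot θ v) (rot θ (planeOrientation.rightAngleRotation v)) θ := by
  have h := ((Real.hasDerivAt_cos θ).smul_const v).add
    ((Real.hasDerivAt_sin θ).smul_const (planeOrientation.rightAngleRotation v))
  refine (h.congr_deriv ?_).congr_of_eventuallyEq
    (Filter.Eventually.of_forall fun θ => rot_apply θ v)
  rw [rot_apply, Orientation.rightAngleRotation_rightAngleRotation]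
  module

theorem exists_rot_eq {v v' : Vec 2} (h : ‖v‖ = ‖v'‖) :
    ∃ θ ∈ Ioc (-Real.pi) Real.pi, rot θ v = v' := by
  refine ⟨(planeOrientation.oangle v v').toReal, Real.Angle.toReal_mem_Ioc _, ?_⟩
  rw [rot, Real.Angle.coe_toReal]
  exact (planeOrientation.rotation_oangle_eq_iff_norm_eq v v').2 h

/-- The oscillation of a function on a circle. -/
theorem abs_sub_le_integral_circle {u : Vec 2 → ℝ} (hu : ContDiff ℝ 1 u) (x : Vec 2) {v v' : Vec 2}
    (h : ‖v‖ = ‖v'‖) : |u (x + v') - u (x + v)| ≤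
      ‖v‖ * ∫ θ in Ioc (-Real.pi) Real.pi, ‖fderiv ℝ u (x + rot θ v)‖ := by
  obtain ⟨θ, hθ, rfl⟩ := exists_rot_eq h
  have hu' : Continuous (fderiv ℝ u) := hu.continuous_fderiv (by simp)
  have hrot := continuous_rot_left
  have hd : ∀ s, HasDerivAt (fun θ => u (x + rot θ v))
      (fderiv ℝ u (x + rot s v) (rot s (planeOrientation.rightAngleRotation v))) s := fun s =>
    ((hu.differentiable (by simp)) _).hasFDerivAt.comp_hasDerivAt s
      ((hasDerivAt_rot s v).const_add x)
  have hc : Continuous fun s =>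
      fderiv ℝ u (x + rot s v) (rot s (planeOrientation.rightAngleRotation v)) :=
    (hu'.comp (continuous_const.add (hrot v))).clm_apply (hrot _)
  have hn : Continuous fun s => ‖fderiv ℝ u (x + rot s v)‖ :=
    (hu'.comp (continuous_const.add (hrot v))).norm
  have hn' : Continuous fun s => ‖v‖ * ‖fderiv ℝ u (x + rot s v)‖ := continuous_const.mul hn
  have h0 : rot 0 v = v := by simp [rot_apply]
  -- The fundamental theorem along the arc from angle `0` to `θ`. The angle is normalized to `(-π,
  -- π]`, so the arc is contained in one full turn.
  have h1 := intervalIntegral.integral_eq_sub_of_hasDerivAt (a := 0) (b := θ) (fun s _ => hd s)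
    (hc.intervalIntegrable _ _)
  rw [h0] at h1
  rw [← h1, ← Real.norm_eq_abs, ← integral_const_mul]
  refine (intervalIntegral.norm_integral_le_abs_of_norm_le
    (g := fun s => ‖v‖ * ‖fderiv ℝ u (x + rot s v)‖) (Filter.Eventually.of_forall fun s => ?_)
    (hn'.intervalIntegrable _ _)).trans ?_
  · refine ((fderiv ℝ u _).le_opNorm _).trans_eq ?_
    rw [LinearIsometryEquiv.norm_map, LinearIsometryEquiv.norm_map, mul_comm]
  · have hpi := Real.pi_pos
    refine (intervalIntegral.abs_integral_mono_interval (c := -Real.pi) (d := Real.pi) ?_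
      (Filter.Eventually.of_forall fun s => mul_nonneg (norm_nonneg _) (norm_nonneg _))
      (hn'.intervalIntegrable _ _)).trans_eq ?_
    · intro s hs
      rw [uIoc_of_le (by linarith)]
      rcases mem_uIoc.1 hs with hs | hs
      · exact ⟨by linarith [hs.1], hs.2.trans hθ.2⟩
      · exact ⟨hθ.1.trans hs.1, hs.2.trans hpi.le⟩
    · rw [intervalIntegral.integral_of_le (by linarith),
        abs_of_nonneg (integral_nonneg fun s => mul_nonneg (norm_nonneg _) (norm_nonneg _))]

/-! ### Radial fields -/

theorem IntegrableOn.continuous_mul {Ω : Set (Vec 2)} {R : ℝ} (hΩ : Ω ⊆ Metric.closedBall 0 R)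
    (hΩm : MeasurableSet Ω) {f g : Vec 2 → ℝ} (hf : Integrable f (volume.restrict Ω))
    (hg : Continuous g) : Integrable (fun y => g y * f y) (volume.restrict Ω) := by
  obtain ⟨C, hC⟩ := (isCompact_closedBall (0 : Vec 2) R).exists_bound_of_continuousOn
    hg.continuousOn
  refine (hf.norm.const_mul C).mono' (hg.aestronglyMeasurable.mul hf.aestronglyMeasurable)
    ((ae_restrict_iff' hΩm).2 (Filter.Eventually.of_forall fun y hy => ?_))
  rw [norm_mul]
  gcongr
  exact hC y (hΩ hy)

/-- The radial cutoff, as a function of the squared radius. -/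
noncomputable def radialCut (R : ℝ) (n : ℕ) (s : ℝ) : ℝ :=
  min 1 (max 0 (((n : ℝ) + 1) * (R ^ 2 - s) - 1))

theorem radialCut_nonneg (R : ℝ) (n : ℕ) (s : ℝ) : 0 ≤ radialCut R n s :=
  le_min zero_le_one (le_max_left _ _)

theorem radialCut_le_one (R : ℝ) (n : ℕ) (s : ℝ) : radialCut R n s ≤ 1 := min_le_left _ _

theorem continuous_radialCut (R : ℝ) (n : ℕ) : Continuous (radialCut R n) := by
  unfold radialCut
  fun_prop

theorem radialCut_eq_zero {R : ℝ} {n : ℕ} {s : ℝ} (h : R ^ 2 - 1 / ((n : ℝ) + 1) ≤ s) :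
    radialCut R n s = 0 := by
  have hn : (0 : ℝ) < (n : ℝ) + 1 := by positivity
  have : ((n : ℝ) + 1) * (R ^ 2 - s) ≤ 1 := by
    have : R ^ 2 - s ≤ 1 / ((n : ℝ) + 1) := by linarith
    rwa [le_div_iff₀ hn, mul_comm] at this
  rw [radialCut, max_eq_left (by linarith), min_eq_right zero_le_one]

theorem tendsto_radialCut {R s : ℝ} (h : s < R ^ 2) :
    Tendsto (fun n => radialCut R n s) atTop (𝓝 1) := by
  have h1 : Tendsto (fun n : ℕ => ((n : ℝ) + 1) * (R ^ 2 - s) - 1) atTop atTop :=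
    Filter.tendsto_atTop_add_const_right _ _ (Filter.Tendsto.atTop_mul_const (by linarith)
      (Filter.tendsto_atTop_add_const_right _ _ tendsto_natCast_atTop_atTop))
  refine tendsto_const_nhds.congr' ?_
  filter_upwards [h1.eventually_ge_atTop 1] with n hn
  rw [radialCut, max_eq_right (by linarith), min_eq_left hn]

/-- A divergence free field is orthogonal to the radial fields on balls. -/
theorem WeaklyDivFree.integral_radial {Ω : Set (Vec 2)} {b : Vec 2 → Vec 2}
    (h : WeaklyDivFree Ω b) {R₀ : ℝ} (hΩ : Ω ⊆ Metric.closedBall 0 R₀) (hΩm : MeasurableSet Ω)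
    (hb : Integrable b (volume.restrict Ω)) {G : ℝ → ℝ} (hG : Continuous G) (x : Vec 2) {R : ℝ}
    (hR0 : 0 ≤ R) (hR : Metric.ball x R ⊆ Ω) :
    ∫ y in Ω, (Metric.ball x R).indicator (fun y => G (‖y - x‖ ^ 2) * ⟪b y, y - x⟫) y = 0 := by
  -- With the cutoff inserted, the radial field is the gradient of `P(‖y - x‖²)`, where `P` is a
  -- primitive based at `R²`. The cutoff vanishes for squared radii above `R² - 1/(n+1)`, hence so
  -- does `P`, and the potential is compactly supported in the open ball.
  have hcut : ∀ n : ℕ, ∫ y in Ω, radialCut R n (‖y - x‖ ^ 2) * (G (‖y - x‖ ^ 2) * ⟪b y, y - x⟫)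
      = 0 := by
    intro n
    set H : ℝ → ℝ := fun s => G s * radialCut R n s with hH
    have hHc : Continuous H := hG.mul (continuous_radialCut R n)
    set P : ℝ → ℝ := fun s => ∫ t in (R ^ 2)..s, H t / 2 with hP
    have hPd : ∀ s, HasDerivAt P (H s / 2) s := fun s =>
      intervalIntegral.integral_hasDerivAt_right ((hHc.div_const 2).intervalIntegrable _ _)
        (hHc.div_const 2).aestronglyMeasurable.stronglyMeasurableAtFilter
        (hHc.div_const 2).continuousAt
    have hPc : ContDiff ℝ 1 P := by
      rw [contDiff_one_iff_deriv]
      refine ⟨fun s => (hPd s).differentiableAt, ?_⟩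
      rw [show deriv P = fun s => H s / 2 from funext fun s => (hPd s).deriv]
      exact hHc.div_const 2
    have hP0 : ∀ s, R ^ 2 - 1 / ((n : ℝ) + 1) ≤ s → P s = 0 := by
      intro s hs
      rw [hP]
      refine (intervalIntegral.integral_congr (g := fun _ => (0 : ℝ)) fun t ht => ?_).trans (by simp)
      have : R ^ 2 - 1 / ((n : ℝ) + 1) ≤ t := by
        have h1 : (0 : ℝ) < 1 / ((n : ℝ) + 1) := by positivity
        rcases le_total (R ^ 2) s with h2 | h2
        · rw [uIcc_of_le h2] at ht; linarith [ht.1]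
        · rw [uIcc_of_ge h2] at ht; linarith [ht.1]
      simp [hH, radialCut_eq_zero this]
    have hq : ∀ y, HasFDerivAt (fun y => P (‖y - x‖ ^ 2)) (H (‖y - x‖ ^ 2) • innerSL ℝ (y - x)) y := by
      intro y
      have h1 : HasFDerivAt (fun y : Vec 2 => ‖y - x‖ ^ 2) (2 • innerSL ℝ (y - x)) y :=
        (hasFDerivAt_comp_sub (f := fun y : Vec 2 => ‖y‖ ^ 2) x).2
          (hasStrictFDerivAt_norm_sq (y - x)).hasFDerivAt
      refine ((hPd _).comp_hasFDerivAt y h1).congr_fderiv ?_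
      ext v
      simp
      ring
    have hsupp : tsupport (fun y => P (‖y - x‖ ^ 2)) ⊆
        {y | ‖y - x‖ ^ 2 ≤ R ^ 2 - 1 / ((n : ℝ) + 1)} := by
      refine closure_minimal (fun y hy => ?_) (isClosed_le (by fun_prop) continuous_const)
      by_contra hlt
      exact hy (hP0 _ (not_le.1 hlt).le)
    have hsub : {y | ‖y - x‖ ^ 2 ≤ R ^ 2 - 1 / ((n : ℝ) + 1)} ⊆ Metric.ball x R := by
      intro y hy
      rw [mem_ball_iff_norm]
      have h1 : (0 : ℝ) < 1 / ((n : ℝ) + 1) := by positivity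
      refine lt_of_pow_lt_pow_left₀ 2 hR0 ?_
      have : ‖y - x‖ ^ 2 ≤ R ^ 2 - 1 / ((n : ℝ) + 1) := hy
      linarith
    have hC1c : IsC1c Ω (fun y => P (‖y - x‖ ^ 2)) := by
      refine ⟨hPc.comp ((contDiff_norm_sq ℝ).comp (contDiff_id.sub contDiff_const)), ?_,
        hsupp.trans (hsub.trans hR)⟩
      exact (isCompact_closedBall x R).of_isClosed_subset (isClosed_tsupport _)
        (hsupp.trans (hsub.trans Metric.ball_subset_closedBall))
    rw [← h _ hC1c]
    refine integral_congr_ae (Filter.Eventually.of_forall fun y => ?_)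
    simp only [inner_gradient_eq, (hq y).fderiv, hH]
    rw [real_inner_comm]
    simp only [smul_apply, innerSL_apply_apply, smul_eq_mul]
    ring
  have hint : Integrable (fun y => G (‖y - x‖ ^ 2) * ⟪b y, y - x⟫) (volume.restrict Ω) := by
    have h1 : Integrable (fun y => (G (‖y - x‖ ^ 2) * ‖y - x‖) * ‖b y‖) (volume.restrict Ω) :=
      IntegrableOn.continuous_mul hΩ hΩm hb.norm (by fun_prop)
    refine h1.mono ((Continuous.aestronglyMeasurable (by fun_prop)).mul
      (hb.aestronglyMeasurable.inner (Continuous.aestronglyMeasurable (by fun_prop))))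
      (Filter.Eventually.of_forall fun y => ?_)
    rw [norm_mul, norm_mul, norm_mul, norm_norm, norm_norm, mul_assoc]
    gcongr
    rw [mul_comm]
    exact norm_inner_le_norm _ _
  -- The cutoffs tend pointwise to the indicator of the open ball and are at most `1`.
  have hlim : Tendsto (fun n : ℕ => ∫ y in Ω, radialCut R n (‖y - x‖ ^ 2) *
      (G (‖y - x‖ ^ 2) * ⟪b y, y - x⟫)) atTop (𝓝 (∫ y in Ω, (Metric.ball x R).indicator
        (fun y => G (‖y - x‖ ^ 2) * ⟪b y, y - x⟫) y)) := by
    refine tendsto_integral_of_dominated_convergence _ (fun n => ?_) hint.norm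
      (fun n => Filter.Eventually.of_forall fun y => ?_) (Filter.Eventually.of_forall fun y => ?_)
    · exact (((continuous_radialCut R n).comp (by fun_prop)).aestronglyMeasurable).mul
        hint.aestronglyMeasurable
    · rw [norm_mul, Real.norm_of_nonneg (radialCut_nonneg _ _ _)]
      exact mul_le_of_le_one_left (norm_nonneg _) (radialCut_le_one _ _ _)
    · by_cases hy : y ∈ Metric.ball x R
      · rw [indicator_of_mem hy]
        rw [mem_ball_iff_norm] at hy
        have := (tendsto_radialCut (R := R) (s := ‖y - x‖ ^ 2)
          (by gcongr)).mul_const (G (‖y - x‖ ^ 2) * ⟪b y, y - x⟫)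
        simpa using this
      · rw [indicator_of_notMem hy]
        rw [mem_ball_iff_norm, not_lt] at hy
        have h1 : R ^ 2 ≤ ‖y - x‖ ^ 2 := by gcongr
        refine tendsto_const_nhds.congr fun n => ?_
        have h2 : (0 : ℝ) < 1 / ((n : ℝ) + 1) := by positivity
        rw [radialCut_eq_zero (by linarith), zero_mul]
  exact tendsto_nhds_unique hlim (by simp only [hcut]; exact tendsto_const_nhds)

end MovingStokes

namespace MovingStokes

open scoped NNReal
open Filter (Tendsto atTop)

/-! ### Critical advecting fields in the plane -/

section Critical

variable {Ω : Set (Vec 2)} {b : Vec 2 → Vec 2} {u : Vec 2 → ℝ} {R δ ε : ℝ}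

theorem IsC1c.continuous_fderiv {d : ℕ} {Ω : Set (Vec d)} {u : Vec d → ℝ} (hu : IsC1c Ω u) :
    Continuous (fderiv ℝ u) := hu.1.continuous_fderiv (by simp)

theorem integrable_fderiv_apply (hb : Integrable b (volume.restrict Ω)) (hu : IsC1c Ω u) :
    Integrable (fun y => fderiv ℝ u y (b y)) (volume.restrict Ω) := by
  obtain ⟨C, hC⟩ := (hu.2.1.fderiv ℝ).exists_bound_of_continuous hu.continuous_fderiv
  refine (hb.norm.const_mul C).mono' ?_ (Filter.Eventually.of_forall fun y =>
    ((fderiv ℝ u y).le_opNorm _).trans (by gcongr; exact hC y))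
  exact (isBoundedBilinearMap_apply (𝕜 := ℝ) (E := Vec 2) (F := ℝ)).continuous
    |>.comp_aestronglyMeasurable (hu.continuous_fderiv.aestronglyMeasurable.prodMk
      hb.aestronglyMeasurable)

/-- The potential of a convective derivative, after an integration by parts. -/
theorem logPot_eq (hb : Integrable b (volume.restrict Ω)) (hΩ : Ω ⊆ Metric.closedBall 0 R)
    (hΩm : MeasurableSet Ω) (hdiv : WeaklyDivFree Ω b) (hu : IsC1c Ω u) (hε : 0 < ε) (x : Vec 2) :
    logPot Ω ε (fun y => fderiv ℝ u y (b y)) x =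
      ∫ y in Ω, u y * ⟪logKerGrad ε (x - y), b y⟫ := by
  have hk : ContDiff ℝ 1 fun y : Vec 2 => logKer ε (x - y) :=
    (contDiff_logKer hε).comp (contDiff_const.sub contDiff_id)
  have hq : IsC1c Ω fun y => u y * logKer ε (x - y) :=
    ⟨hu.1.mul hk, hu.2.1.mul_right, (tsupport_mul_subset_left).trans hu.2.2⟩
  have hd : ∀ y, fderiv ℝ (fun y => u y * logKer ε (x - y)) y (b y) =
      logKer ε (x - y) * fderiv ℝ u y (b y) - u y * ⟪logKerGrad ε (x - y), b y⟫ := by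
    intro y
    have h1 : HasFDerivAt (fun y : Vec 2 => logKer ε (x - y)) (-innerSL ℝ (logKerGrad ε (x - y))) y := by
      refine ((hasFDerivAt_logKer hε (x - y)).comp y
        ((hasFDerivAt_id y).const_sub x)).congr_fderiv ?_
      ext v
      simp
    have h2 : fderiv ℝ (fun y => u y * logKer ε (x - y)) y = _ :=
      (((hu.1.differentiable (by simp)) y).hasFDerivAt.mul h1).fderiv
    rw [h2]
    simp only [add_apply, smul_apply, neg_apply, innerSL_apply_apply, smul_eq_mul]
    ring
  have h := hdiv _ hq
  simp only [inner_gradient_eq, hd] at h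
  have i1 : Integrable (fun y => logKer ε (x - y) * fderiv ℝ u y (b y)) (volume.restrict Ω) :=
    IntegrableOn.continuous_mul hΩ hΩm (integrable_fderiv_apply hb hu) hk.continuous
  have hg : Continuous fun y : Vec 2 => logKerGrad ε (x - y) :=
    (contDiff_logKerGrad hε).continuous.comp (continuous_const.sub continuous_id)
  have i2 : Integrable (fun y => u y * ⟪logKerGrad ε (x - y), b y⟫) (volume.restrict Ω) := by
    refine IntegrableOn.continuous_mul hΩ hΩm ?_ hu.1.continuous
    refine (hb.norm.const_mul ε⁻¹).mono' (hg.aestronglyMeasurable.inner hb.aestronglyMeasurable)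
      (Filter.Eventually.of_forall fun y => (norm_inner_le_norm _ _).trans ?_)
    gcongr
    exact norm_logKerGrad_le hε _
  rw [integral_sub i1 i2, sub_eq_zero] at h
  rw [← h, logPot]
  simp only [mul_comm]

theorem sq_div_le_one (hε : 0 < ε) (r : ℝ) : (r ^ 2 + ε ^ 2)⁻¹ * r * r ≤ 1 := by
  rw [mul_assoc, inv_mul_le_iff₀ (by positivity)]
  nlinarith [sq_nonneg ε]

/-- A pointwise bound: the function minus its value at one point of each small circle is bounded by
the integral of its derivative over the circle. -/
theorem abs_sub_mul_inner_le (hu : ContDiff ℝ 1 u) (hε : 0 < ε) {x y z w : Vec 2}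
    (hz : ‖z - x‖ = ‖y - x‖) : |(u y - u z) * ((‖y - x‖ ^ 2 + ε ^ 2)⁻¹ * ⟪w, y - x⟫)| ≤
      ‖w‖ * ∫ θ in Ioc (-Real.pi) Real.pi, ‖fderiv ℝ u (x + rot θ (y - x))‖ := by
  have h1 := abs_sub_le_integral_circle hu x hz.symm
  rw [add_sub_cancel, add_sub_cancel, abs_sub_comm] at h1
  set I := ∫ θ in Ioc (-Real.pi) Real.pi, ‖fderiv ℝ u (x + rot θ (y - x))‖
  have hI : 0 ≤ I := integral_nonneg fun θ => norm_nonneg _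
  have hk : 0 < (‖y - x‖ ^ 2 + ε ^ 2)⁻¹ := by positivity
  rw [abs_mul, abs_mul, abs_of_pos hk]
  calc |u y - u z| * ((‖y - x‖ ^ 2 + ε ^ 2)⁻¹ * |⟪w, y - x⟫|)
      ≤ (‖y - x‖ * I) * ((‖y - x‖ ^ 2 + ε ^ 2)⁻¹ * (‖w‖ * ‖y - x‖)) := by
        gcongr
        exact abs_real_inner_le_norm _ _
    _ = ((‖y - x‖ ^ 2 + ε ^ 2)⁻¹ * ‖y - x‖ * ‖y - x‖) * (‖w‖ * I) := by ring
    _ ≤ ‖w‖ * I := mul_le_of_le_one_left (by positivity) (sq_div_le_one hε _)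

theorem measurePreserving_rot_sub (x : Vec 2) (θ : ℝ) :
    MeasurePreserving (fun y : Vec 2 => x + rot θ (y - x)) volume volume :=
  (measurePreserving_add_left volume x).comp
    ((rot θ).measurePreserving.comp (measurePreserving_sub_right volume x))

theorem measurableEmbedding_rot_sub (x : Vec 2) (θ : ℝ) :
    MeasurableEmbedding (fun y : Vec 2 => x + rot θ (y - x)) :=
  (measurableEmbedding_addLeft x).comp
    ((rot θ).toHomeomorph.measurableEmbedding.comp (Homeomorph.subRight x).measurableEmbedding)

/-- Swap the integrals: for a fixed angle, rotation about `x` preserves Lebesgue measure, so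
Cauchy–Schwarz gives `B * U`; the angles contribute the factor `2π`. -/
theorem integral_mul_integral_circle_le (hbm : MemLp b 2 (volume.restrict Ω))
    (hbi : Integrable b (volume.restrict Ω)) (hu : IsC1c Ω u) (x : Vec 2) {B U : ℝ}
    (hB0 : 0 ≤ B) (hU0 : 0 ≤ U) (hB : ∫ y in Ω, ‖b y‖ ^ 2 ≤ B ^ 2)
    (hU : ∫ y, ‖fderiv ℝ u y‖ ^ 2 ≤ U ^ 2) :
    Integrable (fun y => ‖b y‖ * ∫ θ in Ioc (-Real.pi) Real.pi, ‖fderiv ℝ u (x + rot θ (y - x))‖)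
      (volume.restrict Ω) ∧
    ∫ y in Ω, ‖b y‖ * ∫ θ in Ioc (-Real.pi) Real.pi, ‖fderiv ℝ u (x + rot θ (y - x))‖ ≤
      2 * Real.pi * (B * U) := by
  obtain ⟨C, hC⟩ := (hu.2.1.fderiv ℝ).exists_bound_of_continuous hu.continuous_fderiv
  have hn : Continuous fun p : Vec 2 × ℝ => ‖fderiv ℝ u (x + rot p.2 (p.1 - x))‖ := by
    refine (hu.continuous_fderiv.comp (continuous_const.add ?_)).norm
    exact continuous_rot.comp (continuous_snd.prodMk (continuous_fst.sub continuous_const))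
  have hint : Integrable (Function.uncurry fun (y : Vec 2) (θ : ℝ) =>
      ‖b y‖ * ‖fderiv ℝ u (x + rot θ (y - x))‖)
      ((volume.restrict Ω).prod (volume.restrict (Ioc (-Real.pi) Real.pi))) := by
    refine (hbi.norm.mul_prod (ν := volume.restrict (Ioc (-Real.pi) Real.pi))
      (g := fun _ => C) (integrable_const C)).mono' ?_ (Filter.Eventually.of_forall fun p => ?_)
    · exact hbi.aestronglyMeasurable.norm.comp_fst.mul hn.aestronglyMeasurable
    · simp only [Function.uncurry]
      rw [norm_mul, norm_norm, norm_norm]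
      gcongr
      exact hC _
  have hfst := hint.integral_prod_left
  simp only [Function.uncurry, integral_const_mul] at hfst
  refine ⟨hfst, ?_⟩
  simp only [← integral_const_mul]
  rw [integral_integral_swap hint]
  have hθ : ∀ θ : ℝ, ∫ y in Ω, ‖b y‖ * ‖fderiv ℝ u (x + rot θ (y - x))‖ ≤ B * U := by
    intro θ
    have hmp := measurePreserving_rot_sub x θ
    have hm2 : MemLp (fun y : Vec 2 => ‖fderiv ℝ u (x + rot θ (y - x))‖) 2 volume :=
      ((hu.continuous_fderiv.norm.memLp_of_hasCompactSupport (p := 2) (μ := volume)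
        (hu.2.1.fderiv ℝ).norm)).comp_measurePreserving hmp
    refine (le_abs_self _).trans (integral_mul_le_of_sq hbm.norm (hm2.restrict Ω) hB0 hU0 hB ?_)
    refine (setIntegral_le_integral hm2.integrable_sq
      (Filter.Eventually.of_forall fun y => sq_nonneg _)).trans ?_
    rwa [hmp.integral_comp (measurableEmbedding_rot_sub x θ) fun y => ‖fderiv ℝ u y‖ ^ 2]
  have hright := hint.integral_prod_right
  simp only [Function.uncurry] at hright
  refine (integral_mono hright (integrable_const (B * U)) hθ).trans_eq ?_
  have hpi := Real.pi_pos
  simp only [integral_const, measureReal_restrict_apply_univ, Real.volume_real_Ioc, smul_eq_mul]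
  rw [max_eq_left (by linarith)]
  ring

/-- The potentials of the convective derivatives are uniformly bounded. -/
theorem abs_logPot_le (hΩo : IsOpen Ω) (hΩ : Ω ⊆ Metric.closedBall 0 R) (hδ : 0 < δ)
    (hole : ∀ x r, 0 < r → r < δ → Metric.sphere x r ⊆ Ω → Metric.closedBall x r ⊆ Ω)
    (hbm : MemLp b 2 (volume.restrict Ω)) (hdiv : WeaklyDivFree Ω b) (hu : IsC1c Ω u) {B U U₀ : ℝ}
    (hB0 : 0 ≤ B) (hU0 : 0 ≤ U) (hU₀0 : 0 ≤ U₀) (hB : ∫ y in Ω, ‖b y‖ ^ 2 ≤ B ^ 2)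
    (hU : ∫ y, ‖fderiv ℝ u y‖ ^ 2 ≤ U ^ 2) (hU₀ : ∫ y in Ω, u y ^ 2 ≤ U₀ ^ 2) (hε : 0 < ε)
    (x : Vec 2) : |logPot Ω ε (fun y => fderiv ℝ u y (b y)) x| ≤
      δ⁻¹ * (B * U₀) + 2 * Real.pi * (B * U) := by
  have hfin := isFiniteMeasure_restrict_of_subset hΩ
  have hbi : Integrable b (volume.restrict Ω) := hbm.integrable (by norm_num)
  have hu0 : ∀ {y}, y ∉ Ω → u y = 0 := fun hy =>
    image_eq_zero_of_notMem_tsupport fun h => hy (hu.2.2 h)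
  rw [logPot_eq hbi hΩ hΩo.measurableSet hdiv hu hε x]
  -- The largest radius, up to `δ`, for which the ball about `x` is inside `Ω`, so that
  -- orthogonality to radial fields applies. If `x` is outside `Ω` the ball is empty and nothing is
  -- subtracted.
  set ρ : ℝ := min δ (Metric.infDist x Ωᶜ) with hρ
  have hρ0 : 0 ≤ ρ := le_min hδ.le Metric.infDist_nonneg
  have hne : (Ωᶜ : Set (Vec 2)).Nonempty := by
    rw [nonempty_compl]
    rintro rfl
    obtain ⟨v, hv⟩ := NormedSpace.exists_lt_norm ℝ (Vec 2) R
    have := hΩ (mem_univ v)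
    rw [mem_closedBall_zero_iff] at this
    linarith
  have hball : Metric.ball x ρ ⊆ Ω := by
    intro y hy
    by_contra hyΩ
    have h1 := Metric.infDist_le_dist_of_mem (x := x) (show y ∈ Ωᶜ from hyΩ)
    rw [Metric.mem_ball, dist_comm] at hy
    exact absurd (hy.trans_le (min_le_right _ _)) (not_lt.2 h1)
  set e : Vec 2 := EuclideanSpace.single 0 1 with he
  have he1 : ‖e‖ = 1 := by simp [he]
  -- `G` carries the value of `u` at the point of direction `e` on the circle of squared radius `s`,
  -- times the radial kernel; the absolute value only makes `G` continuous for negative arguments.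
  set G : ℝ → ℝ := fun s => u (x + Real.sqrt s • e) * (|s| + ε ^ 2)⁻¹ with hG
  have hGc : Continuous G := by
    refine (hu.1.continuous.comp (by fun_prop)).mul (Continuous.inv₀ (by fun_prop) fun s => ?_)
    positivity
  have hrad := hdiv.integral_radial hΩ hΩo.measurableSet hbi hGc x hρ0 hball
  set S : Vec 2 → ℝ := fun y => u y * ⟪logKerGrad ε (x - y), b y⟫ with hS
  have hSy : ∀ y, S y = -(u y * ((‖y - x‖ ^ 2 + ε ^ 2)⁻¹ * ⟪b y, y - x⟫)) := by
    intro y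
    rw [hS]
    simp only [logKerGrad]
    rw [real_inner_smul_left, norm_sub_rev, ← neg_sub y x, inner_neg_left, real_inner_comm]
    ring
  set I : Vec 2 → ℝ := fun y =>
    ‖b y‖ * ∫ θ in Ioc (-Real.pi) Real.pi, ‖fderiv ℝ u (x + rot θ (y - x))‖ with hI
  have hI0 : ∀ y, 0 ≤ I y := fun y =>
    mul_nonneg (norm_nonneg _) (integral_nonneg fun θ => norm_nonneg _)
  obtain ⟨hIi, hIle⟩ := integral_mul_integral_circle_le hbm hbi hu x hB0 hU0 hB hU
  set Q : Vec 2 → ℝ := (Metric.ball x ρ).indicator fun y => G (‖y - x‖ ^ 2) * ⟪b y, y - x⟫ with hQ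
  -- Three regions: inside the `ρ`-ball a value of `u` on the same circle is subtracted; beyond
  -- radius `δ` the kernel is at most `δ⁻¹`; in between the circle leaves `Ω`, so `u` vanishes at
  -- one of its points.
  have hpt : ∀ y, |S y + Q y| ≤ δ⁻¹ * (‖b y‖ * |u y|) + I y := by
    intro y
    have hfirst : 0 ≤ δ⁻¹ * (‖b y‖ * |u y|) := by positivity
    by_cases hy : y ∈ Metric.ball x ρ
    · have h1 := abs_sub_mul_inner_le (w := b y) hu.1 hε (x := x) (y := y)
        (z := x + ‖y - x‖ • e) (by simp [norm_smul, he1])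
      have h2 : S y + Q y = -((u y - u (x + ‖y - x‖ • e)) *
          ((‖y - x‖ ^ 2 + ε ^ 2)⁻¹ * ⟪b y, y - x⟫)) := by
        rw [hSy, hQ, indicator_of_mem hy, hG]
        simp only [Real.sqrt_sq (norm_nonneg _), abs_pow, abs_norm]
        ring
      rw [h2, abs_neg]
      linarith
    · have hQ0 : Q y = 0 := indicator_of_notMem hy _
      rw [mem_ball_iff_norm, not_lt] at hy
      rw [hQ0, add_zero, hSy, abs_neg]
      rcases le_or_gt δ ‖y - x‖ with hδy | hδy
      · have hr : 0 < ‖y - x‖ := hδ.trans_le hδy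
        have hk : 0 < (‖y - x‖ ^ 2 + ε ^ 2)⁻¹ := by positivity
        have h3 : (‖y - x‖ ^ 2 + ε ^ 2)⁻¹ * ‖y - x‖ ≤ δ⁻¹ := by
          rw [inv_mul_le_iff₀ (by positivity), ← div_eq_mul_inv, le_div_iff₀ hδ]
          nlinarith [sq_nonneg ε]
        rw [abs_mul, abs_mul, abs_of_pos hk]
        calc |u y| * ((‖y - x‖ ^ 2 + ε ^ 2)⁻¹ * |⟪b y, y - x⟫|)
            ≤ |u y| * ((‖y - x‖ ^ 2 + ε ^ 2)⁻¹ * (‖b y‖ * ‖y - x‖)) := by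
              gcongr
              exact abs_real_inner_le_norm _ _
          _ = ((‖y - x‖ ^ 2 + ε ^ 2)⁻¹ * ‖y - x‖) * (‖b y‖ * |u y|) := by ring
          _ ≤ δ⁻¹ * (‖b y‖ * |u y|) := by gcongr
          _ ≤ _ := le_add_of_nonneg_right (hI0 y)
      · rcases (norm_nonneg (y - x)).eq_or_lt with h0 | h0
        · rw [norm_eq_zero.1 h0.symm]
          simp only [inner_zero_right, mul_zero, abs_zero]
          exact add_nonneg hfirst (hI0 y)
        have hdist : Metric.infDist x Ωᶜ ≤ ‖y - x‖ := by
          rcases min_le_iff.1 hy with h | h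
          · exact absurd h (not_le.2 hδy)
          · exact h
        obtain ⟨w, hw, hwd⟩ := hΩo.isClosed_compl.exists_infDist_eq_dist hne x
        -- If the circle were inside `Ω`, the hole condition would put the closed disc inside `Ω`,
        -- but this disc contains the nearest point of the complement.
        have hnot : ¬ Metric.sphere x ‖y - x‖ ⊆ Ω := by
          intro hsub
          refine hw (hole x _ h0 hδy hsub ?_)
          rw [Metric.mem_closedBall, dist_comm, ← hwd]
          exact hdist
        obtain ⟨z, hz, hzΩ⟩ := not_subset.1 hnot
        rw [mem_sphere_iff_norm] at hz
        have h1 := abs_sub_mul_inner_le (w := b y) hu.1 hε hz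
        rw [hu0 hzΩ, sub_zero] at h1
        linarith
  have hQi : Integrable Q (volume.restrict Ω) := by
    refine Integrable.indicator ?_ Metric.isOpen_ball.measurableSet
    refine IntegrableOn.continuous_mul hΩ hΩo.measurableSet ?_ (hGc.comp (by fun_prop))
    have h1 : Integrable (fun y => ‖y - x‖ * ‖b y‖) (volume.restrict Ω) :=
      IntegrableOn.continuous_mul hΩ hΩo.measurableSet hbi.norm (by fun_prop)
    refine h1.mono' (hbi.aestronglyMeasurable.inner
      (Continuous.aestronglyMeasurable (by fun_prop))) (Filter.Eventually.of_forall fun y => ?_)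
    rw [mul_comm]
    exact norm_inner_le_norm _ _
  have hSi : Integrable S (volume.restrict Ω) := by
    refine IntegrableOn.continuous_mul hΩ hΩo.measurableSet ?_ hu.1.continuous
    refine (hbi.norm.const_mul ε⁻¹).mono' (((contDiff_logKerGrad hε).continuous.comp
      (continuous_const.sub continuous_id)).aestronglyMeasurable.inner hbi.aestronglyMeasurable)
      (Filter.Eventually.of_forall fun y => (norm_inner_le_norm _ _).trans ?_)
    gcongr
    exact norm_logKerGrad_le hε _
  have hum : MemLp (fun y => |u y|) 2 (volume.restrict Ω) :=
    (hu.1.continuous.memLp_of_hasCompactSupport hu.2.1).abs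
  have hbu : Integrable (fun y => ‖b y‖ * |u y|) (volume.restrict Ω) := hbm.norm.integrable_mul hum
  -- The radial field `Q` has integral zero, so it may be added to the integrand for free.
  have hsum : ∫ y in Ω, S y = ∫ y in Ω, (S y + Q y) := by
    rw [integral_add hSi hQi, hrad, add_zero]
  rw [hsum, ← Real.norm_eq_abs]
  refine (norm_integral_le_of_norm_le ((hbu.const_mul δ⁻¹).add hIi)
    (Filter.Eventually.of_forall hpt)).trans ?_
  rw [integral_add' (hbu.const_mul δ⁻¹) hIi, integral_const_mul]
  have h4 := (le_abs_self _).trans (integral_mul_le_of_sq hbm.norm hum hB0 hU₀0 hB (by simpa using hU₀))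
  gcongr

end Critical

end MovingStokes

namespace MovingStokes

open scoped NNReal
open Filter (Tendsto atTop)

/-! ### The critical estimate for vector fields, by components. -/

section Components

variable {d : ℕ} {Ω : Set (Vec d)} {φ : Vec d → Vec d}

theorem fderiv_component {f : Vec d → Vec d} {x : Vec d} (hf : DifferentiableAt ℝ f x) (i : Fin d)
    (v : Vec d) : fderiv ℝ (fun x => f x i) x v = fderiv ℝ f x v i := by
  have := ((EuclideanSpace.proj i : Vec d →L[ℝ] ℝ).hasFDerivAt.comp x hf.hasFDerivAt).fderiv
  rw [show (fun x => f x i) = (EuclideanSpace.proj i : Vec d →L[ℝ] ℝ) ∘ f from rfl, this]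
  rfl

theorem IsTest.isC1c_component (hφ : IsTest Ω φ) (i : Fin d) : IsC1c Ω fun x => φ x i := by
  refine ⟨(EuclideanSpace.proj i : Vec d →L[ℝ] ℝ).contDiff.comp (hφ.1.of_le (by simp)),
    hφ.2.1.comp_left (g := fun v : Vec d => v i) rfl, ?_⟩
  refine (closure_mono fun x hx => ?_).trans hφ.2.2
  contrapose! hx
  simp [Function.notMem_support.1 hx]

theorem IsTest.norm_fderiv_component_le (hφ : IsTest Ω φ) (i : Fin d) (x : Vec d) :
    ‖fderiv ℝ (fun x => φ x i) x‖ ≤ ‖jacobian φ x‖ := by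
  refine (ContinuousLinearMap.opNorm_le_bound _ (norm_nonneg _) fun v => ?_).trans
    (norm_fderiv_le_jacobian φ x)
  rw [fderiv_component (hφ.differentiable x)]
  exact (PiLp.norm_apply_le _ i).trans ((fderiv ℝ φ x).le_opNorm v)

theorem IsTest.integral_sq_jacobian (hφ : IsTest Ω φ) :
    ∫ x, ‖jacobian φ x‖ ^ 2 ≤ ‖hφ.toH10‖ ^ 2 := by
  have h1 : ∫ x, ‖jacobian φ x‖ ^ 2 = ‖jacH hφ.toH10‖ ^ 2 := by
    rw [Lp_norm_sq, ← setIntegral_eq_integral_of_forall_compl_eq_zero (s := Ω)]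
    · refine integral_congr_ae ?_
      filter_upwards [hφ.coeFn_jacH] with x hx
      rw [hx]
    · intro x hx
      rw [jacobian_eq, hφ.fderiv_eq_zero hx]
      simp
  rw [h1, norm_sq_H10]
  linarith [sq_nonneg ‖fnH hφ.toH10‖]

theorem IsTest.integral_sq_fderiv_component (hφ : IsTest Ω φ) (i : Fin d) :
    ∫ x, ‖fderiv ℝ (fun x => φ x i) x‖ ^ 2 ≤ ‖hφ.toH10‖ ^ 2 := by
  refine le_trans (integral_mono_of_nonneg (Filter.Eventually.of_forall fun x => sq_nonneg _)
    (hφ.memLp_jacobian 2 volume).norm.integrable_sq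
    (Filter.Eventually.of_forall fun x => ?_)) hφ.integral_sq_jacobian
  exact pow_le_pow_left₀ (norm_nonneg _) (hφ.norm_fderiv_component_le i x) 2

theorem IsTest.integral_sq_component (hφ : IsTest Ω φ) (i : Fin d) :
    ∫ x in Ω, φ x i ^ 2 ≤ ‖hφ.toH10‖ ^ 2 := by
  have h1 : ∫ x in Ω, ‖φ x‖ ^ 2 = ‖fnH hφ.toH10‖ ^ 2 := by
    rw [Lp_norm_sq]
    refine integral_congr_ae ?_
    filter_upwards [hφ.coeFn_fnH] with x hx
    rw [hx]
  have h2 : ∫ x in Ω, φ x i ^ 2 ≤ ∫ x in Ω, ‖φ x‖ ^ 2 := by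
    refine integral_mono_of_nonneg (Filter.Eventually.of_forall fun x => sq_nonneg _)
      (hφ.memLp 2 _).norm.integrable_sq (Filter.Eventually.of_forall fun x => ?_)
    simp only []
    rw [← sq_abs, ← Real.norm_eq_abs]
    exact pow_le_pow_left₀ (norm_nonneg _) (PiLp.norm_apply_le _ i) 2
  rw [h1] at h2
  rw [norm_sq_H10]
  linarith [sq_nonneg ‖jacH hφ.toH10‖]

end Components

theorem integral_sq_le_of_eLpNorm {α F : Type*} [MeasurableSpace α] {μ : Measure α}
    [NormedAddCommGroup F] [InnerProductSpace ℝ F] {f : α → F} (hf : MemLp f 2 μ) {M : ℝ≥0}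
    (h : eLpNorm f 2 μ ≤ M) : ∫ x, ‖f x‖ ^ 2 ∂μ ≤ (M : ℝ) ^ 2 := by
  have h1 : ∫ x, ‖f x‖ ^ 2 ∂μ = ‖hf.toLp f‖ ^ 2 := by
    rw [Lp_norm_sq]
    refine integral_congr_ae ?_
    filter_upwards [hf.coeFn_toLp] with x hx
    rw [hx]
  rw [h1, Lp.norm_toLp]
  gcongr
  exact ENNReal.toReal_le_of_le_ofReal (NNReal.coe_nonneg M) (by simpa using h)

/-- Square integrable divergence free fields in the plane are advecting, uniformly over the
bounded open sets in which small circles bound discs. -/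
theorem exists_isAdvecting_critical (R : ℝ) {δ : ℝ} (hδ : 0 < δ) (M : ℝ≥0) :
    ∃ κ : ℝ, ∀ Ω : Set (Vec 2), IsOpen Ω → Ω ⊆ Metric.closedBall 0 R →
      (∀ x r, 0 < r → r < δ → Metric.sphere x r ⊆ Ω → Metric.closedBall x r ⊆ Ω) →
      ∀ b : Vec 2 → Vec 2, MemLp b 2 (volume.restrict Ω) → eLpNorm b 2 (volume.restrict Ω) ≤ M →
      WeaklyDivFree Ω b → IsAdvecting Ω b κ := by
  let χ : ContDiffBump (0 : Vec 2) := ⟨|R| + 1, |R| + 2, by positivity, by linarith⟩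
  set X := ∫ x, ‖fderiv ℝ χ x‖ ^ 2 with hX
  have hX0 : 0 ≤ X := integral_nonneg fun x => sq_nonneg _
  set c := ∫ z, logKerLap 1 z with hc
  have hc0 : 0 < c := integral_logKerLap_one_pos
  -- If `n` is the norm of `ψ`, the potential is at most `m * (M * n)` and the `L¹` norm at most `M
  -- * n`. The energy bound is then homogeneous of degree two in `M * n`, and `k` is the square root
  -- of its coefficient.
  set m := δ⁻¹ + 2 * Real.pi with hm
  have hpi := Real.pi_pos
  have hm0 : 0 ≤ m := by positivity
  set k := Real.sqrt (2 * (c * m) + 4 * m ^ 2 * X) with hk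
  -- The `2` counts the components; `c⁻¹` undoes the mass of the mollifier.
  refine ⟨2 * (c⁻¹ * (k * M)), fun Ω hΩo hΩ hole b hbm hbM hdiv => ⟨hbm, by positivity, ?_⟩⟩
  intro ψ φ hψ hφ
  have hfin := isFiniteMeasure_restrict_of_subset hΩ
  have hbi : Integrable b (volume.restrict Ω) := hbm.integrable (by norm_num)
  have hB : ∫ y in Ω, ‖b y‖ ^ 2 ≤ (M : ℝ) ^ 2 := integral_sq_le_of_eLpNorm hbm hbM
  have hcomp : ∀ i, |∫ y in Ω, fderiv ℝ (fun x => ψ x i) y (b y) * φ y i| ≤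
      c⁻¹ * (k * M) * ‖hψ.toH10‖ * ‖hφ.toH10‖ := by
    intro i
    have hu := hψ.isC1c_component i
    have hv := hφ.isC1c_component i
    set n := ‖hψ.toH10‖
    have hn : 0 ≤ n := norm_nonneg _
    have hpot : ∀ ε : ℝ, 0 < ε → ∀ x, |logPot Ω ε (fun y => fderiv ℝ (fun x => ψ x i) y (b y)) x| ≤
        m * (M * n) := fun ε hε x =>
      (abs_logPot_le hΩo hΩ hδ hole hbm hdiv hu (NNReal.coe_nonneg M) hn hn hB (hψ.integral_sq_fderiv_component i)
        (hψ.integral_sq_component i) hε x).trans_eq (by rw [hm]; ring)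
    have hF : ∫ y in Ω, |fderiv ℝ (fun x => ψ x i) y (b y)| ≤ M * n := by
      have hcf := hu.continuous_fderiv
      have hmf : MemLp (fun y => ‖fderiv ℝ (fun x => ψ x i) y‖) 2 volume :=
        hcf.norm.memLp_of_hasCompactSupport (hu.2.1.fderiv ℝ).norm
      have h1 := integral_mul_le_of_sq hbm.norm (hmf.restrict Ω) (NNReal.coe_nonneg M) hn hB
        ((setIntegral_le_integral hmf.integrable_sq (Filter.Eventually.of_forall fun y =>
          sq_nonneg _)).trans (hψ.integral_sq_fderiv_component i))
      refine le_trans (integral_mono (integrable_fderiv_apply hbi hu).abs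
        (hbm.norm.integrable_mul (hmf.restrict Ω)) fun y => ?_) ((le_abs_self _).trans h1)
      simp only [Pi.mul_apply]
      rw [mul_comm]
      exact (fderiv ℝ (fun x => ψ x i) y).le_opNorm (b y)
    have h := abs_integral_mul_le_of_logPot hΩ hΩo.measurableSet (integrable_fderiv_apply hbi hu)
      hpot hF (χ.contDiff (n := 1)) χ.hasCompactSupport
      (fun x => by rw [abs_of_nonneg χ.nonneg]; exact χ.le_one)
      (fun x hx => χ.one_of_mem_closedBall ((Metric.closedBall_subset_closedBall
        ((le_abs_self R).trans (by simp [χ]))) (hΩ hx)))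
      hv.1 hv.2.1 hv.2.2 (norm_nonneg _) (hφ.integral_sq_fderiv_component i)
    have e : 2 * (c * (m * (M * n)) * (M * n)) + 4 * (m * (M * n)) ^ 2 * X =
        (2 * (c * m) + 4 * m ^ 2 * X) * (M * n) ^ 2 := by ring
    rw [← hX, ← hc, e, Real.sqrt_mul (by positivity), Real.sqrt_sq (by positivity), ← hk] at h
    exact ((le_inv_mul_iff₀ hc0).2 h).trans_eq (by ring)
  have hint : ∀ i ∈ (Finset.univ : Finset (Fin 2)), Integrable
      (fun y => fderiv ℝ (fun x => ψ x i) y (b y) * φ y i) (volume.restrict Ω) := fun i _ => by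
    simp only [mul_comm _ (φ _ i)]
    exact IntegrableOn.continuous_mul hΩ hΩo.measurableSet
      (integrable_fderiv_apply hbi (hψ.isC1c_component i)) (hφ.isC1c_component i).1.continuous
  have hsum : ∫ y in Ω, ⟪matVec (jacobian ψ y) (b y), φ y⟫ =
      ∑ i, ∫ y in Ω, fderiv ℝ (fun x => ψ x i) y (b y) * φ y i := by
    rw [← integral_finsetSum _ hint]
    refine integral_congr_ae (Filter.Eventually.of_forall fun y => ?_)
    simp only [jacobian_eq, matVec_matOfCLM, PiLp.inner_apply, RCLike.inner_apply, conj_trivial]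
    refine Finset.sum_congr rfl fun i _ => ?_
    rw [fderiv_component (hψ.differentiable y), mul_comm]
  rw [hsum]
  refine (Finset.abs_sum_le_sum_abs _ _).trans ((Finset.sum_le_sum fun i _ => hcomp i).trans_eq ?_)
  simp
  ring

end MovingStokes

namespace MovingStokes

open scoped NNReal
open Filter (Tendsto atTop)

variable {d : ℕ}

/-! ### Small spheres in the images of a smooth domain -/

/-- In the images of a bounded `C²` domain under homeomorphisms with uniformly Lipschitz inverses,
small spheres bound balls. -/
theorem HasC2Boundary.exists_closedBall_subset [Nontrivial (Vec d)] {Ω₀ : Set (Vec d)}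
    (hC : HasC2Boundary Ω₀) (hb : Bornology.IsBounded Ω₀) (ho : IsOpen Ω₀) (L : ℝ≥0) :
    ∃ δ : ℝ, 0 < δ ∧ ∀ h : Vec d ≃ₜ Vec d, AntilipschitzWith L h →
      ∀ x r, 0 < r → r < δ → Metric.sphere x r ⊆ h '' Ω₀ → Metric.closedBall x r ⊆ h '' Ω₀ := by
  have hfr : IsCompact (frontier Ω₀) :=
    Metric.isCompact_of_isClosed_isBounded isClosed_frontier
      (hb.closure.subset frontier_subset_closure)
  choose! U hUo hxU ρ hρ hρ' hΩU using hC
  have hopen : ∀ i : frontier Ω₀, IsOpen {y | y ∈ U i ∧ fderiv ℝ (ρ i) y ≠ 0} := fun i =>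
    ((hρ i i.2).continuousOn_fderiv_of_isOpen (hUo i i.2) (by norm_num)).isOpen_inter_preimage
      (hUo i i.2) isOpen_compl_singleton
  -- Lebesgue number: a set of diameter below `η` that meets the boundary lies in a single chart,
  -- where moreover the gradient of the defining function does not vanish. The choice of `δ` makes
  -- the preimage of a small ball that small for every admissible `h`.
  obtain ⟨η, hη, hleb⟩ := lebesgue_number_lemma_of_metric hfr hopen fun x hx =>
    mem_iUnion.2 ⟨⟨x, hx⟩, hxU x hx, hρ' x hx⟩
  refine ⟨η / (2 * (L + 1)), by positivity, fun h hL x r hr hrδ hsph => ?_⟩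
  set A := h.symm '' Metric.closedBall x r with hA
  have hAmem : ∀ {a}, a ∈ A ↔ dist (h a) x ≤ r := by
    intro a
    rw [hA, Homeomorph.image_symm]
    rfl
  have hAdist : ∀ a ∈ A, ∀ a' ∈ A, dist a a' < η := by
    intro a ha a' ha'
    have h1 := hL.le_mul_dist a a'
    have h2 : dist (h a) (h a') ≤ 2 * r := by
      have := dist_triangle_right (h a) (h a') x
      linarith [hAmem.1 ha, hAmem.1 ha']
    have h3 : r * (2 * (L + 1)) < η := (lt_div_iff₀ (by positivity)).1 hrδ
    nlinarith [NNReal.coe_nonneg L]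
  have hAc : IsCompact A := (isCompact_closedBall x r).image h.symm.continuous
  have hAp : IsPreconnected A :=
    (convex_closedBall x r).isPreconnected.image _ h.symm.continuous.continuousOn
  suffices hsub : A ⊆ Ω₀ by
    intro y hy
    exact ⟨h.symm y, hsub ⟨y, hy, rfl⟩, h.apply_symm_apply y⟩
  have hne : (A ∩ Ω₀).Nonempty := by
    obtain ⟨z, hz⟩ := (NormedSpace.sphere_nonempty (x := x) (r := r)).2 hr.le
    obtain ⟨a, ha, rfl⟩ := hsph hz
    exact ⟨a, hAmem.2 (Metric.mem_sphere.1 hz).le, ha⟩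
  -- The preimage `A` is connected and meets `Ω₀`; if it is not contained in `Ω₀`, it contains a
  -- boundary point and so lies in one chart.
  by_contra hnot
  have hcl : ¬ closure Ω₀ ∩ A ⊆ Ω₀ := fun hc =>
    hnot (hAp.subset_of_closure_inter_subset ho hne hc)
  obtain ⟨p, ⟨hpc, hpA⟩, hpΩ⟩ := not_subset.1 hcl
  have hpf : p ∈ frontier Ω₀ := by rw [ho.frontier_eq]; exact ⟨hpc, hpΩ⟩
  obtain ⟨⟨i, hi⟩, hball⟩ := hleb p hpf
  have hAU : A ⊆ {y | y ∈ U i ∧ fderiv ℝ (ρ i) y ≠ 0} := fun a ha => hball (hAdist a ha p hpA)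
  have hmemΩ : ∀ a ∈ A, (a ∈ Ω₀ ↔ ρ i a < 0) := by
    intro a ha
    have haU : a ∈ U i := (hAU ha).1
    have : a ∈ Ω₀ ∩ U i ↔ a ∈ {y | y ∈ U i ∧ ρ i y < 0} := by rw [hΩU i hi]
    simpa [haU] using this
  -- The maximum of the defining function over `A` is nonnegative, so `q` is outside `Ω₀` and cannot
  -- lie over the sphere. It is therefore an interior maximum, where the gradient would have to
  -- vanish.
  obtain ⟨q, hqA, hqmax⟩ := hAc.exists_isMaxOn ⟨p, hpA⟩
    ((hρ i hi).continuousOn.mono fun a ha => (hAU ha).1)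
  have hq0 : 0 ≤ ρ i q := (not_lt.1 fun hlt => hpΩ ((hmemΩ p hpA).2 hlt)).trans (hqmax hpA)
  have hqΩ : q ∉ Ω₀ := fun hq => absurd ((hmemΩ q hqA).1 hq) (not_lt.2 hq0)
  have hqlt : dist (h q) x < r := by
    refine lt_of_le_of_ne (hAmem.1 hqA) fun heq => hqΩ ?_
    obtain ⟨a, ha, hae⟩ := hsph (Metric.mem_sphere.2 heq)
    rwa [← h.injective hae]
  have hnhds : A ∈ 𝓝 q := by
    have : h ⁻¹' Metric.ball x r ∈ 𝓝 q :=
      (Metric.isOpen_ball.preimage h.continuous).mem_nhds hqlt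
    exact Filter.mem_of_superset this fun a ha => hAmem.2 (le_of_lt ha)
  exact (hAU hqA).2 (hqmax.isLocalMax hnhds).fderiv_eq_zero

/-! ### The flow as a family of homeomorphisms -/

section Transfer

variable {W : ℝ → Vec d → Vec d} {M L N : ℝ≥0} {T : ℝ} {Φ : ℝ → Vec d → Vec d} {t : ℝ}
  {Ω₀ : Set (Vec d)}

/-- The flow map at a fixed time. -/
noncomputable def IsFlow.homeo (hW : IsRegularField W M L N) (hΦ : IsFlow W T Φ)
    (ht : t ∈ Icc 0 T) : Vec d ≃ₜ Vec d where
  toFun := Φ t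
  invFun := Function.invFun (Φ t)
  left_inv := hΦ.invFun_apply hW ht
  right_inv := hΦ.apply_invFun hW ht
  continuous_toFun := (hΦ.lipschitz hW ht).continuous
  continuous_invFun := (hΦ.lipschitz_invFun hW ht).continuous

theorem IsFlow.isOpen_image (hW : IsRegularField W M L N) (hΦ : IsFlow W T Φ) (ht : t ∈ Icc 0 T)
    (ho : IsOpen Ω₀) : IsOpen (Φ t '' Ω₀) := (hΦ.homeo hW ht).isOpenMap _ ho

theorem IsFlow.image_subset_closedBall (hW : IsRegularField W M L N) (hΦ : IsFlow W T Φ)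
    (hT : 0 ≤ T) (hb : Bornology.IsBounded Ω₀) :
    ∃ R : ℝ, ∀ t ∈ Icc 0 T, Φ t '' Ω₀ ⊆ Metric.closedBall 0 R := by
  obtain ⟨R, hR⟩ := hb.subset_closedBall 0
  refine ⟨R + M * T, fun t ht => ?_⟩
  rintro _ ⟨x, hx, rfl⟩
  have h0 : (0 : ℝ) ∈ Icc 0 T := ⟨le_rfl, hT⟩
  have h1 := hΦ.dist_time_le hW h0 ht x
  rw [(hΦ x).1, sub_zero, abs_of_nonneg ht.1] at h1
  have h2 := hR hx
  rw [mem_closedBall_zero_iff] at h2 ⊢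
  have h3 := norm_le_norm_add_norm_sub' (Φ t x) x
  have h4 : (M : ℝ) * t ≤ M * T := by gcongr; exact ht.2
  rw [norm_sub_rev] at h3
  have h5 := norm_sub_rev (Φ t x) x
  linarith

theorem IsFlow.hasFDerivAt (hW : IsRegularField W M L N) (hΦ : IsFlow W T Φ) (ht : t ∈ Icc 0 T)
    (x : Vec d) : HasFDerivAt (Φ t) (fderiv ℝ (Φ t) x) x :=
  (hΦ.exists_variational hW (ht.1.trans ht.2) x).1 t ht

/-- Almost everywhere statements are transported by the flow. -/
theorem IsFlow.ae_image (hW : IsRegularField W M L N) (hΦ : IsFlow W T Φ) (ht : t ∈ Icc 0 T)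
    (ho : MeasurableSet Ω₀) {P : Vec d → Prop} (h : ∀ᵐ x ∂volume.restrict Ω₀, P x) :
    ∀ᵐ y ∂volume.restrict (Φ t '' Ω₀), P (Function.invFun (Φ t) y) := by
  have hm : MeasurableSet (Φ t '' Ω₀) :=
    (hΦ.homeo hW ht).measurableEmbedding.measurableSet_image' ho
  rw [ae_restrict_iff' ho] at h
  rw [ae_restrict_iff' hm, ae_iff]
  refine measure_mono_null (t := Φ t '' {x | ¬(x ∈ Ω₀ → P x)}) ?_
    (addHaar_image_eq_zero_of_differentiableOn_of_addHaar_eq_zero volume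
      (fun x _ => (hΦ.hasFDerivAt hW ht x).differentiableAt.differentiableWithinAt) (ae_iff.1 h))
  intro y hy
  refine ⟨Function.invFun (Φ t) y, fun hi => hy fun hyΩ => hi ?_, hΦ.apply_invFun hW ht y⟩
  obtain ⟨x, hx, rfl⟩ := hyΩ
  rwa [hΦ.invFun_apply hW ht]

theorem exists_abs_det_le (d : ℕ) (l : ℝ≥0) :
    ∃ C : ℝ≥0, ∀ A : Vec d →L[ℝ] Vec d, ‖A‖ ≤ l → |A.det| ≤ C := by
  obtain ⟨C, hC⟩ := (isCompact_closedBall (0 : Vec d →L[ℝ] Vec d) l).exists_bound_of_continuousOn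
    (f := fun A : Vec d →L[ℝ] Vec d => A.det) ContinuousLinearMap.continuous_det.continuousOn
  exact ⟨C.toNNReal, fun A hA => (hC A (by simpa using hA)).trans (Real.le_coe_toNNReal C)⟩

/-- The change of variables inequality for the flow, with a constant independent of time. -/
theorem IsFlow.exists_lintegral_image_le (hW : IsRegularField W M L N) (hΦ : IsFlow W T Φ)
    (ho : MeasurableSet Ω₀) : ∃ C : ℝ≥0, ∀ t ∈ Icc 0 T, ∀ g : Vec d → ℝ≥0∞,
      ∫⁻ y in Φ t '' Ω₀, g y ≤ C * ∫⁻ x in Ω₀, g (Φ t x) := by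
  obtain ⟨C, hC⟩ := exists_abs_det_le d (flowLip L T)
  refine ⟨C, fun t ht g => ?_⟩
  rw [lintegral_image_eq_lintegral_abs_det_fderiv_mul volume ho
    (fun x _ => (hΦ.hasFDerivAt hW ht x).hasFDerivWithinAt) (hΦ.bijective hW ht).1.injOn]
  rw [← lintegral_const_mul' _ _ ENNReal.coe_ne_top]
  refine lintegral_mono fun x => ?_
  gcongr
  rw [← ENNReal.ofReal_coe_nnreal]
  exact ENNReal.ofReal_le_ofReal (hC _ (hΦ.norm_fderiv_le hW ht x))

end Transfer

end MovingStokes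

namespace MovingStokes

open scoped NNReal
open Filter (Tendsto atTop)

variable {d : ℕ}

/-! ### Measurability of maps into `L²` -/

theorem measurable_of_edist {α β : Type*} [MeasurableSpace α] [PseudoMetricSpace β]
    [SecondCountableTopology β] [MeasurableSpace β] [BorelSpace β] {f : α → β}
    (h : ∀ c, Measurable fun a => edist (f a) c) : Measurable f := by
  refine measurable_of_isOpen fun s hs => ?_
  obtain ⟨I, hI, hIs⟩ := TopologicalSpace.isOpen_iUnion_countable
    (fun q : {q : β × ℝ // Metric.ball q.1 q.2 ⊆ s} => Metric.ball q.1.1 q.1.2)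
    fun _ => Metric.isOpen_ball
  have hs' : s = ⋃ q : {q : β × ℝ // Metric.ball q.1 q.2 ⊆ s}, Metric.ball q.1.1 q.1.2 := by
    refine Subset.antisymm (fun x hx => ?_) (iUnion_subset fun q => q.2)
    obtain ⟨ε, hε, hx'⟩ := Metric.isOpen_iff.1 hs x hx
    exact mem_iUnion.2 ⟨⟨(x, ε), hx'⟩, Metric.mem_ball_self hε⟩
  rw [hs', ← hIs, preimage_iUnion₂]
  refine MeasurableSet.biUnion hI fun q _ => ?_
  have : f ⁻¹' Metric.ball q.1.1 q.1.2 = {a | edist (f a) q.1.1 < ENNReal.ofReal q.1.2} := by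
    ext a
    rw [← Metric.eball_ofReal]
    rfl
  rw [this]
  exact measurableSet_lt (h _) measurable_const

section Lp

variable {α E G : Type*} [MeasurableSpace α] {μ : Measure α}
  [NormedAddCommGroup E] [NormedAddCommGroup G]

theorem measurable_eLpNorm_right [SFinite μ] {F : ℝ → α → E}
    (hF : StronglyMeasurable (Function.uncurry F)) : Measurable fun t => eLpNorm (F t) 2 μ := by
  simp only [eLpNorm_eq_lintegral_rpow_enorm_toReal two_ne_zero ENNReal.ofNat_ne_top]
  refine Measurable.pow_const ?_ _
  exact Measurable.lintegral_prod_right (f := fun t x => ‖F t x‖ₑ ^ (2 : ℝ≥0∞).toReal)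
    (hF.enorm.pow_const _)

instance secondCountable_Lp [IsSeparable μ] [TopologicalSpace.SeparableSpace E] :
    SecondCountableTopology (Lp E 2 μ) :=
  have : Fact ((2 : ℝ≥0∞) ≠ ⊤) := ⟨by simp⟩
  Lp.SecondCountableTopology

/-- A family of `L²` functions with a jointly measurable representative is measurable. -/
theorem stronglyMeasurable_toLp [IsSeparable μ] [SFinite μ] [TopologicalSpace.SeparableSpace E]
    {F : ℝ → α → E} (hF : StronglyMeasurable (Function.uncurry F)) (hmem : ∀ t, MemLp (F t) 2 μ) :
    StronglyMeasurable fun t => (hmem t).toLp (F t) := by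
  borelize ↥(Lp E 2 μ)
  refine (measurable_of_edist fun c => ?_).stronglyMeasurable
  have : ∀ t, edist ((hmem t).toLp (F t)) c = eLpNorm (F t - ⇑c) 2 μ := by
    intro t
    rw [Lp.edist_def]
    refine eLpNorm_congr_ae ?_
    filter_upwards [(hmem t).coeFn_toLp] with x hx
    simp [hx]
  simp only [this]
  exact measurable_eLpNorm_right (F := fun t => F t - ⇑c)
    (hF.sub ((Lp.stronglyMeasurable c).comp_measurable measurable_snd))

/-- A family of uniformly bounded additive operators preserving joint measurability maps
measurable families of `L²` functions to measurable families. -/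
theorem aestronglyMeasurable_of_operator {β : Type*} [MeasurableSpace β] {ν : Measure β}
    [IsSeparable μ] [SFinite μ] [IsSeparable ν] [TopologicalSpace.SeparableSpace E]
    [TopologicalSpace.SeparableSpace G] {τ : Measure ℝ} {K : ℝ≥0}
    (P : ℝ → (β → E) → α → G) (hsub : ∀ t f g, P t (f - g) = P t f - P t g)
    (hm : ∀ g, StronglyMeasurable g → StronglyMeasurable (Function.uncurry fun t y => P t g y))
    (hb : ∀ t g, StronglyMeasurable g → eLpNorm (P t g) 2 μ ≤ K * eLpNorm g 2 ν)
    {g₀ : ℝ → Lp E 2 ν} (hg₀ : AEStronglyMeasurable g₀ τ) {e : ℝ → Lp G 2 μ}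
    (he : ∀ᵐ t ∂τ, e t =ᵐ[μ] P t (g₀ t)) : AEStronglyMeasurable e τ := by
  borelize ↥(Lp G 2 μ)
  borelize ↥(Lp E 2 ν)
  have hPt : ∀ t g, StronglyMeasurable g → StronglyMeasurable (P t g) := fun t g hg =>
    (hm g hg).comp_measurable measurable_prodMk_left
  have hmem : ∀ t (g : Lp E 2 ν), MemLp (P t g) 2 μ := fun t g =>
    ⟨(hPt t g (Lp.stronglyMeasurable g)).aestronglyMeasurable,
      (hb t g (Lp.stronglyMeasurable g)).trans_lt
        (ENNReal.mul_lt_top ENNReal.coe_lt_top (Lp.eLpNorm_lt_top g))⟩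
  set Q : Lp E 2 ν → ℝ → Lp G 2 μ := fun g t => (hmem t g).toLp (P t g) with hQ
  have hc : ∀ t, Continuous fun g => Q g t := by
    intro t
    refine LipschitzWith.continuous (K := K) fun f g => ?_
    rw [Lp.edist_def, Lp.edist_def]
    refine le_trans (le_of_eq ?_)
      (hb t (f - g) ((Lp.stronglyMeasurable f).sub (Lp.stronglyMeasurable g)))
    refine eLpNorm_congr_ae ?_
    filter_upwards [(hmem t f).coeFn_toLp, (hmem t g).coeFn_toLp] with x h1 h2
    simp only [hQ, Pi.sub_apply, h1, h2, hsub]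
  have hs : ∀ g, StronglyMeasurable (Q g) := fun g =>
    stronglyMeasurable_toLp (hm g (Lp.stronglyMeasurable g)) fun t => hmem t g
  -- Carathéodory: `Q` is continuous in the function and measurable in time, hence jointly
  -- measurable, and can be composed with `t ↦ (g₀ t, t)`.
  have hun : Measurable (Function.uncurry Q) :=
    measurable_uncurry_of_continuous_of_measurable hc fun g => (hs g).measurable
  have : AEMeasurable (fun t => Q (g₀ t) t) τ :=
    hun.comp_aemeasurable (hg₀.aemeasurable.prodMk aemeasurable_id)
  refine this.aestronglyMeasurable.congr ?_
  filter_upwards [he] with t ht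
  exact Lp.ext ((hmem t _).coeFn_toLp.trans ht.symm)

end Lp

end MovingStokes

namespace MovingStokes

open scoped NNReal
open Filter (Tendsto atTop)

variable {d : ℕ}

/-! ### Measurability in time of families transported by the flow -/

section Coefficients

variable {α E G : Type*} [MeasurableSpace α] {μ : Measure α} [NormedAddCommGroup E]
  [InnerProductSpace ℝ E] [NormedAddCommGroup G] [InnerProductSpace ℝ G]
  [TopologicalSpace.SeparableSpace E] [TopologicalSpace.SeparableSpace G]

theorem exists_aestronglyMeasurable_mul [IsSeparable μ] [SFinite μ] {τ : Measure ℝ}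
    {A : ℝ → α → E →L[ℝ] G} (hA : StronglyMeasurable (Function.uncurry A)) {B : ℝ≥0}
    (hB : ∀ t x, ‖A t x‖ ≤ B) {g : ℝ → Lp E 2 μ} (hg : AEStronglyMeasurable g τ) :
    ∃ m : ℝ → Lp G 2 μ, AEStronglyMeasurable m τ ∧ ∀ t, m t =ᵐ[μ] fun x => A t x (g t x) := by
  have hAt : ∀ t, StronglyMeasurable (A t) := fun t => hA.comp_measurable measurable_prodMk_left
  have hbd : ∀ t (g : α → E), eLpNorm (fun x => A t x (g x)) 2 μ ≤ B * eLpNorm g 2 μ := by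
    intro t g
    refine (eLpNorm_le_nnreal_smul_eLpNorm_of_ae_le_mul (c := B)
      (Filter.Eventually.of_forall fun x => ?_) 2).trans_eq rfl
    exact (A t x).le_of_opNorm_le (hB t x) _
  have hmem : ∀ t, MemLp (fun x => A t x (g t x)) 2 μ := fun t =>
    ⟨(isBoundedBilinearMap_apply.continuous.comp_stronglyMeasurable
      ((hAt t).prodMk (Lp.stronglyMeasurable (g t)))).aestronglyMeasurable,
      (hbd t _).trans_lt (ENNReal.mul_lt_top ENNReal.coe_lt_top (Lp.eLpNorm_lt_top _))⟩
  refine ⟨fun t => (hmem t).toLp _, ?_, fun t => (hmem t).coeFn_toLp⟩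
  refine aestronglyMeasurable_of_operator (K := B) (fun t (g : α → E) x => A t x (g x))
    (fun t f g => ?_) (fun g hg => ?_) (fun t g _ => hbd t g) hg
    (Filter.Eventually.of_forall fun t => (hmem t).coeFn_toLp)
  · ext x
    simp
  · exact isBoundedBilinearMap_apply.continuous.comp_stronglyMeasurable
      (hA.prodMk (hg.comp_measurable measurable_snd))

theorem aemeasurable_integral_inner_mul [IsSeparable μ] [SFinite μ] {τ : Measure ℝ}
    {A : ℝ → α → E →L[ℝ] G} (hA : StronglyMeasurable (Function.uncurry A)) {B : ℝ≥0}
    (hB : ∀ t x, ‖A t x‖ ≤ B) {g : ℝ → Lp E 2 μ} (hg : AEStronglyMeasurable g τ)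
    {h : ℝ → Lp G 2 μ} (hh : AEStronglyMeasurable h τ) :
    AEMeasurable (fun t => ∫ x, ⟪A t x (g t x), h t x⟫ ∂μ) τ := by
  obtain ⟨m, hm, hm'⟩ := exists_aestronglyMeasurable_mul hA hB hg
  refine (AEStronglyMeasurable.inner (𝕜 := ℝ) hm hh).aemeasurable.congr (Filter.Eventually.of_forall fun t => ?_)
  change ⟪m t, h t⟫ = _
  rw [L2.inner_def]
  refine integral_congr_ae ?_
  filter_upwards [hm' t] with x hx
  rw [hx]

end Coefficients

/-- Lusin–Souslin: a continuous injection between Polish spaces is a measurable embedding. The weak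
Jacobians therefore need no separate treatment. -/
theorem aestronglyMeasurable_H10 {Ω : Set (Vec d)} {τ : Measure ℝ} {U : ℝ → H10 Ω}
    (h : AEStronglyMeasurable (fun t => fnH (U t)) τ) : AEStronglyMeasurable U τ := by
  borelize (H10 Ω)
  borelize ↥(Lp (Vec d) 2 (volume.restrict Ω))
  have he : MeasurableEmbedding (fnH : H10 Ω → L2 Ω) :=
    Continuous.measurableEmbedding (fnHL Ω).continuous (fnH_injective Ω)
  exact (he.aemeasurable_comp_iff.1 h.aemeasurable).aestronglyMeasurable

section Flow

variable {W : ℝ → Vec d → Vec d} {M L N : ℝ≥0} {T : ℝ} {Φ : ℝ → Vec d → Vec d}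
  {Ω₀ : Set (Vec d)}

/-- Comparison of the `L^p` norms on the moving and on the fixed domain. -/
theorem IsFlow.exists_eLpNorm_image_le (hW : IsRegularField W M L N) (hΦ : IsFlow W T Φ)
    (ho : MeasurableSet Ω₀) : ∃ C : ℝ≥0, ∀ t ∈ Icc 0 T, ∀ p : ℝ≥0∞, 1 ≤ p →
      ∀ f : Vec d → Vec d, eLpNorm f p (volume.restrict (Φ t '' Ω₀)) ≤
        C * eLpNorm (fun x => f (Φ t x)) p (volume.restrict Ω₀) := by
  obtain ⟨C, hC⟩ := hΦ.exists_lintegral_image_le hW ho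
  -- A constant at least `1` dominates its own `1/p`-th power, so one constant serves all exponents,
  -- `∞` included.
  refine ⟨max 1 C, fun t ht p hp f => ?_⟩
  have h1 : (1 : ℝ≥0∞) ≤ ((max 1 C : ℝ≥0) : ℝ≥0∞) := by exact_mod_cast le_max_left 1 C
  rcases eq_or_ne p ⊤ with rfl | hpt
  · refine le_trans ?_ (le_mul_of_one_le_left zero_le h1)
    rw [eLpNorm_exponent_top, eLpNorm_exponent_top]
    refine essSup_le_of_ae_le _ ?_
    have := hΦ.ae_image hW ht ho
      (enorm_ae_le_eLpNormEssSup (fun x => f (Φ t x)) (volume.restrict Ω₀))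
    filter_upwards [this] with y hy
    rwa [hΦ.apply_invFun hW ht] at hy
  · have hp0 : p ≠ 0 := (zero_lt_one.trans_le hp).ne'
    have hpr : 1 ≤ p.toReal := by
      rw [← ENNReal.toReal_one]
      exact ENNReal.toReal_mono hpt hp
    rw [eLpNorm_eq_lintegral_rpow_enorm_toReal hp0 hpt,
      eLpNorm_eq_lintegral_rpow_enorm_toReal hp0 hpt]
    calc (∫⁻ x in Φ t '' Ω₀, ‖f x‖ₑ ^ p.toReal) ^ (1 / p.toReal)
        ≤ (((max 1 C : ℝ≥0) : ℝ≥0∞) * ∫⁻ x in Ω₀, ‖f (Φ t x)‖ₑ ^ p.toReal) ^ (1 / p.toReal) := by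
          gcongr
          refine (hC t ht fun y => ‖f y‖ₑ ^ p.toReal).trans ?_
          gcongr
          exact le_max_right 1 C
      _ ≤ _ := by
          rw [ENNReal.mul_rpow_of_nonneg _ _ (by positivity)]
          gcongr
          refine (ENNReal.rpow_le_rpow_of_exponent_le h1 ?_).trans_eq (ENNReal.rpow_one _)
          rw [div_le_one (by positivity)]
          exact hpr

theorem IsFlow.mem_image_iff (hW : IsRegularField W M L N) (hΦ : IsFlow W T Φ) {t : ℝ}
    (ht : t ∈ Icc 0 T) {y : Vec d} : y ∈ Φ t '' Ω₀ ↔ Function.invFun (Φ t) y ∈ Ω₀ := by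
  constructor
  · rintro ⟨x, hx, rfl⟩
    rwa [hΦ.invFun_apply hW ht]
  · exact fun h => ⟨_, h, hΦ.apply_invFun hW ht y⟩

theorem IsFlow.measurableSet_image (hW : IsRegularField W M L N) (hΦ : IsFlow W T Φ) {t : ℝ}
    (ht : t ∈ Icc 0 T) (ho : MeasurableSet Ω₀) : MeasurableSet (Φ t '' Ω₀) :=
  (hΦ.homeo hW ht).measurableEmbedding.measurableSet_image' ho

/-- Inversion of the Piola transform. -/
theorem IsFlow.ae_eq_of_piolaInv (hW : IsRegularField W M L N) (hΦ : IsFlow W T Φ) {t : ℝ}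
    (ht : t ∈ Icc 0 T) (ho : MeasurableSet Ω₀) {u₀ u : Vec d → Vec d}
    (h : u₀ =ᵐ[volume.restrict Ω₀] piolaInv Φ t u) : u =ᵐ[volume.restrict (Φ t '' Ω₀)]
      fun y => DΦ Φ t (Function.invFun (Φ t) y) (u₀ (Function.invFun (Φ t) y)) := by
  filter_upwards [hΦ.ae_image hW ht ho h] with y hy
  have hinv := hΦ.isInvertible_fderiv hW ht (Function.invFun (Φ t) y)
  rw [hy, piolaInv, hΦ.apply_invFun hW ht]
  exact congr($(hinv.self_comp_inverse) (u y)).symm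

/-- The forward Piola transform followed by extension by zero is a uniformly bounded family of
operators from `L²(Ω₀)` to `L²(ℝ^d)` that respects joint measurability. It brings the fibres over
all times into one space. -/
theorem IsFlow.aestronglyMeasurable_ext (hW : IsRegularField W M L N) (hΦ : IsFlow W T Φ)
    (hT : 0 ≤ T) (ho : MeasurableSet Ω₀) {u₀ : ℝ → L2 Ω₀}
    (hu₀ : AEStronglyMeasurable u₀ (timeMeasure T)) {u : ∀ t, L2 (Φ t '' Ω₀)}
    (hu : ∀ᵐ t ∂(timeMeasure T), u₀ t =ᵐ[volume.restrict Ω₀] piolaInv Φ t (u t))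
    {e : ℝ → L2 (univ : Set (Vec d))}
    (he : ∀ᵐ t ∂(timeMeasure T), e t =ᵐ[volume.restrict univ] (Φ t '' Ω₀).indicator (u t)) :
    AEStronglyMeasurable e (timeMeasure T) := by
  obtain ⟨C, hC⟩ := hΦ.exists_eLpNorm_image_le hW ho
  have hcl : ∀ t, (projIcc 0 T hT t : ℝ) ∈ Icc 0 T := fun t => (projIcc 0 T hT t).2
  set P : ℝ → (Vec d → Vec d) → Vec d → Vec d := fun t g y =>
    (Φ (projIcc 0 T hT t) '' Ω₀).indicator (fun y =>
      fderiv ℝ (Φ (projIcc 0 T hT t)) (Function.invFun (Φ (projIcc 0 T hT t)) y)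
        (g (Function.invFun (Φ (projIcc 0 T hT t)) y))) y with hP
  have hinv := hΦ.continuous_invFun_clamp hW hT
  refine aestronglyMeasurable_of_operator (K := C * flowLip L T) P (fun t f g => ?_)
    (fun g hg => ?_) (fun t g hg => ?_) hu₀ ?_
  · simp only [hP]
    ext1 y
    by_cases hy : y ∈ Φ (projIcc 0 T hT t) '' Ω₀ <;>
      simp only [Pi.sub_apply, map_sub, indicator, hy, if_true, if_false, sub_zero]
  · have hset : (Function.uncurry fun t y => P t g y) =
        ((fun z : ℝ × Vec d => Function.invFun (Φ (projIcc 0 T hT z.1)) z.2) ⁻¹' Ω₀).indicator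
          (fun z => fderiv ℝ (Φ (projIcc 0 T hT z.1))
            (Function.invFun (Φ (projIcc 0 T hT z.1)) z.2)
            (g (Function.invFun (Φ (projIcc 0 T hT z.1)) z.2))) := by
      ext1 ⟨t, y⟩
      have hiff : y ∈ Φ (projIcc 0 T hT t) '' Ω₀ ↔ _ := hΦ.mem_image_iff hW (hcl t)
      simp only [hP, Function.uncurry_apply_pair, indicator]
      by_cases hy : y ∈ Φ (projIcc 0 T hT t) '' Ω₀
      · rw [if_pos hy, if_pos (by exact hiff.1 hy)]
      · rw [if_neg hy, if_neg (by exact fun h => hy (hiff.2 h))]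
    rw [hset]
    refine StronglyMeasurable.indicator ?_ (hinv.measurable ho)
    refine isBoundedBilinearMap_apply.continuous.comp_stronglyMeasurable
      (StronglyMeasurable.prodMk ?_ (hg.comp_measurable hinv.measurable))
    exact ((hΦ.continuous_fderiv_clamp hW hT).comp
      (continuous_fst.prodMk hinv)).stronglyMeasurable
  · rw [Measure.restrict_univ, show P t g = (Φ (projIcc 0 T hT t) '' Ω₀).indicator _ from rfl,
      eLpNorm_indicator_eq_eLpNorm_restrict (hΦ.measurableSet_image hW (hcl t) ho)]
    refine (hC _ (hcl t) 2 one_le_two _).trans ?_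
    rw [ENNReal.coe_mul, mul_assoc]
    gcongr
    simp only [hΦ.invFun_apply hW (hcl t)]
    refine (eLpNorm_le_nnreal_smul_eLpNorm_of_ae_le_mul (c := flowLip L T)
      (Filter.Eventually.of_forall fun x => ?_) 2).trans_eq rfl
    exact ContinuousLinearMap.le_of_opNorm_le _ (hΦ.norm_fderiv_le hW (hcl t) x) _
  · filter_upwards [hu, he, ae_restrict_mem measurableSet_Ioo] with t h1 h2 ht
    have ht' := Ioo_subset_Icc_self ht
    have hpt : (projIcc 0 T hT t : ℝ) = t := by rw [projIcc_of_mem hT ht']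
    refine h2.trans ?_
    simp only [hP, hpt]
    exact indicator_ae_eq_univ (hΦ.measurableSet_image hW ht' ho)
      (hΦ.ae_eq_of_piolaInv hW ht' ho h1)

end Flow

end MovingStokes

namespace MovingStokes

open scoped NNReal
open Filter (Tendsto atTop)

variable {d : ℕ}

/-! ### Measurability in time of the forms -/

theorem matVec_add_right (A : Mat d) (v w : Vec d) :
    matVec A (v + w) = matVec A v + matVec A w := by
  ext i
  simp [matVec_apply, add_mul, Finset.sum_add_distrib]

theorem matVec_smul_right (c : ℝ) (A : Mat d) (v : Vec d) :
    matVec A (c • v) = c • matVec A v := by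
  ext i
  simp [matVec_apply, Finset.mul_sum, mul_assoc]

/-- The map `v ↦ (A ↦ A v)`. -/
noncomputable def matVecL (d : ℕ) : Vec d →L[ℝ] Mat d →L[ℝ] Vec d :=
  LinearMap.mkContinuous₂ (LinearMap.mk₂ ℝ (fun v A => matVec A v)
    (fun v w A => matVec_add_right A v w) (fun c v A => matVec_smul_right c A v)
    (fun v A B => matVec_add_left A B v) (fun c v A => matVec_smul_left c A v)) 1
    (fun v A => by
      rw [one_mul, mul_comm]
      exact norm_matVec_le A v)

@[simp] theorem matVecL_apply (v : Vec d) (A : Mat d) : matVecL d v A = matVec A v := rfl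

theorem norm_matVecL_le (v : Vec d) : ‖matVecL d v‖ ≤ ‖v‖ :=
  ContinuousLinearMap.opNorm_le_bound _ (norm_nonneg _) fun A => by
    rw [mul_comm]
    exact norm_matVec_le A v

section Fibers

variable {τ : Measure ℝ} {Ω : ℝ → Set (Vec d)}

theorem aemeasurable_integral_moving (hΩ : ∀ᵐ t ∂τ, MeasurableSet (Ω t))
    {A : ℝ → Vec d → Vec d →L[ℝ] Vec d} (hA : StronglyMeasurable (Function.uncurry A)) {B : ℝ≥0}
    (hB : ∀ t x, ‖A t x‖ ≤ B) {M : ℝ → Vec d → Vec d →L[ℝ] Vec d}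
    (hM : ∀ᵐ t ∂τ, ∀ y, M t y = A t y) {u v : ∀ t, L2 (Ω t)} {u' v' : ℝ → L2 (univ : Set (Vec d))}
    (hu' : AEStronglyMeasurable u' τ) (hv' : AEStronglyMeasurable v' τ)
    (hu : ∀ᵐ t ∂τ, u' t =ᵐ[volume.restrict univ] (Ω t).indicator (u t))
    (hv : ∀ᵐ t ∂τ, v' t =ᵐ[volume.restrict univ] (Ω t).indicator (v t)) :
    AEMeasurable (fun t => ∫ x in Ω t, ⟪M t x (u t x), v t x⟫) τ := by
  refine (aemeasurable_integral_inner_mul hA hB hu' hv').congr ?_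
  filter_upwards [hΩ, hM, hu, hv] with t h0 h1 h2 h3
  rw [← integral_indicator h0, ← setIntegral_univ (μ := volume)]
  refine integral_congr_ae ?_
  filter_upwards [h2, h3] with x h4 h5
  rw [h4, h5, ← h1]
  by_cases hx : x ∈ Ω t <;> simp [hx]

theorem norm_matVec_trunc_le {ε : ℝ} (hε : 0 ≤ ε) (A : Mat d) (v : Vec d) :
    ‖matVec A (trunc ε v)‖ ≤ ‖matVec A v‖ := by
  rw [trunc, matVec_smul_right, norm_smul]
  refine mul_le_of_le_one_left (norm_nonneg _) ?_
  rw [norm_inv, Real.norm_of_nonneg (Real.sqrt_nonneg _)]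
  refine inv_le_one_of_one_le₀ (Real.one_le_sqrt.2 ?_)
  have : 0 ≤ ε * ‖v‖ ^ 2 := by positivity
  linarith

/-- The pairing need not be an integral, so it is reached by two successive limits: truncating `b`
gives bounded coefficients, which are removed by dominated convergence at a fixed truncation of `v`;
then the truncation of `v` is removed by `Represents.tendsto_trunc`. -/
theorem aemeasurable_pairing (hΩ : ∀ᵐ t ∂τ, MeasurableSet (Ω t)) {b b' : ℝ → Vec d → Vec d}
    {κ : ℝ} (hb : ∀ᵐ t ∂τ, IsAdvecting (Ω t) (b t) κ)
    (hb' : StronglyMeasurable (Function.uncurry b'))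
    (hbb' : ∀ᵐ t ∂τ, b t =ᵐ[volume.restrict (Ω t)] b' t)
    {u v : ∀ t, H10 (Ω t)} {u' v' : ℝ → H10 (univ : Set (Vec d))}
    (hu' : AEStronglyMeasurable u' τ) (hv' : AEStronglyMeasurable v' τ)
    (hu : ∀ᵐ t ∂τ, jacH (u' t) =ᵐ[volume.restrict univ] (Ω t).indicator (jacH (u t)))
    (hv : ∀ᵐ t ∂τ, fnH (v' t) =ᵐ[volume.restrict univ] (Ω t).indicator (fnH (v t))) :
    AEMeasurable (fun t => pairing (Ω t) (fun x => matVec (jacH (u t) x) (b t x)) (v t)) τ := by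
  have hε : ∀ n : ℕ, (0 : ℝ) < 1 / ((n : ℝ) + 1) := fun n => by positivity
  have hJ : AEStronglyMeasurable (fun t => jacH (u' t)) τ :=
    (jacHL _).continuous.comp_aestronglyMeasurable hu'
  have hF : AEStronglyMeasurable (fun t => fnH (v' t)) τ :=
    (fnHL _).continuous.comp_aestronglyMeasurable hv'
  have hconv : ∀ᵐ t ∂τ, (fun x => matVec (jacH (u' t) x) (b' t x)) =ᵐ[volume.restrict univ]
      (Ω t).indicator fun x => matVec (jacH (u t) x) (b t x) := by
    filter_upwards [hΩ, hu, hbb'] with t h0 h1 h2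
    filter_upwards [h1, indicator_ae_eq_univ h0 h2] with x h3 h4
    rw [h3]
    by_cases hx : x ∈ Ω t
    · simp only [indicator_of_mem hx] at h4 ⊢
      rw [h4]
    · simp only [indicator_of_notMem hx]
      exact norm_le_zero_iff.1 ((norm_matVec_le _ _).trans_eq (by simp))
  have hlim : ∀ n : ℕ, AEMeasurable (fun t => ∫ x in univ,
      ⟪matVec (jacH (u' t) x) (b' t x), trunc (1 / ((n : ℝ) + 1)) (fnH (v' t) x)⟫) τ := by
    intro n
    refine aemeasurable_of_tendsto_metrizable_ae atTop
      (f := fun (m : ℕ) t => ∫ x in univ, ⟪matVecL d (trunc (1 / ((m : ℝ) + 1)) (b' t x))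
        (jacH (u' t) x), truncLp (hε n).le (fnH (v' t)) x⟫) (fun m => ?_) ?_
    · refine aemeasurable_integral_inner_mul
        (A := fun t x => matVecL d (trunc (1 / ((m : ℝ) + 1)) (b' t x)))
        (B := ⟨(Real.sqrt (1 / ((m : ℝ) + 1)))⁻¹, by positivity⟩) ?_ (fun t x => ?_) hJ ?_
      · exact ((matVecL d).continuous.comp
          (contDiff_trunc (hε m).le).continuous).comp_stronglyMeasurable hb'
      · exact (norm_matVecL_le _).trans (norm_trunc_le_inv (hε m) _)
      · exact ((lipschitz_trunc (hε n).le).continuous_compLp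
          (trunc_zero _)).comp_aestronglyMeasurable hF
    · filter_upwards [hΩ, hb, hconv] with t h0 h1 h2
      have hint : Integrable (fun x => matVec (jacH (u' t) x) (b' t x)) (volume.restrict univ) := by
        refine Integrable.congr ?_ h2.symm
        rw [Measure.restrict_univ, integrable_indicator_iff h0]
        exact h1.integrable (u t)
      have hb't : StronglyMeasurable (b' t) := hb'.comp_measurable measurable_prodMk_left
      refine tendsto_integral_of_dominated_convergence
        (fun x => ‖matVec (jacH (u' t) x) (b' t x)‖ * (Real.sqrt (1 / ((n : ℝ) + 1)))⁻¹)
        (fun m => ?_) (hint.norm.mul_const _) (fun m => ?_) ?_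
      · exact (continuous_matVec.comp_aestronglyMeasurable
          ((Lp.aestronglyMeasurable _).prodMk ((contDiff_trunc (hε m).le).continuous
            |>.comp_aestronglyMeasurable hb't.aestronglyMeasurable))).inner
          (Lp.aestronglyMeasurable _)
      · filter_upwards [coeFn_truncLp (hε n).le (fnH (v' t))] with x hx
        rw [hx, matVecL_apply]
        exact (norm_inner_le_norm _ _).trans (mul_le_mul (norm_matVec_trunc_le (hε m).le _ _)
          (norm_trunc_le_inv (hε n) _) (norm_nonneg _) (norm_nonneg _))
      · filter_upwards [coeFn_truncLp (hε n).le (fnH (v' t))] with x hx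
        rw [hx]
        refine Tendsto.inner ?_ tendsto_const_nhds
        exact ((continuous_matVec.comp (Continuous.prodMk_right (jacH (u' t) x))).tendsto
          (b' t x)).comp (tendsto_trunc (b' t x))
  refine aemeasurable_of_tendsto_metrizable_ae atTop hlim ?_
  filter_upwards [hΩ, hb, hconv, hv] with t h0 h1 h2 h3
  obtain ⟨Bf, hB, -⟩ := h1.exists_bilin
  rw [(hB (u t)).pairing_eq]
  refine ((hB (u t)).tendsto_trunc (h1.integrable (u t)) (v t)).congr fun n => ?_
  rw [← integral_indicator h0, ← setIntegral_univ (μ := volume)]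
  refine integral_congr_ae ?_
  filter_upwards [h2, h3] with x h4 h5
  rw [h4, h5]
  by_cases hx : x ∈ Ω t <;> simp [hx]

end Fibers

end MovingStokes

namespace MovingStokes

open scoped NNReal
open Filter (Tendsto atTop)

variable {d : ℕ}

/-! ### Measurability in time of the form coefficients and of the duality pairing. -/

section FlowMeasurability

variable {W : ℝ → Vec d → Vec d} {M L N : ℝ≥0} {T : ℝ} {Φ : ℝ → Vec d → Vec d}
  {Ω₀ : Set (Vec d)}

theorem IsFlow.ae_measurableSet_image (hW : IsRegularField W M L N) (hΦ : IsFlow W T Φ)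
    (ho : MeasurableSet Ω₀) : ∀ᵐ t ∂(timeMeasure T), MeasurableSet (Φ t '' Ω₀) := by
  filter_upwards [ae_restrict_mem measurableSet_Ioo] with t ht
  exact hΦ.measurableSet_image hW (Ioo_subset_Icc_self ht) ho

/-- Elements of `L²_H` extend by zero to a measurable family on the whole space. -/
theorem IsFlow.exists_ext_of_memL2H (hW : IsRegularField W M L N) (hΦ : IsFlow W T Φ)
    (hT : 0 ≤ T) (ho : MeasurableSet Ω₀) {u : ∀ t, HSp (Φ t '' Ω₀)} (hu : MemL2H Φ Ω₀ T u) :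
    ∃ u' : ℝ → L2 (univ : Set (Vec d)), AEStronglyMeasurable u' (timeMeasure T) ∧
      ∀ᵐ t ∂(timeMeasure T), u' t =ᵐ[volume.restrict univ]
        (Φ t '' Ω₀).indicator (u t : L2 (Φ t '' Ω₀)) := by
  classical
  obtain ⟨u₀, hm, hu₀⟩ := hu
  have he : ∀ᵐ t ∂(timeMeasure T), (fun t => if h : MeasurableSet (Φ t '' Ω₀) then
      extLp h (u t : L2 (Φ t '' Ω₀)) else 0) t =ᵐ[volume.restrict univ]
        (Φ t '' Ω₀).indicator (u t : L2 (Φ t '' Ω₀)) := by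
    filter_upwards [hΦ.ae_measurableSet_image hW ho] with t ht
    simp only [dif_pos ht]
    exact coeFn_extLp ht _
  exact ⟨_, hΦ.aestronglyMeasurable_ext hW hT ho (u₀ := fun t => (u₀ t : L2 Ω₀))
    (continuous_subtype_val.comp_aestronglyMeasurable hm.1) hu₀ he, he⟩

/-- Elements of `L²_V` extend by zero to a measurable family on the whole space. -/
theorem IsFlow.exists_ext_of_memL2V (hW : IsRegularField W M L N) (hΦ : IsFlow W T Φ)
    (hT : 0 ≤ T) (ho : MeasurableSet Ω₀) {u : ∀ t, VSp (Φ t '' Ω₀)} (hu : MemL2V Φ Ω₀ T u) :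
    ∃ u' : ℝ → H10 (univ : Set (Vec d)), AEStronglyMeasurable u' (timeMeasure T) ∧
      ∀ᵐ t ∂(timeMeasure T), ∃ h : MeasurableSet (Φ t '' Ω₀),
        u' t = extH h (u t : H10 (Φ t '' Ω₀)) := by
  classical
  obtain ⟨u₀, hm, hu₀⟩ := hu
  set e : ℝ → H10 (univ : Set (Vec d)) := fun t => if h : MeasurableSet (Φ t '' Ω₀) then
      extH h (u t : H10 (Φ t '' Ω₀)) else 0 with he
  have he' : ∀ᵐ t ∂(timeMeasure T), fnH (e t) =ᵐ[volume.restrict univ]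
      (Φ t '' Ω₀).indicator (fnV (u t)) := by
    filter_upwards [hΦ.ae_measurableSet_image hW ho] with t ht
    simp only [he, dif_pos ht, fnH_extH]
    exact coeFn_extLp ht _
  refine ⟨e, aestronglyMeasurable_H10 (hΦ.aestronglyMeasurable_ext hW hT ho
    (u₀ := fun t => fnV (u₀ t)) (((fnHL Ω₀).continuous.comp
      continuous_subtype_val).comp_aestronglyMeasurable hm.1) hu₀ he'), ?_⟩
  filter_upwards [hΦ.ae_measurableSet_image hW ho] with t ht
  exact ⟨ht, by simp only [he, dif_pos ht]⟩

theorem norm_adjoint (A : Vec d →L[ℝ] Vec d) : ‖ContinuousLinearMap.adjoint A‖ = ‖A‖ :=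
  LinearIsometryEquiv.norm_map _ A

theorem lipschitz_adjoint_comp_self {A : Vec d → Vec d →L[ℝ] Vec d} {B K : ℝ≥0}
    (hB : ∀ x, ‖A x‖ ≤ B) (hK : LipschitzWith K A) :
    LipschitzWith (2 * B * K) fun x => ContinuousLinearMap.adjoint (A x) ∘L A x := by
  refine LipschitzWith.of_dist_le_mul fun x y => ?_
  have e : ContinuousLinearMap.adjoint (A x) ∘L A x - ContinuousLinearMap.adjoint (A y) ∘L A y =
      ContinuousLinearMap.adjoint (A x) ∘L (A x - A y) +
        ContinuousLinearMap.adjoint (A x - A y) ∘L A y := by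
    rw [map_sub, ContinuousLinearMap.comp_sub, ContinuousLinearMap.sub_comp]
    abel
  have h1 := hK.dist_le_mul x y
  rw [dist_eq_norm] at h1 ⊢
  rw [e]
  refine (norm_add_le _ _).trans ((add_le_add (ContinuousLinearMap.opNorm_comp_le _ _)
    (ContinuousLinearMap.opNorm_comp_le _ _)).trans ?_)
  rw [norm_adjoint, norm_adjoint]
  have h2 : ‖A x‖ * ‖A x - A y‖ ≤ B * (K * dist x y) := by gcongr; exact hB x
  have h3 : ‖A x - A y‖ * ‖A y‖ ≤ K * dist x y * B := by gcongr; exact hB y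
  push_cast
  linarith

/-- `v` is the covariant transform of `η = DΦᵀ DΦ v₀`, so by duality `⟨f, v⟩ = ⟨f₀, η⟩` on the fixed
domain. The factor `DΦᵀ DΦ` is bounded and Lipschitz in space, so `η` stays in `H¹₀`; its divergence
plays no role. -/
theorem IsFlow.aemeasurable_lForm (hW : IsRegularField W M L N) (hΦ : IsFlow W T Φ)
    (hT : 0 ≤ T) (ho : MeasurableSet Ω₀) {f : ∀ t, VStar (Φ t '' Ω₀)}
    {v : ∀ t, VSp (Φ t '' Ω₀)} (hf : MemL2VStar Φ Ω₀ T f) (hv : MemL2V Φ Ω₀ T v) :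
    AEMeasurable (fun t => lForm Φ Ω₀ t (f t) (v t)) (timeMeasure T) := by
  obtain ⟨f₀, hfm, hf₀⟩ := hf
  obtain ⟨v₀, hvm, hv₀⟩ := hv
  have hcl : ∀ t, (projIcc 0 T hT t : ℝ) ∈ Icc 0 T := fun t => (projIcc 0 T hT t).2
  set A : ℝ → Vec d → Vec d →L[ℝ] Vec d := fun t x =>
    ContinuousLinearMap.adjoint (fderiv ℝ (Φ (projIcc 0 T hT t)) x) ∘L
      fderiv ℝ (Φ (projIcc 0 T hT t)) x with hA
  have hB : ∀ t x, ‖A t x‖ ≤ ((flowLip L T * flowLip L T : ℝ≥0) : ℝ) := by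
    intro t x
    have h := hΦ.norm_fderiv_le hW (hcl t) x
    refine (ContinuousLinearMap.opNorm_comp_le _ _).trans ?_
    rw [norm_adjoint, NNReal.coe_mul]
    gcongr
  have hAm : StronglyMeasurable (Function.uncurry A) := by
    have hc := hΦ.continuous_fderiv_clamp hW hT
    exact ((((adjointCLM d).continuous.comp hc).clm_comp hc)).stronglyMeasurable
  choose η hη using fun t => H10.exists_mul (hB t) (lipschitz_adjoint_comp_self
    (fun x => hΦ.norm_fderiv_le hW (hcl t) x) (hΦ.lipschitz_fderiv hW (hcl t)))
    (v₀ t : H10 Ω₀)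
  have hvm' : AEStronglyMeasurable (fun t => fnV (v₀ t)) (timeMeasure T) :=
    ((fnHL Ω₀).continuous.comp continuous_subtype_val).comp_aestronglyMeasurable hvm.1
  obtain ⟨m, hm, hm'⟩ := exists_aestronglyMeasurable_mul hAm hB hvm'
  have hηm : AEStronglyMeasurable η (timeMeasure T) := by
    refine aestronglyMeasurable_H10 (hm.congr (Filter.Eventually.of_forall fun t => ?_))
    exact Lp.ext ((hm' t).trans (hη t).symm)
  have hfm' : AEStronglyMeasurable (fun t => (f₀ t : StrongDual ℝ (H10 Ω₀))) (timeMeasure T) :=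
    continuous_subtype_val.comp_aestronglyMeasurable hfm.1
  have := (isBoundedBilinearMap_apply (𝕜 := ℝ) (E := H10 Ω₀) (F := ℝ)
    ).continuous.comp_aestronglyMeasurable (hfm'.prodMk hηm)
  refine this.aemeasurable.congr ?_
  filter_upwards [hf₀, hv₀, ae_restrict_mem measurableSet_Ioo] with t h1 h2 ht
  have ht' := Ioo_subset_Icc_self ht
  have hpt : (projIcc 0 T hT t : ℝ) = t := by rw [projIcc_of_mem hT ht']
  refine h1 (η t) (v t : H10 (Φ t '' Ω₀)) ?_
  filter_upwards [hΦ.ae_eq_of_piolaInv hW ht' ho h2, hΦ.ae_image hW ht' ho (hη t)] with y h3 h4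
  change fnV (v t) y = _
  rw [h3, covPiola, flowInv, h4, hA]
  simp only [hpt]
  have hinv := hΦ.isInvertible_fderiv hW ht' (Function.invFun (Φ t) y)
  have e : ContinuousLinearMap.adjoint (DΦinv Φ t (Function.invFun (Φ t) y)) ∘L
      ContinuousLinearMap.adjoint (fderiv ℝ (Φ t) (Function.invFun (Φ t) y)) =
        ContinuousLinearMap.id ℝ _ := by
    rw [← ContinuousLinearMap.adjoint_comp]
    exact (congrArg _ hinv.self_comp_inverse).trans ContinuousLinearMap.adjoint_id
  exact congr($e _).symm

theorem IsRegularField.norm_symm_fderiv_le (hW : IsRegularField W M L N) (t : ℝ) (y : Vec d) :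
    ‖ContinuousLinearMap.adjoint (fderiv ℝ (W t) y) + fderiv ℝ (W t) y‖ ≤
      ((L + L : ℝ≥0) : ℝ) := by
  refine (norm_add_le _ _).trans ?_
  rw [norm_adjoint, NNReal.coe_add]
  exact add_le_add (hW.dbound t y) (hW.dbound t y)

theorem IsRegularField.continuous_symm_fderiv (hW : IsRegularField W M L N) :
    Continuous fun z : ℝ × Vec d =>
      ContinuousLinearMap.adjoint (fderiv ℝ (W z.1) z.2) + fderiv ℝ (W z.1) z.2 :=
  ((adjointCLM d).continuous.comp hW.dcont).add hW.dcont

theorem aemeasurable_lamForm (hW : IsRegularField W M L N) (hΦ : IsFlow W T Φ)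
    (ho : MeasurableSet Ω₀) {u v : ∀ t, L2 (Φ t '' Ω₀)} {u' v' : ℝ → L2 (univ : Set (Vec d))}
    (hu' : AEStronglyMeasurable u' (timeMeasure T))
    (hv' : AEStronglyMeasurable v' (timeMeasure T))
    (hu : ∀ᵐ t ∂(timeMeasure T), u' t =ᵐ[volume.restrict univ] (Φ t '' Ω₀).indicator (u t))
    (hv : ∀ᵐ t ∂(timeMeasure T), v' t =ᵐ[volume.restrict univ] (Φ t '' Ω₀).indicator (v t)) :
    AEMeasurable (fun t => lamForm Φ Ω₀ t (u t) (v t)) (timeMeasure T) := by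
  refine (aemeasurable_integral_moving (hΦ.ae_measurableSet_image hW ho)
    (A := fun t y => ContinuousLinearMap.adjoint (fderiv ℝ (W t) y) + fderiv ℝ (W t) y)
    hW.continuous_symm_fderiv.stronglyMeasurable hW.norm_symm_fderiv_le
    (M := lamMatrix Φ) ?_ hv' hu' hv hu).congr (Filter.Eventually.of_forall fun t => ?_)
  · filter_upwards [ae_restrict_mem measurableSet_Ioo] with t ht y
    exact hΦ.lamMatrix_eq hW ht y
  · simp only [lamForm, real_inner_comm]

theorem aemeasurable_drift (hW : IsRegularField W M L N) (hΦ : IsFlow W T Φ)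
    (ho : MeasurableSet Ω₀) {u v : ∀ t, L2 (Φ t '' Ω₀)} {u' v' : ℝ → L2 (univ : Set (Vec d))}
    (hu' : AEStronglyMeasurable u' (timeMeasure T))
    (hv' : AEStronglyMeasurable v' (timeMeasure T))
    (hu : ∀ᵐ t ∂(timeMeasure T), u' t =ᵐ[volume.restrict univ] (Φ t '' Ω₀).indicator (u t))
    (hv : ∀ᵐ t ∂(timeMeasure T), v' t =ᵐ[volume.restrict univ] (Φ t '' Ω₀).indicator (v t)) :
    AEMeasurable (fun t => ∫ x in Φ t '' Ω₀, ⟪driftMatrix Φ t x (u t x), v t x⟫)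
      (timeMeasure T) := by
  refine aemeasurable_integral_moving (A := fun t y => -fderiv ℝ (W t) y) (B := L)
    (hΦ.ae_measurableSet_image hW ho) hW.dcont.neg.stronglyMeasurable
    (fun t y => by rw [norm_neg]; exact hW.dbound t y) ?_ hu' hv' hu hv
  filter_upwards [ae_restrict_mem measurableSet_Ioo] with t ht y
  exact hΦ.driftMatrix_eq hW ht y

end FlowMeasurability

end MovingStokes

namespace MovingStokes

open scoped NNReal
open Filter (Tendsto atTop)

variable {d : ℕ}

/-! ### Uniform bounds for the advecting field -/

section Advection

variable {W : ℝ → Vec d → Vec d} {M L N : ℝ≥0} {T : ℝ} {Φ : ℝ → Vec d → Vec d}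
  {Ω₀ : Set (Vec d)} {p : ℝ≥0∞} {V : ℝ → Vec d → Vec d}

theorem AdvectionAssumption.natCast_le (h : AdvectionAssumption Φ Ω₀ T p V) : (d : ℝ≥0∞) ≤ p := by
  rcases h.2 with h | rfl
  · exact h.1
  · exact le_top

/-- The relative velocity has a jointly measurable representative and is bounded in `L^p`,
uniformly in time. -/
theorem IsFlow.exists_relative_velocity (hW : IsRegularField W M L N) (hΦ : IsFlow W T Φ)
    (hT : 0 ≤ T) (ho : MeasurableSet Ω₀) (hbd : Bornology.IsBounded Ω₀) (hp : 1 ≤ p)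
    (hV : MemLinfLp Ω₀ T p fun t x => V t (Φ t x)) :
    ∃ b : ℝ → Vec d → Vec d, StronglyMeasurable (Function.uncurry b) ∧ ∃ M' : ℝ≥0,
      ∀ᵐ t ∂(timeMeasure T),
        (fun y => V t y - W t y) =ᵐ[volume.restrict (Φ t '' Ω₀)] b t ∧
          eLpNorm (fun y => V t y - W t y) p (volume.restrict (Φ t '' Ω₀)) ≤ M' := by
  obtain ⟨⟨G, hG, hGV⟩, M₁, hM₁⟩ := hV
  obtain ⟨C, hC⟩ := hΦ.exists_eLpNorm_image_le hW ho
  obtain ⟨R, hR⟩ := hΦ.image_subset_closedBall hW hT hbd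
  have hfin : eLpNorm (fun _ : Vec d => (M : ℝ)) p
      (volume.restrict (Metric.closedBall (0 : Vec d) R)) < ⊤ :=
    have := isFiniteMeasure_restrict_of_subset (subset_refl (Metric.closedBall (0 : Vec d) R))
    (memLp_const (M : ℝ)).2
  -- `V` itself need not be jointly measurable; its representative is obtained from that of `V ∘ Φ`
  -- by composing with the inverse flow.
  refine ⟨fun t y => G t (Function.invFun (Φ (projIcc 0 T hT t)) y) - W t y, ?_,
    C * M₁ + (eLpNorm (fun _ : Vec d => (M : ℝ)) p
      (volume.restrict (Metric.closedBall (0 : Vec d) R))).toNNReal, ?_⟩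
  · exact (hG.comp_measurable (measurable_fst.prodMk
      (hΦ.continuous_invFun_clamp hW hT).measurable)).sub hW.cont.stronglyMeasurable
  filter_upwards [hGV, hM₁, ae_restrict_mem measurableSet_Ioo] with t h1 h2 ht
  have ht' := Ioo_subset_Icc_self ht
  have hpt : (projIcc 0 T hT t : ℝ) = t := by rw [projIcc_of_mem hT ht']
  have hVG : V t =ᵐ[volume.restrict (Φ t '' Ω₀)] fun y => G t (Function.invFun (Φ t) y) := by
    filter_upwards [hΦ.ae_image hW ht' ho h1] with y hy
    rwa [hΦ.apply_invFun hW ht'] at hy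
  have hGt : StronglyMeasurable (G t) := hG.comp_measurable measurable_prodMk_left
  have hVm : AEStronglyMeasurable (V t) (volume.restrict (Φ t '' Ω₀)) :=
    (hGt.comp_measurable (hΦ.lipschitz_invFun hW ht').continuous.measurable
      ).aestronglyMeasurable.congr hVG.symm
  have hWm : AEStronglyMeasurable (W t) (volume.restrict (Φ t '' Ω₀)) :=
    (hW.diff t).continuous.aestronglyMeasurable
  refine ⟨?_, ?_⟩
  · filter_upwards [hVG] with y hy
    rw [hy, hpt]
  · refine (eLpNorm_sub_le hVm hWm hp).trans ?_
    rw [ENNReal.coe_add, ENNReal.coe_mul, ENNReal.coe_toNNReal hfin.ne]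
    gcongr
    · exact (hC t ht' p hp (V t)).trans (by gcongr)
    · exact (eLpNorm_mono_real fun y => hW.bound t y).trans
        (eLpNorm_mono_measure _ (Measure.restrict_mono (hR t ht') le_rfl))

/-- The convective term is uniformly bounded. -/
theorem IsFlow.exists_isAdvecting (hd : d = 2 ∨ d = 3) (hW : IsRegularField W M L N)
    (hΦ : IsFlow W T Φ) (hT : 0 ≤ T) (ho : IsOpen Ω₀) (hbd : Bornology.IsBounded Ω₀)
    (hC2 : HasC2Boundary Ω₀) (hp : (d : ℝ≥0∞) ≤ p) {b : ℝ → Vec d → Vec d} {M' : ℝ≥0}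
    (hb : ∀ᵐ t ∂(timeMeasure T), AEStronglyMeasurable (b t) (volume.restrict (Φ t '' Ω₀)) ∧
      eLpNorm (b t) p (volume.restrict (Φ t '' Ω₀)) ≤ M')
    (hdiv : p ≠ ⊤ → ∀ᵐ t ∂(timeMeasure T), WeaklyDivFree (Φ t '' Ω₀) (b t)) :
    ∃ κ : ℝ, ∀ᵐ t ∂(timeMeasure T), IsAdvecting (Φ t '' Ω₀) (b t) κ ∧
      ((d = 2 → 2 < p) → ∀ u v : H10 (Φ t '' Ω₀), Integrable
        (fun x => ⟪matVec (jacH u x) (b t x), fnH v x⟫) (volume.restrict (Φ t '' Ω₀))) := by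
  obtain ⟨R, hR⟩ := hΦ.image_subset_closedBall hW hT hbd
  by_cases hcrit : d = 2 → 2 < p
  · obtain ⟨κ, hκ⟩ := exists_isAdvecting_subcritical hd hp hcrit R M'
    refine ⟨κ, ?_⟩
    filter_upwards [hb, ae_restrict_mem measurableSet_Ioo] with t h1 ht
    obtain ⟨h2, h3⟩ := hκ _ (hR t (Ioo_subset_Icc_self ht)) (b t) h1.1 h1.2
    exact ⟨h2, fun _ => h3⟩
  -- What remains is `d = p = 2`. As `p` is finite the field is divergence free, and since all
  -- inverse flow maps share one Lipschitz constant, one radius `δ` serves all times.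
  · obtain ⟨rfl, hp2⟩ : ∃ _ : d = 2, ¬ 2 < p := by simpa using hcrit
    have hp2' : p = 2 := le_antisymm (not_lt.1 hp2) (by exact_mod_cast hp)
    subst hp2'
    obtain ⟨δ, hδ, hhole⟩ := hC2.exists_closedBall_subset hbd ho (flowLip L T)
    obtain ⟨κ, hκ⟩ := exists_isAdvecting_critical R hδ M'
    refine ⟨κ, ?_⟩
    filter_upwards [hb, hdiv (by simp), ae_restrict_mem measurableSet_Ioo] with t h1 h2 ht
    have ht' := Ioo_subset_Icc_self ht
    refine ⟨hκ _ (hΦ.isOpen_image hW ht' ho) (hR t ht') ?_ (b t)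
      ⟨h1.1, h1.2.trans_lt ENNReal.coe_lt_top⟩ h1.2 h2, fun h => absurd h hcrit⟩
    exact hhole (hΦ.homeo hW ht') (hΦ.antilipschitz hW ht')

theorem IsFlow.weaklyDivFree_relative (hW : IsRegularField W M L N) (hΦ : IsFlow W T Φ)
    (hT : 0 ≤ T) (hbd : Bornology.IsBounded Ω₀) (hWd : ∀ t, ContDiff ℝ 1 (W t))
    (hdiv : ∀ t x, divergence (W t) x = 0) (hp : 1 ≤ p)
    (hm : ∀ᵐ t ∂(timeMeasure T), MemLp (fun y => V t y - W t y) p (volume.restrict (Φ t '' Ω₀)))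
    (hV : ∀ᵐ t ∂(timeMeasure T), WeaklyDivFree (Φ t '' Ω₀) (V t)) :
    ∀ᵐ t ∂(timeMeasure T), WeaklyDivFree (Φ t '' Ω₀) fun y => V t y - W t y := by
  obtain ⟨R, hR⟩ := hΦ.image_subset_closedBall hW hT hbd
  filter_upwards [hm, hV, ae_restrict_mem measurableSet_Ioo] with t h1 h2 ht
  have := isFiniteMeasure_restrict_of_subset (hR t (Ioo_subset_Icc_self ht))
  have hWi : LocallyIntegrable (W t) (volume.restrict (Φ t '' Ω₀)) :=
    (hW.diff t).continuous.locallyIntegrable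
  have hVi : LocallyIntegrable (V t) (volume.restrict (Φ t '' Ω₀)) := by
    have := ((h1.integrable hp).locallyIntegrable).add hWi
    refine this.congr (Filter.Eventually.of_forall fun y => ?_)
    simp
  exact h2.sub (weaklyDivFree_of_divergence (hWd t) (hdiv t)) hVi hWi

end Advection

end MovingStokes

namespace MovingStokes

open scoped NNReal
open Filter (Tendsto atTop)

variable {d : ℕ}

/-! ### Bounded bilinear forms -/

namespace IsBilinearBoundedBy

variable {X Y X' Y' : Type*} [NormedAddCommGroup X] [NormedSpace ℝ X] [NormedAddCommGroup Y]
  [NormedSpace ℝ Y] [NormedAddCommGroup X'] [NormedSpace ℝ X'] [NormedAddCommGroup Y']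
  [NormedSpace ℝ Y'] {C C' : ℝ} {b b' : X → Y → ℝ}

theorem add (h : IsBilinearBoundedBy C b) (h' : IsBilinearBoundedBy C' b') :
    IsBilinearBoundedBy (C + C') fun x y => b x y + b' x y := by
  obtain ⟨B, hB⟩ := h
  obtain ⟨B', hB'⟩ := h'
  refine ⟨B + B', fun x y => ⟨by simp [(hB x y).1, (hB' x y).1], ?_⟩⟩
  refine (abs_add_le _ _).trans ((add_le_add (hB x y).2 (hB' x y).2).trans_eq ?_)
  ring

theorem sub (h : IsBilinearBoundedBy C b) (h' : IsBilinearBoundedBy C' b') :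
    IsBilinearBoundedBy (C + C') fun x y => b x y - b' x y := by
  obtain ⟨B, hB⟩ := h
  obtain ⟨B', hB'⟩ := h'
  refine ⟨B - B', fun x y => ⟨by simp [(hB x y).1, (hB' x y).1], ?_⟩⟩
  refine (abs_sub _ _).trans ((add_le_add (hB x y).2 (hB' x y).2).trans_eq ?_)
  ring

theorem comp (hC : 0 ≤ C) (h : IsBilinearBoundedBy C b) (f : X' →ₗ[ℝ] X) (g : Y' →ₗ[ℝ] Y)
    (hf : ∀ x, ‖f x‖ ≤ ‖x‖) (hg : ∀ y, ‖g y‖ ≤ ‖y‖) :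
    IsBilinearBoundedBy C fun x y => b (f x) (g y) := by
  obtain ⟨B, hB⟩ := h
  refine ⟨B.compl₁₂ f g, fun x y => ⟨(hB _ _).1, (hB _ _).2.trans ?_⟩⟩
  gcongr
  · exact hf x
  · exact hg y

theorem inner (X : Type*) [NormedAddCommGroup X] [InnerProductSpace ℝ X] :
    IsBilinearBoundedBy 1 fun x y : X => ⟪x, y⟫ :=
  ⟨innerₗ X, fun x y => ⟨rfl, by rw [one_mul]; exact abs_real_inner_le_norm x y⟩⟩

end IsBilinearBoundedBy

section Coefficient

variable {Ω : Set (Vec d)} {A : Vec d → Vec d →L[ℝ] Vec d} {B : ℝ≥0}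

theorem memLp_mul_of_bounded (hA : AEStronglyMeasurable A (volume.restrict Ω))
    (hB : ∀ x, ‖A x‖ ≤ B) (u : L2 Ω) : MemLp (fun x => A x (u x)) 2 (volume.restrict Ω) :=
  (Lp.memLp u).of_le_mul (c := B)
    (isBoundedBilinearMap_apply.continuous.comp_aestronglyMeasurable
      (hA.prodMk (Lp.aestronglyMeasurable u)))
    (Filter.Eventually.of_forall fun x => (A x).le_of_opNorm_le (hB x) _)

theorem integrable_inner_mul (hA : AEStronglyMeasurable A (volume.restrict Ω))
    (hB : ∀ x, ‖A x‖ ≤ B) (u v : L2 Ω) :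
    Integrable (fun x => ⟪A x (u x), v x⟫) (volume.restrict Ω) := by
  refine (L2.integrable_inner (𝕜 := ℝ) ((memLp_mul_of_bounded hA hB u).toLp _) v).congr ?_
  filter_upwards [(memLp_mul_of_bounded hA hB u).coeFn_toLp] with x hx
  rw [hx]

theorem isBilinearBoundedBy_integral (hA : AEStronglyMeasurable A (volume.restrict Ω))
    (hB : ∀ x, ‖A x‖ ≤ B) :
    IsBilinearBoundedBy B fun u v : L2 Ω => ∫ x in Ω, ⟪A x (u x), v x⟫ := by
  have hi := integrable_inner_mul hA hB
  refine ⟨LinearMap.mk₂ ℝ (fun u v : L2 Ω => ∫ x in Ω, ⟪A x (u x), v x⟫) (fun u u' v => ?_)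
    (fun c u v => ?_) (fun u v v' => ?_) (fun c u v => ?_), fun u v => ⟨rfl, ?_⟩⟩
  · rw [← integral_add (hi u v) (hi u' v)]
    refine integral_congr_ae ?_
    filter_upwards [Lp.coeFn_add u u'] with x hx
    rw [hx, Pi.add_apply, map_add, inner_add_left]
  · rw [smul_eq_mul, ← integral_const_mul]
    refine integral_congr_ae ?_
    filter_upwards [Lp.coeFn_smul c u] with x hx
    rw [hx, Pi.smul_apply, map_smul, real_inner_smul_left]
  · rw [← integral_add (hi u v) (hi u v')]
    refine integral_congr_ae ?_
    filter_upwards [Lp.coeFn_add v v'] with x hx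
    rw [hx, Pi.add_apply, inner_add_right]
  · rw [smul_eq_mul, ← integral_const_mul]
    refine integral_congr_ae ?_
    filter_upwards [Lp.coeFn_smul c v] with x hx
    rw [hx, Pi.smul_apply, real_inner_smul_right]
  · have hm := memLp_mul_of_bounded hA hB u
    have e : ∫ x in Ω, ⟪A x (u x), v x⟫ = ⟪hm.toLp _, v⟫ := by
      rw [L2.inner_def]
      refine integral_congr_ae ?_
      filter_upwards [hm.coeFn_toLp] with x hx
      rw [hx]
    change |∫ x in Ω, ⟪A x (u x), v x⟫| ≤ _
    rw [e]
    refine (abs_real_inner_le_norm _ _).trans ?_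
    gcongr
    refine Lp.norm_le_mul_norm_of_ae_le_mul ?_
    filter_upwards [hm.coeFn_toLp] with x hx
    rw [hx]
    exact (A x).le_of_opNorm_le (hB x) _

/-- For bounded fields only the `L²` norm of `v` is needed on the right; this, rather than the
general convective bound, is what Gårding's inequality uses. -/
theorem abs_integral_matVec_le {b : Vec d → Vec d} {M : ℝ≥0}
    (hb : AEStronglyMeasurable b (volume.restrict Ω))
    (hM : eLpNorm b ⊤ (volume.restrict Ω) ≤ M) (J : Lp (Mat d) 2 (volume.restrict Ω))
    (v : L2 Ω) : |∫ x in Ω, ⟪matVec (J x) (b x), v x⟫| ≤ M * ‖J‖ * ‖v‖ := by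
  have hbd : ∀ᵐ x ∂volume.restrict Ω, ‖matVec (J x) (b x)‖ ≤ M * ‖J x‖ := by
    filter_upwards [ae_le_eLpNormEssSup (f := b) (μ := volume.restrict Ω)] with x hx
    rw [eLpNorm_exponent_top] at hM
    have h : ‖b x‖ ≤ M := by
      have := hx.trans hM
      rw [enorm_le_coe] at this
      exact this
    refine (norm_matVec_le _ _).trans ?_
    rw [mul_comm]
    gcongr
  have hm : MemLp (fun x => matVec (J x) (b x)) 2 (volume.restrict Ω) :=
    (Lp.memLp J).of_le_mul (continuous_matVec.comp_aestronglyMeasurable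
      ((Lp.aestronglyMeasurable J).prodMk hb)) hbd
  have e : ∫ x in Ω, ⟪matVec (J x) (b x), v x⟫ = ⟪hm.toLp _, v⟫ := by
    rw [L2.inner_def]
    refine integral_congr_ae ?_
    filter_upwards [hm.coeFn_toLp] with x hx
    rw [hx]
  rw [e]
  refine (abs_real_inner_le_norm _ _).trans ?_
  gcongr
  refine Lp.norm_le_mul_norm_of_ae_le_mul ?_
  filter_upwards [hm.coeFn_toLp, hbd] with x hx h
  rwa [hx]

end Coefficient

/-- The function underlying an element of `V`, as a linear map. -/
noncomputable def fnVL (Ω : Set (Vec d)) : VSp Ω →ₗ[ℝ] L2 Ω :=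
  (fnHL Ω).toLinearMap ∘ₗ (VSp Ω).subtype

theorem norm_fnV_le {Ω : Set (Vec d)} (u : VSp Ω) : ‖fnV u‖ ≤ ‖u‖ := norm_fnH_le (u : H10 Ω)

/-! ### Boundedness, coercivity and measurability of the forms on the moving domain. -/

section Forms

variable {W : ℝ → Vec d → Vec d} {M L N : ℝ≥0} {T : ℝ} {Φ : ℝ → Vec d → Vec d} {t : ℝ}
  {Ω₀ : Set (Vec d)} {V : ℝ → Vec d → Vec d}

theorem convection_eq (w V Φ : ℝ → Vec d → Vec d) (Ω₀ : Set (Vec d)) (t : ℝ)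
    (u : VSp (Φ t '' Ω₀)) : convection w V Φ Ω₀ t u =
      fun x => matVec (jacH (u : H10 (Φ t '' Ω₀)) x) (V t x - w t x) := rfl

theorem isBilinearBoundedBy_lForm (Φ : ℝ → Vec d → Vec d) (Ω₀ : Set (Vec d)) (t : ℝ) :
    IsBilinearBoundedBy 1
      fun (f : VStar (Φ t '' Ω₀)) (v : VSp (Φ t '' Ω₀)) => lForm Φ Ω₀ t f v := by
  refine ⟨LinearMap.mk₂ ℝ (fun (f : VStar (Φ t '' Ω₀)) (v : VSp (Φ t '' Ω₀)) =>
    lForm Φ Ω₀ t f v) (fun _ _ _ => rfl) (fun _ _ _ => rfl) (fun f u v => ?_) (fun c f v => ?_),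
    fun f v => ⟨rfl, ?_⟩⟩
  · exact map_add (f : StrongDual ℝ (H10 (Φ t '' Ω₀))) _ _
  · exact map_smul (f : StrongDual ℝ (H10 (Φ t '' Ω₀))) _ _
  · rw [one_mul]
    exact (f : StrongDual ℝ (H10 (Φ t '' Ω₀))).le_opNorm _

theorem IsFlow.inner_lamMatrix (hW : IsRegularField W M L N) (hΦ : IsFlow W T Φ)
    (ht : t ∈ Ioo 0 T) (y u v : Vec d) : ⟪u, lamMatrix Φ t y v⟫ =
      ⟪(ContinuousLinearMap.adjoint (fderiv ℝ (W t) y) + fderiv ℝ (W t) y) u, v⟫ := by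
  rw [hΦ.lamMatrix_eq hW ht, add_apply, add_apply, inner_add_left, inner_add_right,
    ContinuousLinearMap.adjoint_inner_left, ContinuousLinearMap.adjoint_inner_right, add_comm]

theorem IsFlow.integrable_lamForm (hW : IsRegularField W M L N) (hΦ : IsFlow W T Φ)
    (ht : t ∈ Ioo 0 T) (u v : L2 (Φ t '' Ω₀)) :
    IntegrableOn (fun x => ⟪u x, lamMatrix Φ t x (v x)⟫) (Φ t '' Ω₀) := by
  simp only [hΦ.inner_lamMatrix hW ht]
  exact integrable_inner_mul (hW.continuous_symm_fderiv.comp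
    (Continuous.prodMk_right t)).aestronglyMeasurable (hW.norm_symm_fderiv_le t) u v

theorem IsFlow.isBilinearBoundedBy_lamForm (hW : IsRegularField W M L N) (hΦ : IsFlow W T Φ)
    (ht : t ∈ Ioo 0 T) :
    IsBilinearBoundedBy (L + L : ℝ≥0) fun u v : L2 (Φ t '' Ω₀) => lamForm Φ Ω₀ t u v := by
  simp only [lamForm, hΦ.inner_lamMatrix hW ht]
  exact isBilinearBoundedBy_integral (hW.continuous_symm_fderiv.comp
    (Continuous.prodMk_right t)).aestronglyMeasurable (hW.norm_symm_fderiv_le t)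

theorem IsFlow.integrable_drift (hW : IsRegularField W M L N) (hΦ : IsFlow W T Φ)
    (ht : t ∈ Ioo 0 T) (u v : L2 (Φ t '' Ω₀)) :
    IntegrableOn (fun x => ⟪driftMatrix Φ t x (u x), v x⟫) (Φ t '' Ω₀) := by
  simp only [hΦ.driftMatrix_eq hW ht]
  exact integrable_inner_mul (A := fun x => -fderiv ℝ (W t) x) (B := L)
    (hW.dcont.comp (Continuous.prodMk_right t)).neg.aestronglyMeasurable
    (fun x => by rw [norm_neg]; exact hW.dbound t x) u v

theorem IsFlow.isBilinearBoundedBy_drift (hW : IsRegularField W M L N) (hΦ : IsFlow W T Φ)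
    (ht : t ∈ Ioo 0 T) : IsBilinearBoundedBy L fun u v : L2 (Φ t '' Ω₀) =>
      ∫ x in Φ t '' Ω₀, ⟪driftMatrix Φ t x (u x), v x⟫ := by
  simp only [hΦ.driftMatrix_eq hW ht]
  exact isBilinearBoundedBy_integral (hW.dcont.comp
    (Continuous.prodMk_right t)).neg.aestronglyMeasurable
    fun x => by rw [norm_neg]; exact hW.dbound t x

theorem IsFlow.isBilinearBoundedBy_aForm (hW : IsRegularField W M L N) (hΦ : IsFlow W T Φ)
    (ht : t ∈ Ioo 0 T) {κ : ℝ}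
    (hadv : IsAdvecting (Φ t '' Ω₀) (fun x => V t x - W t x) κ) {w : ℝ → Vec d → Vec d}
    (hw : w t = W t) : IsBilinearBoundedBy (1 + 1 + κ + L + (L + L : ℝ≥0))
      fun u v : VSp (Φ t '' Ω₀) => aForm w V Φ Ω₀ t u v := by
  have h1 := IsBilinearBoundedBy.inner (VSp (Φ t '' Ω₀))
  have h2 := (IsBilinearBoundedBy.inner (L2 (Φ t '' Ω₀))).comp zero_le_one (fnVL _) (fnVL _)
    norm_fnV_le norm_fnV_le
  have h3 : IsBilinearBoundedBy κ fun u v : VSp (Φ t '' Ω₀) =>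
      pairing (Φ t '' Ω₀) (convection w V Φ Ω₀ t u) (v : H10 (Φ t '' Ω₀)) := by
    obtain ⟨B, hB, hκ⟩ := hadv.exists_bilin
    have h : IsBilinearBoundedBy κ fun u v : H10 (Φ t '' Ω₀) => B u v :=
      ⟨LinearMap.mk₂ ℝ (fun u v => B u v) (fun _ _ _ => by simp) (fun _ _ _ => by simp)
        (fun _ _ _ => by simp) (fun _ _ _ => by simp), fun u v => ⟨rfl, hκ u v⟩⟩
    have h' := h.comp hadv.nonneg (VSp (Φ t '' Ω₀)).subtype (VSp (Φ t '' Ω₀)).subtype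
      (fun _ => le_rfl) fun _ => le_rfl
    convert h' using 3 with u v
    rw [convection_eq, hw]
    exact (hB (u : H10 (Φ t '' Ω₀))).pairing_eq _
  have h4 := (hΦ.isBilinearBoundedBy_drift (Ω₀ := Ω₀) hW ht).comp L.2 (fnVL _) (fnVL _)
    norm_fnV_le norm_fnV_le
  have h5 := (hΦ.isBilinearBoundedBy_lamForm (Ω₀ := Ω₀) hW ht).comp (L + L).2 (fnVL _) (fnVL _)
    norm_fnV_le norm_fnV_le
  exact (((h1.sub h2).add h3).sub h4).sub h5

theorem IsBilinearBoundedBy.abs_le {X Y : Type*} [NormedAddCommGroup X] [NormedSpace ℝ X]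
    [NormedAddCommGroup Y] [NormedSpace ℝ Y] {C : ℝ} {b : X → Y → ℝ}
    (h : IsBilinearBoundedBy C b) (x : X) (y : Y) : |b x y| ≤ C * ‖x‖ * ‖y‖ := by
  obtain ⟨B, hB⟩ := h
  exact (hB x y).2

/-- Gårding's inequality, given a bound for the diagonal of the convective term. -/
theorem IsFlow.le_aForm (hW : IsRegularField W M L N) (hΦ : IsFlow W T Φ)
    (ht : t ∈ Ioo 0 T) {c : ℝ} {w : ℝ → Vec d → Vec d} (u : VSp (Φ t '' Ω₀))
    (hu : |pairing (Φ t '' Ω₀) (convection w V Φ Ω₀ t u) (u : H10 (Φ t '' Ω₀))| ≤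
      c * ‖u‖ * ‖fnV u‖) :
    1 / 2 * ‖u‖ ^ 2 - (1 + 3 * L + c ^ 2 / 2) * ‖fnV u‖ ^ 2 ≤ aForm w V Φ Ω₀ t u u := by
  have h4 := (hΦ.isBilinearBoundedBy_drift (Ω₀ := Ω₀) hW ht).abs_le (fnV u) (fnV u)
  have h5 := (hΦ.isBilinearBoundedBy_lamForm (Ω₀ := Ω₀) hW ht).abs_le (fnV u) (fnV u)
  rw [aForm, real_inner_self_eq_norm_sq, real_inner_self_eq_norm_sq]
  have h1 := (abs_le.1 hu).1
  have h2 := (abs_le.1 h4).2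
  have h3 := (abs_le.1 h5).2
  push_cast at h3
  -- Young: `c ‖u‖ ‖fnV u‖ ≤ ‖u‖²/2 + c² ‖fnV u‖²/2`. The `1` comes from the subtracted `H` inner
  -- product, and `3 L` is `L` for the drift plus `2 L` for `λ`.
  nlinarith [sq_nonneg (‖u‖ - c * ‖fnV u‖)]

theorem IsFlow.aemeasurable_aForm (hW : IsRegularField W M L N) (hΦ : IsFlow W T Φ)
    (hT : 0 ≤ T) (ho : MeasurableSet Ω₀) {κ : ℝ}
    (hadv : ∀ᵐ t ∂(timeMeasure T), IsAdvecting (Φ t '' Ω₀) (fun x => V t x - W t x) κ)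
    {b : ℝ → Vec d → Vec d} (hb : StronglyMeasurable (Function.uncurry b))
    (hbV : ∀ᵐ t ∂(timeMeasure T),
      (fun x => V t x - W t x) =ᵐ[volume.restrict (Φ t '' Ω₀)] b t)
    {w : ℝ → Vec d → Vec d} (hw : ∀ t ∈ Icc 0 T, w t = W t)
    {u v : ∀ t, VSp (Φ t '' Ω₀)} (hu : MemL2V Φ Ω₀ T u) (hv : MemL2V Φ Ω₀ T v) :
    AEMeasurable (fun t => aForm w V Φ Ω₀ t (u t) (v t)) (timeMeasure T) := by
  obtain ⟨u', hum, hu'⟩ := hΦ.exists_ext_of_memL2V hW hT ho hu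
  obtain ⟨v', hvm, hv'⟩ := hΦ.exists_ext_of_memL2V hW hT ho hv
  have hfu : AEStronglyMeasurable (fun t => fnH (u' t)) (timeMeasure T) :=
    (fnHL _).continuous.comp_aestronglyMeasurable hum
  have hfv : AEStronglyMeasurable (fun t => fnH (v' t)) (timeMeasure T) :=
    (fnHL _).continuous.comp_aestronglyMeasurable hvm
  have hext : ∀ {u : ∀ t, VSp (Φ t '' Ω₀)} {u' : ℝ → H10 (univ : Set (Vec d))},
      (∀ᵐ t ∂(timeMeasure T), ∃ h : MeasurableSet (Φ t '' Ω₀),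
        u' t = extH h (u t : H10 (Φ t '' Ω₀))) → ∀ᵐ t ∂(timeMeasure T),
        fnH (u' t) =ᵐ[volume.restrict univ] (Φ t '' Ω₀).indicator (fnV (u t)) := by
    intro u u' h
    filter_upwards [h] with t ⟨h1, h2⟩
    rw [h2, fnH_extH]
    exact coeFn_extLp h1 _
  have hjac : ∀ᵐ t ∂(timeMeasure T), jacH (u' t) =ᵐ[volume.restrict univ]
      (Φ t '' Ω₀).indicator (jacH (u t : H10 (Φ t '' Ω₀))) := by
    filter_upwards [hu'] with t ⟨h1, h2⟩
    rw [h2, jacH_extH]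
    exact coeFn_extLp h1 _
  have h1 : AEMeasurable (fun t => ⟪u' t, v' t⟫) (timeMeasure T) :=
    (AEStronglyMeasurable.inner (𝕜 := ℝ) hum hvm).aemeasurable
  have h2 : AEMeasurable (fun t => ⟪fnH (u' t), fnH (v' t)⟫) (timeMeasure T) :=
    (AEStronglyMeasurable.inner (𝕜 := ℝ) hfu hfv).aemeasurable
  have h3 := aemeasurable_pairing (hΦ.ae_measurableSet_image hW ho) hadv hb hbV
    (u := fun t => (u t : H10 (Φ t '' Ω₀))) (v := fun t => (v t : H10 (Φ t '' Ω₀)))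
    hum hvm hjac (hext hv')
  have h4 := aemeasurable_drift hW hΦ ho hfu hfv (hext hu') (hext hv')
  have h5 := aemeasurable_lamForm hW hΦ ho hfu hfv (hext hu') (hext hv')
  refine ((((h1.sub h2).add h3).sub h4).sub h5).congr ?_
  filter_upwards [hu', hv', ae_restrict_mem measurableSet_Ioo] with t ⟨h6, h7⟩ ⟨h8, h9⟩ ht
  have e1 : ⟪u' t, v' t⟫ = ⟪u t, v t⟫ := by
    rw [h7, h9]
    exact inner_extH h6 _ _
  have e2 : ⟪fnH (u' t), fnH (v' t)⟫ = ⟪fnV (u t), fnV (v t)⟫ := by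
    rw [h7, h9, fnH_extH, fnH_extH]
    exact LinearIsometry.inner_map_map _ _ _
  simp only [Pi.sub_apply, Pi.add_apply, e1, e2, aForm, convection_eq,
    hw t (Ioo_subset_Icc_self ht)]

end Forms

end MovingStokes

/-! ### The main theorem. -/

theorem mainTheorem6 {d : ℕ} (hd : d = 2 ∨ d = 3) {T : ℝ} (hT : 0 < T)
    (D Ω₀ : Set (Vec d)) (hD : IsOpen D) (hDb : Bornology.IsBounded D)
    (hΩ₀ : IsOpen Ω₀) (hΩ₀D : closure Ω₀ ⊆ D) (hC2 : HasC2Boundary Ω₀)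
    (k : ℕ) (hk : 2 ≤ k) (K : TopologicalSpace.Compacts (Vec d))
    (hK : (K : Set (Vec d)) ⊆ D)
    (w : ℝ → ContDiffMapSupportedIn (Vec d) (Vec d) (k : ℕ∞) K)
    (hw : IsC1InTime T w)
    (hwdiv : ∀ t ∈ Icc 0 T, ∀ x ∈ D, divergence (w t) x = 0)
    (Φ : ℝ → Vec d → Vec d)
    (hΦ : Φ = flow (fun t x => w t x) T)
    (V : ℝ → Vec d → Vec d) (p : ℝ≥0∞)
    (hV : AdvectionAssumption Φ Ω₀ T p V) :
    -- the forms are well defined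
    ((∀ t ∈ Ioo 0 T, ∀ u v : L2 (Φ t '' Ω₀),
        IntegrableOn (fun x => ⟪u x, lamMatrix Φ t x (v x)⟫) (Φ t '' Ω₀) ∧
        IntegrableOn (fun x => ⟪driftMatrix Φ t x (u x), v x⟫) (Φ t '' Ω₀)) ∧
      (∀ᵐ t ∂(timeMeasure T), ∀ u : VSp (Φ t '' Ω₀),
        IntegrableOn (convection (fun t x => w t x) V Φ Ω₀ t u) (Φ t '' Ω₀) ∧
        (∃ ℓ : StrongDual ℝ (H10 (Φ t '' Ω₀)),
          Represents (Φ t '' Ω₀)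
            (convection (fun t x => w t x) V Φ Ω₀ t u) ℓ) ∧
        ((d = 2 → 2 < p) → ∀ v : VSp (Φ t '' Ω₀),
          IntegrableOn (fun x =>
            ⟪convection (fun t x => w t x) V Φ Ω₀ t u x, fnV v x⟫) (Φ t '' Ω₀) ∧
          pairing (Φ t '' Ω₀)
              (convection (fun t x => w t x) V Φ Ω₀ t u) v =
            ∫ x in Φ t '' Ω₀,
              ⟪convection (fun t x => w t x) V Φ Ω₀ t u x, fnV v x⟫))) ∧
    -- measurability in time
    ((∀ u v : ∀ t : ℝ, VSp (Φ t '' Ω₀),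
        MemL2V Φ Ω₀ T u → MemL2V Φ Ω₀ T v →
        AEMeasurable (fun t => aForm (fun t x => w t x) V Φ Ω₀ t (u t) (v t))
          (timeMeasure T)) ∧
      (∀ u v : ∀ t : ℝ, HSp (Φ t '' Ω₀),
        MemL2H Φ Ω₀ T u → MemL2H Φ Ω₀ T v →
        AEMeasurable (fun t => lamForm Φ Ω₀ t (u t) (v t))
          (timeMeasure T)) ∧
      (∀ (f : ∀ t : ℝ, VStar (Φ t '' Ω₀)) (v : ∀ t : ℝ, VSp (Φ t '' Ω₀)),
        MemL2VStar Φ Ω₀ T f → MemL2V Φ Ω₀ T v →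
        AEMeasurable (fun t => lForm Φ Ω₀ t (f t) (v t))
          (timeMeasure T))) ∧
    -- boundedness, uniformly in time
    ((∃ C : ℝ, ∀ᵐ t ∂(timeMeasure T), IsBilinearBoundedBy C
        (fun u v : VSp (Φ t '' Ω₀) =>
          aForm (fun t x => w t x) V Φ Ω₀ t u v)) ∧
      (∃ C : ℝ, ∀ t ∈ Ioo 0 T, IsBilinearBoundedBy C
        (fun u v : HSp (Φ t '' Ω₀) => lamForm Φ Ω₀ t u v)) ∧
      (∃ C : ℝ, ∀ t ∈ Ioo 0 T, IsBilinearBoundedBy C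
        (fun (f : VStar (Φ t '' Ω₀)) (v : VSp (Φ t '' Ω₀)) =>
          lForm Φ Ω₀ t f v))) ∧
    -- the Garding inequality
    (∃ C₁ C₂ : ℝ, 0 < C₁ ∧ 0 < C₂ ∧ ∀ᵐ t ∂(timeMeasure T),
      ∀ u : VSp (Φ t '' Ω₀),
        C₁ * ‖u‖ ^ 2 - C₂ * ‖fnV u‖ ^ 2 ≤
          aForm (fun t x => w t x) V Φ Ω₀ t u u) := by 
  have hbd : Bornology.IsBounded Ω₀ := hDb.subset (subset_closure.trans hΩ₀D)
  have ho : MeasurableSet Ω₀ := hΩ₀.measurableSet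
  obtain ⟨M, L, N, hW⟩ := hw.exists_isRegularField hk hT.le
  -- `W` is `w` with clamped time: it agrees with `w` on `[0, T]` and is regular and bounded for all
  -- times.
  set W : ℝ → Vec d → Vec d := fun t x => w (projIcc 0 T hT.le t) x with hWdef
  have hwW : ∀ t ∈ Icc 0 T, (fun x => w t x) = W t := fun t ht => by
    simp only [hWdef, projIcc_of_mem hT.le ht]
  have hflow : IsFlow W T Φ := hΦ ▸ isFlow_flow hT.le hW hwW
  have hWd : ∀ t, ContDiff ℝ 1 (W t) := fun t =>
    (w (projIcc 0 T hT.le t)).contDiff.of_le (by exact_mod_cast one_le_two.trans hk)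
  have hWdiv : ∀ t x, divergence (W t) x = 0 := fun t x => by
    by_cases hx : x ∈ D
    · exact hwdiv _ (projIcc 0 T hT.le t).2 x hx
    -- Outside `D` the field vanishes near `x`, since its support lies in the compact set `K ⊆ D`.
    · have h0 : W t =ᶠ[𝓝 x] fun _ => 0 := by
        filter_upwards [K.isCompact.isClosed.isOpen_compl.mem_nhds fun h => hx (hK h)] with y hy
        exact (w (projIcc 0 T hT.le t)).zero_on_compl hy
      simp [divergence, h0.fderiv_eq]
  have hpd := hV.natCast_le
  have hp1 : 1 ≤ p := le_trans (by rcases hd with rfl | rfl <;> norm_num) hpd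
  obtain ⟨b, hbm, M', hb⟩ := hflow.exists_relative_velocity hW hT.le ho hbd hp1 hV.1
  have hbm' : ∀ᵐ t ∂(timeMeasure T), AEStronglyMeasurable (fun y => V t y - W t y)
      (volume.restrict (Φ t '' Ω₀)) ∧
        eLpNorm (fun y => V t y - W t y) p (volume.restrict (Φ t '' Ω₀)) ≤ M' := by
    filter_upwards [hb] with t h
    exact ⟨((hbm.comp_measurable measurable_prodMk_left).aestronglyMeasurable).congr h.1.symm, h.2⟩
  have hdf : (∀ᵐ t ∂(timeMeasure T), WeaklyDivFree (Φ t '' Ω₀) (V t)) →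
      ∀ᵐ t ∂(timeMeasure T), WeaklyDivFree (Φ t '' Ω₀) fun y => V t y - W t y :=
    hflow.weaklyDivFree_relative hW hT.le hbd hWd hWdiv hp1 (by
      filter_upwards [hbm'] with t h
      exact ⟨h.1, h.2.trans_lt ENNReal.coe_lt_top⟩)
  obtain ⟨κ, hκ⟩ := hflow.exists_isAdvecting hd hW hT.le hΩ₀ hbd hC2 hpd hbm'
    -- A finite `p` rules out the second alternative of the assumption, so `V` is weakly divergence
    -- free.
    fun hpt => hdf ((hV.2.resolve_right hpt).2)
  have hconv : ∀ t ∈ Ioo 0 T, ∀ u : VSp (Φ t '' Ω₀),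
      convection (fun t x => w t x) V Φ Ω₀ t u =
        fun x => matVec (jacH (u : H10 (Φ t '' Ω₀)) x) (V t x - W t x) := fun t ht u => by
    rw [convection_eq, ← hwW t (Ioo_subset_Icc_self ht)]
  refine ⟨⟨fun t ht u v => ⟨hflow.integrable_lamForm hW ht u v, hflow.integrable_drift hW ht u v⟩,
    ?_⟩, ⟨fun u v hu hv => ?_, fun u v hu hv => ?_, fun f v hf hv => ?_⟩, ⟨?_, ?_, ?_⟩, ?_⟩
  · filter_upwards [hκ, ae_restrict_mem measurableSet_Ioo] with t h ht u
    obtain ⟨B, hB, -⟩ := h.1.exists_bilin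
    simp only [hconv t ht]
    refine ⟨h.1.integrable _, ⟨_, hB _⟩, fun hp2 v => ⟨h.2 hp2 _ _, ?_⟩⟩
    rw [(hB _).pairing_eq]
    exact (hB _).apply_eq_integral (h.1.integrable _) _ (h.2 hp2 _ _)
  · exact hflow.aemeasurable_aForm hW hT.le ho (hκ.mono fun t h => h.1) hbm
      (hb.mono fun t h => h.1) hwW hu hv
  · obtain ⟨u', hu', hu''⟩ := hflow.exists_ext_of_memL2H hW hT.le ho hu
    obtain ⟨v', hv', hv''⟩ := hflow.exists_ext_of_memL2H hW hT.le ho hv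
    exact aemeasurable_lamForm hW hflow ho hu' hv' hu'' hv''
  · exact hflow.aemeasurable_lForm hW hT.le ho hf hv
  · refine ⟨1 + 1 + κ + L + (L + L : NNReal), ?_⟩
    filter_upwards [hκ, ae_restrict_mem measurableSet_Ioo] with t h ht
    exact hflow.isBilinearBoundedBy_aForm hW ht h.1 (hwW t (Ioo_subset_Icc_self ht))
  · exact ⟨(L + L : NNReal), fun t ht => (hflow.isBilinearBoundedBy_lamForm hW ht).comp (L + L).2
      (HSp _).subtype (HSp _).subtype (fun _ => le_rfl) fun _ => le_rfl⟩
  · exact ⟨1, fun t _ => isBilinearBoundedBy_lForm Φ Ω₀ t⟩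
  · refine ⟨1 / 2, 1 + 3 * L + (M' : ℝ) ^ 2 / 2, by norm_num, by positivity, ?_⟩
    -- In the divergence free case the diagonal of the convective term is zero; for `p = ∞` the
    -- pairing is an integral, bounded with the essential supremum `M'` of the relative velocity.
    have hself : ∀ᵐ t ∂(timeMeasure T), ∀ u : VSp (Φ t '' Ω₀),
        |pairing (Φ t '' Ω₀) (convection (fun t x => w t x) V Φ Ω₀ t u)
          (u : H10 (Φ t '' Ω₀))| ≤ M' * ‖u‖ * ‖fnV u‖ := by
      rcases hV.2 with ⟨-, hdiv⟩ | rfl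
      · filter_upwards [hκ, hdf hdiv, ae_restrict_mem measurableSet_Ioo] with t h h' ht u
        rw [hconv t ht, h.1.pairing_self (fun φ hφ => h'.integral_matVec hφ), abs_zero]
        positivity
      · filter_upwards [hκ, hbm', ae_restrict_mem measurableSet_Ioo] with t h h' ht u
        obtain ⟨B, hB, -⟩ := h.1.exists_bilin
        have hint := h.2 (fun _ => by simp) (u : H10 (Φ t '' Ω₀)) (u : H10 (Φ t '' Ω₀))
        rw [hconv t ht, (hB _).pairing_eq, (hB _).apply_eq_integral (h.1.integrable _) _ hint]
        refine (abs_integral_matVec_le h'.1 h'.2 _ _).trans ?_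
        have := norm_jacH_le (u : H10 (Φ t '' Ω₀))
        exact mul_le_mul_of_nonneg_right (mul_le_mul_of_nonneg_left this M'.2) (norm_nonneg _)
    filter_upwards [hself, ae_restrict_mem measurableSet_Ioo] with t h ht u
    exact hflow.le_aForm hW ht u (h u)
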